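/- Let $m\ge 1$ be a fixed integer. For finite graphs $G_1,\dots,G_m$, the Ramsey number $R(G_1,\dots,G_m)$ is the least $N$ such that every colouring of the edges of the complete graph on $N$ vertices with the colours $1,\dots,m$ contains, for some $1\le i\le m$, a copy of $G_i$ (as a not necessarily induced subgraph) all of whose edges have colour $i$. Then there is a function $f:\mathbb N\to\mathbb R$ with $f(s)=o(s)$ as $s\to\infty$ (depending only on $m$) such that the following holds. Let $T_1,\dots,T_m$ be finite trees, let $k_i=|V(T_i)|$, and suppose that, for each $1\le i\le m$, one of the two colour classes of $T_i$ has size at most $k_i/m$. Then $R(T_1,\dots,T_m)$ exists and $$R(T_1,\dots,T_m)\le \sum_{i=1}^m k_i+f\Bigl(\sum_{i=1}^m k_i\Bigr).$$ -/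

import Mathlib

open Asymptotics

/-- `RamseyArrows N G`: for every colouring of the edges of the complete graph on `N` vertices
with the colours `0, …, m - 1`, there is a colour `i` such that the graph formed by the edges of
colour `i` contains a (not necessarily induced) copy of `G i`. -/
def RamseyArrows {m : ℕ} {V : Fin m → Type*} (N : ℕ) (G : ∀ i, SimpleGraph (V i)) : Prop :=
  ∀ c : SimpleGraph.TopEdgeLabeling (Fin N) (Fin m),
    ∃ i, SimpleGraph.IsContained (G i) (c.labelGraph i)

/-- The Ramsey number `R(G 0, …, G (m - 1))`: the least `N` with `RamseyArrows N G`
(it has this meaning only when such an `N` exists; otherwise the value is `0`). -/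
noncomputable def ramseyNumber {m : ℕ} {V : Fin m → Type*} (G : ∀ i, SimpleGraph (V i)) : ℕ :=
  sInf {N : ℕ | RamseyArrows N G}

/-! Let `N` be a little larger than the total order `s` of the trees. The colour degrees of a vertex
add up to `N - 1`, so every vertex has large degree, `k i` plus a small multiple of `N`, in some
colour, and one colour serves at least `N / m` vertices (`exists_label_card_le`). It remains to
embed one tree into one graph: an asymptotic skew Loebl-Komlós-Sós theorem, `exists_tree_embedding`.

Regularity turns the graph into a weighted graph on clusters (`exists_reduced_graph`). There a set
`L`, containing at least an `r`-fraction of the clusters, has weighted degree more than `κ`. Here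
`κ` stands for the order of the tree and `r * κ` for its smaller class, both slightly enlarged and
in units of the cluster size. The core is the choice of an edge `A B` of clusters to hold the
attaching vertices ("seeds") of the two classes. Components hanging at `B` are rooted in `L`. Those
hanging at `A` are rooted outside `L` as far as a balanced flow can carry their other sides into
`L`, and the rest are rooted in `L`. A component rooted in `L` always finds room for its other side,
because degrees there exceed the total demand. If no edge allowed this, counting the weight between
`L` and the saturated vertices outside `L` in two ways would give a contradiction
(`exists_hub_edge`, `exists_allocation`).

For the embedding, the tree is cut at few seeds into components of bounded size, each touching seeds
of one class only, and all but boundedly many seeds carry few vertices (`exists_tree_cut`). The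
heavy seeds are placed first, at vertices with many common neighbours, and each receives private
regions inside its neighbourhood (`exists_hubs`). The light seeds are placed one at a time in
reservoirs, at vertices typical to what is still free. Components are distributed over pairs of
regions by quotas imitating the fractional allocation (`TreePacking.exists_embedding`).

All thresholds depend only on `m` and the error rate. Hence `f s` can be the excess over `s` of the
least `N` that serves all families of total order `s`. -/

/-! ### Fractional flows and allocations in weighted graphs. -/

/-- A fractional flow along the edges of a bipartite relation, with in-capacity `1` and
out-capacity `ρ`, that is as balanced as possible. -/
theorem exists_fair_flow {ι : Type*} [Fintype ι] [DecidableEq ι] (E : ι → ι → Prop) (ρ : ℝ)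
    (hρ : 0 ≤ ρ) :
    ∃ f : ι → ι → ℝ, (∀ u v, 0 ≤ f u v) ∧ (∀ u v, f u v ≠ 0 → E u v) ∧
      (∀ v, ∑ u, f u v ≤ 1) ∧ (∀ u, ∑ v, f u v ≤ ρ) ∧
      ∀ u v, E u v → ∑ v', f u v' < ρ →
        ∑ u', f u' v = 1 ∧ ∀ u', 0 < f u' v → ∑ v', f u' v' ≤ ∑ v', f u v' := by
  classical
  let K : Set (ι × ι → ℝ) := {f | (∀ p, f p ∈ Set.Icc (0 : ℝ) 1) ∧
    (∀ p, ¬ E p.1 p.2 → f p = 0) ∧ (∀ v, ∑ u, f (u, v) ≤ 1) ∧ ∀ u, ∑ v, f (u, v) ≤ ρ}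
  have hK : IsCompact K := by
    have h1 : IsCompact (Set.univ.pi fun _ : ι × ι => Set.Icc (0 : ℝ) 1) :=
      isCompact_univ_pi fun _ => isCompact_Icc
    refine h1.of_isClosed_subset ?_ fun f hf => fun p _ => hf.1 p
    simp only [K, Set.ofPred_and, Set.ofPred_forall]
    refine IsClosed.inter ?_ (IsClosed.inter ?_ (IsClosed.inter ?_ ?_))
    · exact isClosed_iInter fun p => isClosed_Icc.preimage (continuous_apply p)
    · exact isClosed_iInter fun p => isClosed_iInter fun _ =>
        isClosed_eq (continuous_apply p) continuous_const
    · exact isClosed_iInter fun v => isClosed_le (by fun_prop) continuous_const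
    · exact isClosed_iInter fun v => isClosed_le (by fun_prop) continuous_const
  have hne : K.Nonempty := ⟨0, by simp [K, hρ]⟩
  -- Minimising the sum of squared slacks gives balance: the square is strictly convex, so any
  -- possible shift of flow from a fuller source to an emptier one would lower it.
  let Φ : (ι × ι → ℝ) → ℝ := fun f => ∑ u, (ρ - ∑ v, f (u, v)) ^ 2
  have hΦ : Continuous Φ := by fun_prop
  obtain ⟨f, hf, hmin⟩ := hK.exists_isMinOn hne hΦ.continuousOn
  have hmin' : ∀ g ∈ K, Φ f ≤ Φ g := fun g hg => hmin hg
  obtain ⟨hf1, hf2, hf3, hf4⟩ := hf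
  have hle1 : ∀ g : ι × ι → ℝ, (∀ p, 0 ≤ g p) → (∀ v, ∑ u, g (u, v) ≤ 1) → ∀ p, g p ≤ 1 := by
    intro g hg h p
    exact (Finset.single_le_sum (f := fun u => g (u, p.2)) (fun u _ => hg _)
      (Finset.mem_univ p.1)).trans (h p.2)
  refine ⟨fun u v => f (u, v), fun u v => (hf1 _).1, fun u v h => ?_, hf3, hf4, ?_⟩
  · by_contra hE
    exact h (hf2 (u, v) hE)
  intro u v huv hu
  have hload : ∑ u', f (u', v) = 1 := by
    by_contra hlt
    have hlt : ∑ u', f (u', v) < 1 := lt_of_le_of_ne (hf3 v) hlt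
    obtain ⟨t, ht0, ht1, ht2⟩ : ∃ t : ℝ, 0 < t ∧ t ≤ ρ - ∑ v', f (u, v') ∧
        t ≤ 1 - ∑ u', f (u', v) :=
      ⟨min (ρ - ∑ v', f (u, v')) (1 - ∑ u', f (u', v)),
        lt_min (by linarith) (by linarith), min_le_left _ _, min_le_right _ _⟩
    let g : ι × ι → ℝ := fun p => f p + if p = (u, v) then t else 0
    have hrow : ∀ a, ∑ b, g (a, b) = ∑ b, f (a, b) + if a = u then t else 0 := by
      intro a
      by_cases h : a = u <;> simp [g, Finset.sum_add_distrib, h]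
    have hcol : ∀ b, ∑ a, g (a, b) = ∑ a, f (a, b) + if b = v then t else 0 := by
      intro b
      by_cases h : b = v <;> simp [g, Finset.sum_add_distrib, h]
    have hg0 : ∀ p, 0 ≤ g p := by
      intro p
      have := (hf1 p).1
      simp only [g]; split_ifs <;> linarith
    have hg3 : ∀ b, ∑ a, g (a, b) ≤ 1 := by
      intro b
      rw [hcol]
      split_ifs with h
      · subst h; linarith
      · linarith [hf3 b]
    have hgK : g ∈ K := by
      refine ⟨fun p => ⟨hg0 p, hle1 g hg0 hg3 p⟩, ?_, hg3, ?_⟩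
      · intro p hp
        have : p ≠ (u, v) := by rintro rfl; exact hp huv
        simp [g, this, hf2 p hp]
      · intro a
        rw [hrow]
        split_ifs with h
        · subst h; linarith
        · linarith [hf4 a]
    have := hmin' g hgK
    have hlt2 : Φ g < Φ f := by
      refine Finset.sum_lt_sum (fun a _ => ?_) ⟨u, Finset.mem_univ u, ?_⟩
      · rw [hrow]
        split_ifs with h
        · subst h
          nlinarith
        · simp
      · rw [hrow]
        simp only [if_true]
        nlinarith
    linarith
  refine ⟨hload, fun u' hu' => ?_⟩
  by_contra hlt
  push Not at hlt
  have huu : u' ≠ u := by rintro rfl; exact lt_irrefl _ hlt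
  -- Rerouting `t` from `u'` to `u` changes `Φ` by `2 * t * (t - D)`, with `D` the difference of the
  -- two outflows; hence `t < D`.
  obtain ⟨t, ht0, ht1, ht2⟩ : ∃ t : ℝ, 0 < t ∧ t ≤ f (u', v) ∧
      t < ∑ v', f (u', v') - ∑ v', f (u, v') := by
    refine ⟨min (f (u', v)) ((∑ v', f (u', v') - ∑ v', f (u, v')) / 2),
        lt_min hu' (by linarith), min_le_left _ _, (min_le_right _ _).trans_lt (by linarith)⟩
  let g : ι × ι → ℝ := fun p => f p + (if p = (u, v) then t else 0) -
    if p = (u', v) then t else 0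
  have hrow : ∀ a, ∑ b, g (a, b) =
      ∑ b, f (a, b) + (if a = u then t else 0) - if a = u' then t else 0 := by
    intro a
    have aux : ∀ a u v : ι, ∑ b, (if (a, b) = (u, v) then t else 0) = if a = u then t else 0 := by
      intro a u v
      by_cases h : a = u <;> simp [h]
    simp only [g, Finset.sum_add_distrib, Finset.sum_sub_distrib, aux]
  have hcol : ∀ b, ∑ a, g (a, b) = ∑ a, f (a, b) := by
    intro b
    by_cases h : b = v <;> simp [g, Finset.sum_add_distrib, h]
  have hg0 : ∀ p, 0 ≤ g p := by
    intro p
    have := (hf1 p).1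
    by_cases h : p = (u', v)
    · have h2 : (u', v) ≠ (u, v) := by simp [huu]
      subst h
      simp only [g, h2, if_false, if_true]
      linarith
    · simp only [g, h, if_false]
      split_ifs <;> linarith
  have hg3 : ∀ b, ∑ a, g (a, b) ≤ 1 := fun b => by rw [hcol]; exact hf3 b
  have hgK : g ∈ K := by
    refine ⟨fun p => ⟨hg0 p, hle1 g hg0 hg3 p⟩, ?_, hg3, ?_⟩
    · intro p hp
      have h1 : p ≠ (u, v) := by rintro rfl; exact hp huv
      have h2 : p ≠ (u', v) := by
        rintro rfl
        exact hu'.ne' (hf2 _ hp)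
      simp [g, h1, h2, hf2 p hp]
    · intro a
      rw [hrow]
      have := hf4 a
      have := hf4 u'
      split_ifs with h h' h' <;> subst_vars <;> linarith
  have h1 := hmin' g hgK
  have h2 : Φ g - Φ f < 0 := by
    simp only [Φ]
    rw [← Finset.sum_sub_distrib, ← Finset.sum_erase_add _ _ (Finset.mem_univ u),
      ← Finset.sum_erase_add _ _ (show u' ∈ Finset.univ.erase u by simp [huu])]
    rw [Finset.sum_eq_zero]
    · rw [hrow, hrow]
      simp only [huu, huu.symm, if_true, if_false]
      nlinarith
    · intro a ha
      simp only [Finset.mem_erase, Finset.mem_univ, and_true] at ha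
      rw [hrow]
      simp [ha.1, ha.2]
  linarith

/-- In a weighted graph in which an `r`-fraction `L` of the vertices has degree more than `κ`,
there is an edge `A B` such that `B` has degree at least `r * κ` into `L` and such that the
neighbourhood of `A` is well saturated by a balanced flow from the complement of `L` into `L`. -/
theorem exists_hub_edge {ι : Type*} [Fintype ι] [DecidableEq ι] (w : ι → ι → ℝ)
    (hsymm : ∀ u v, w u v = w v u) (h0 : ∀ u v, 0 ≤ w u v) (κ r : ℝ) (hκ : 0 < κ)
    (hr0 : 0 < r) (hr : r ≤ 1 / 2) (L : Finset ι) (hL : ∀ v ∈ L, κ < ∑ u, w v u)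
    (hcard : r * Fintype.card ι ≤ L.card) (hne : L.Nonempty)
    (f : ι → ι → ℝ) (ρ : ℝ) (hρ : (1 - r) * ρ = r) (f0 : ∀ u v, 0 ≤ f u v)
    (f1 : ∀ u v, f u v ≠ 0 → u ∉ L ∧ v ∈ L ∧ 0 < w u v)
    (f3 : ∀ u, ∑ v, f u v ≤ ρ)
    (f4 : ∀ u v, u ∉ L ∧ v ∈ L ∧ 0 < w u v → ∑ v', f u v' < ρ →
        ∑ u', f u' v = 1 ∧ ∀ u', 0 < f u' v → ∑ v', f u' v' ≤ ∑ v', f u v') :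
    ∃ A ∈ L, ∃ B, 0 < w A B ∧ r * κ ≤ ∑ v ∈ L, w B v ∧
      ((∀ u, u ∉ L → 0 < w A u → ∑ v, f u v = ρ) ∨
        ∃ L' : Finset ι, (∀ v ∈ L', v ∈ L ∧ w B v = 0 ∧
            ∀ u, u ∉ L → 0 < w u v → ∑ v, f u v = ρ) ∧
          (1 - r) * κ - (∑ u ∈ Lᶜ, w A u * ∑ v, f u v) / ρ ≤
            max 0 (∑ v ∈ L', w A v -
              ρ * ∑ u ∈ Lᶜ.filter (fun u => ∑ v, f u v = ρ), w A u)) := by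
  classical
  have hρ0 : 0 < ρ := by
    by_contra h
    push Not at h
    nlinarith
  have hρ1 : ρ ≤ 1 := by
    by_contra h
    push Not at h
    nlinarith
  set τ : ι → ℝ := fun u => ∑ v, f u v with hτ
  have τ0 : ∀ u, 0 ≤ τ u := fun u => Finset.sum_nonneg fun v _ => f0 u v
  -- `S'` and `U` are the saturated and unsaturated vertices outside `L`; `L'` sees no vertex of
  -- `U`, and every vertex of `Q` sees one. If no edge is suitable, the weight between `S'` and `L`
  -- is estimated from both ends.
  set L' := L.filter (fun v => ∀ u, u ∉ L → 0 < w u v → τ u = ρ) with hL'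
  set Q := L.filter (fun v => ¬ ∀ u, u ∉ L → 0 < w u v → τ u = ρ) with hQ
  set S' := Lᶜ.filter (fun u => τ u = ρ) with hS'
  set U := Lᶜ.filter (fun u => ¬ τ u = ρ) with hU
  have sumL : ∀ F : ι → ℝ, ∑ v ∈ L, F v = ∑ v ∈ L', F v + ∑ v ∈ Q, F v := fun F =>
    (Finset.sum_filter_add_sum_filter_not _ _ _).symm
  have sumS : ∀ F : ι → ℝ, ∑ v ∈ Lᶜ, F v = ∑ v ∈ S', F v + ∑ v ∈ U, F v := fun F =>
    (Finset.sum_filter_add_sum_filter_not _ _ _).symm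
  have sumAll : ∀ F : ι → ℝ, ∑ v, F v =
      ∑ v ∈ L', F v + ∑ v ∈ Q, F v + (∑ v ∈ S', F v + ∑ v ∈ U, F v) := fun F => by
    rw [← sumL, ← sumS, Finset.sum_add_sum_compl]
  have hUlt : ∀ u ∈ U, τ u < ρ := fun u hu =>
    lt_of_le_of_ne (f3 u) (Finset.mem_filter.1 hu).2
  have hUL : ∀ u ∈ U, u ∉ L := fun u hu => by simpa using (Finset.mem_filter.1 hu).1
  have hSL : ∀ u ∈ S', u ∉ L := fun u hu => by simpa using (Finset.mem_filter.1 hu).1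
  have hQU : ∀ v ∈ Q, ∃ u ∈ U, 0 < w u v := by
    intro v hv
    obtain ⟨hv1, hv2⟩ := Finset.mem_filter.1 hv
    push Not at hv2
    obtain ⟨u, hu1, hu2, hu3⟩ := hv2
    exact ⟨u, by simp [hU, hu1, hu3], hu2⟩
  have hUQ : ∀ u ∈ U, ∀ v ∈ L, 0 < w u v → v ∈ Q := by
    intro u hu v hv h
    refine Finset.mem_filter.2 ⟨hv, fun hall => ?_⟩
    exact (hUlt u hu).ne (hall u (hUL u hu) h)
  have hfQ : ∀ v ∈ Q, ∑ u, f u v = 1 := by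
    intro v hv
    obtain ⟨u, hu, huv⟩ := hQU v hv
    exact (f4 u v ⟨hUL u hu, (Finset.mem_filter.1 hv).1, huv⟩ (hUlt u hu)).1
  have hfle : ∀ v ∈ Q, ∀ u', 0 < f u' v → ∀ u, u ∉ L → 0 < w u v → τ u' ≤ τ u := by
    intro v hv u' hu' u hu huv
    by_cases h : τ u = ρ
    · rw [h]; exact f3 u'
    · exact (f4 u v ⟨hu, (Finset.mem_filter.1 hv).1, huv⟩ (lt_of_le_of_ne (f3 u) h)).2 u' hu'
  have hfU : ∀ v ∈ Q, ∀ u', 0 < f u' v → u' ∈ U := by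
    intro v hv u' hu'
    obtain ⟨u, hu, huv⟩ := hQU v hv
    have h1 := hfle v hv u' hu' u (hUL u hu) huv
    have h2 := hUlt u hu
    have h3 := (f1 u' v hu'.ne').1
    simp only [hU, Finset.mem_filter, Finset.mem_compl]
    exact ⟨h3, by linarith⟩
  have hQsum : ∀ v ∈ Q, ∑ u ∈ U, f u v = 1 := by
    intro v hv
    rw [← hfQ v hv]
    refine Finset.sum_subset (Finset.subset_univ _) fun u _ hu => ?_
    by_contra h
    exact hu (hfU v hv u (lt_of_le_of_ne (f0 u v) (Ne.symm h)))
  have hUsum : ∀ u ∈ U, ∑ v ∈ Q, f u v = τ u := by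
    intro u hu
    refine Finset.sum_subset (Finset.subset_univ _) fun v _ hv => ?_
    by_contra h
    exact hv (hUQ u hu v (f1 u v h).2.1 (f1 u v h).2.2)
  have hQcard : (Q.card : ℝ) = ∑ u ∈ U, τ u := by
    rw [← Finset.sum_congr rfl hUsum, Finset.sum_comm, Finset.sum_congr rfl hQsum]
    simp
  have hc1 : (Fintype.card ι : ℝ) = L'.card + Q.card + (S'.card + U.card) := by
    have := sumAll (fun _ => 1)
    simpa using this
  have hc2 : (L.card : ℝ) = L'.card + Q.card := by
    have := sumL (fun _ => 1)
    simpa using this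
  have hdef : ∑ u ∈ U, (ρ - τ u) = ρ * U.card - Q.card := by
    rw [Finset.sum_sub_distrib, hQcard]; simp [mul_comm]
  -- The flow into `Q` comes from `U` only and has total `Q.card`. So `hcard` says that the vertices
  -- of `L'` pay for `S'` and for the slack left in `U`.
  have hstar : r * S'.card + (1 - r) * ∑ u ∈ U, (ρ - τ u) ≤ (1 - r) * L'.card := by
    rw [hc1, hc2] at hcard
    rw [hdef]
    have : (1 - r) * (ρ * (U.card : ℝ)) = r * U.card := by rw [← mul_assoc, hρ]
    nlinarith
  have hL'ne : L'.Nonempty := by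
    by_contra hempty
    rw [Finset.not_nonempty_iff_eq_empty] at hempty
    rw [hempty] at hstar
    simp only [Finset.card_empty, Nat.cast_zero, mul_zero] at hstar
    have hUe : U = ∅ := by
      by_contra hUne
      have : 0 < ∑ u ∈ U, (ρ - τ u) := Finset.sum_pos (fun u hu => by linarith [hUlt u hu])
        (Finset.nonempty_iff_ne_empty.2 hUne)
      have : (0 : ℝ) ≤ r * S'.card := mul_nonneg hr0.le (Nat.cast_nonneg _)
      nlinarith
    obtain ⟨v, hv⟩ := hne
    have hvQ : v ∈ Q := by
      refine Finset.mem_filter.2 ⟨hv, fun h => ?_⟩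
      have : v ∈ L' := Finset.mem_filter.2 ⟨hv, h⟩
      rw [hempty] at this
      simp at this
    obtain ⟨u, hu, -⟩ := hQU v hvQ
    rw [hUe] at hu
    simp at hu
  by_contra hno
  push Not at hno
  -- A vertex of `L'` satisfies the first alternative with every neighbour `B`, so it must be the
  -- degree of `B` into `L` that fails.
  have hI : ∀ A ∈ L', ∀ B, 0 < w A B → ∑ v ∈ L, w B v < r * κ := by
    intro A hA B hAB
    by_contra h
    push Not at h
    obtain ⟨hA1, hA2⟩ := Finset.mem_filter.1 hA
    obtain ⟨u, hu1, hu2, hu3⟩ := (hno A hA1 B hAB h).1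
    exact hu3 (hA2 u hu1 (by rwa [hsymm]))
  have hII : ∀ A ∈ Q, ∀ B, 0 < w A B → r * κ ≤ ∑ v ∈ L, w B v → (∀ v ∈ L', w B v = 0) →
      max 0 (∑ v ∈ L', w A v - ρ * ∑ u ∈ S', w A u) <
        (1 - r) * κ - (∑ u ∈ Lᶜ, w A u * τ u) / ρ := by
    intro A hA B hAB h hB
    refine (hno A (Finset.mem_filter.1 hA).1 B hAB h).2 L' fun v hv => ?_
    exact ⟨(Finset.mem_filter.1 hv).1, hB v hv, (Finset.mem_filter.1 hv).2⟩
  -- A saturated vertex feeds some `v ∈ L`. This `v` is not in `Q`, which is fed from `U` only, so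
  -- `hI` applies to it.
  have hS'deg : ∑ u ∈ S', ∑ v ∈ L, w u v ≤ r * κ * S'.card := by
    have : ∀ u ∈ S', ∑ v ∈ L, w u v ≤ r * κ := by
      intro u hu
      have hu' : τ u = ρ := (Finset.mem_filter.1 hu).2
      obtain ⟨v, -, hv⟩ : ∃ v ∈ Finset.univ, 0 < f u v := by
        refine Finset.exists_lt_of_sum_lt (f := fun _ => (0 : ℝ)) ?_
        simpa using (by rw [hu']; exact hρ0 : 0 < τ u)
      have hfv := f1 u v hv.ne'
      have hvL' : v ∈ L' := by
        by_contra h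
        have hvQ : v ∈ Q :=
          Finset.mem_filter.2 ⟨hfv.2.1, fun h' => h (Finset.mem_filter.2 ⟨hfv.2.1, h'⟩)⟩
        exact (hUlt u (hfU v hvQ u hv)).ne hu'
      exact (hI v hvL' u (by rw [hsymm]; exact hfv.2.2)).le
    calc _ ≤ ∑ u ∈ S', r * κ := Finset.sum_le_sum this
      _ = _ := by simp [mul_comm]
  -- Only vertices of `L2` can send less than `(1 - r) * κ` to `S'`. By `hI` they have no neighbours
  -- in `L'`, so the deficit is covered by their weight to `Q` and is charged there.
  set L2 := L'.filter (fun v => r * κ ≤ ∑ u ∈ L, w v u) with hL2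
  have hL2L' : ∀ A ∈ L2, ∀ v ∈ L', w A v = 0 := by
    intro A hA v hv
    by_contra h
    have := hI v hv A (by rw [hsymm]; exact lt_of_le_of_ne (h0 A v) (Ne.symm h))
    linarith [(Finset.mem_filter.1 hA).2]
  have hL'U : ∀ A ∈ L', ∑ u ∈ U, w A u = 0 := by
    intro A hA
    refine Finset.sum_eq_zero fun u hu => ?_
    by_contra h
    have := (Finset.mem_filter.1 hA).2 u (hUL u hu)
      (by rw [hsymm]; exact lt_of_le_of_ne (h0 A u) (Ne.symm h))
    exact (hUlt u hu).ne this
  have hL'deg : ∀ A ∈ L', (1 - r) * κ + (if A ∈ L2 then r * κ - ∑ v ∈ Q, w A v else 0) <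
      ∑ u ∈ S', w A u := by
    intro A hA
    have h1 := hL A (Finset.mem_filter.1 hA).1
    rw [sumAll, hL'U A hA] at h1
    split_ifs with h
    · rw [Finset.sum_eq_zero (hL2L' A h)] at h1
      linarith
    · have h2 : ∑ u ∈ L, w A u < r * κ := by
        by_contra h'
        exact h (Finset.mem_filter.2 ⟨hA, not_lt.1 h'⟩)
      rw [sumL] at h2
      linarith
  have hsumlt := Finset.sum_lt_sum_of_nonempty hL'ne hL'deg
  rw [Finset.sum_add_distrib, ← Finset.sum_filter, Finset.filter_mem_eq_inter,
    Finset.inter_eq_right.2 (Finset.filter_subset _ _), Finset.sum_sub_distrib] at hsumlt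
  simp only [Finset.sum_const, nsmul_eq_mul] at hsumlt
  have hdc : ∑ u ∈ S', ∑ v ∈ L, w u v = ∑ A ∈ L', ∑ u ∈ S', w A u + ∑ A ∈ Q, ∑ u ∈ S', w A u := by
    rw [Finset.sum_congr rfl fun u _ => sumL _, Finset.sum_add_distrib,
      Finset.sum_comm (s := S') (t := L'), Finset.sum_comm (s := S') (t := Q)]
    congr 1 <;> exact Finset.sum_congr rfl fun _ _ => Finset.sum_congr rfl fun _ _ => hsymm _ _
  -- If `A` has a neighbour in `L2`, the second alternative fails for that edge. By balance every
  -- neighbour of `A` outside `L` has outflow at least that of any `u'` feeding `A`, which turns the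
  -- failure into a bound by the slack of `u'`.
  have hQL2 : ∀ A ∈ Q, ∀ u', 0 < f u' A →
      ∑ v ∈ L2, w A v ≤ ∑ u ∈ S', w A u + (1 - r) * κ * (1 - τ u' / ρ) := by
    intro A hA u' hu'
    have hS0 : 0 ≤ ∑ u ∈ S', w A u := Finset.sum_nonneg fun u _ => h0 A u
    have ht1 : τ u' / ρ ≤ 1 := by rw [div_le_one hρ0]; exact f3 u'
    have ht0 : 0 ≤ τ u' / ρ := div_nonneg (τ0 _) hρ0.le
    by_cases hB : ∃ B ∈ L2, 0 < w A B
    · obtain ⟨B, hB, hAB⟩ := hB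
      obtain ⟨hB1, hB2⟩ := Finset.mem_filter.1 hB
      have hlt := hII A hA B hAB hB2 (hL2L' B hB)
      have hdegA : ∑ v ∈ L, w A v < r * κ := hI B hB1 A (by rwa [hsymm])
      have hdeg := hL A (Finset.mem_filter.1 hA).1
      rw [sumAll, ← sumL] at hdeg
      set q1 := ∑ u ∈ S', w A u
      set q2 := ∑ u ∈ U, w A u
      have hg : q1 + q2 * (τ u' / ρ) ≤ (∑ u ∈ Lᶜ, w A u * τ u) / ρ := by
        rw [sumS, add_div]
        have e1 : (∑ u ∈ S', w A u * τ u) / ρ = q1 := by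
          rw [div_eq_iff hρ0.ne', Finset.sum_mul]
          refine Finset.sum_congr rfl fun u hu => ?_
          rw [(Finset.mem_filter.1 hu).2]
        have e2 : q2 * (τ u' / ρ) ≤ (∑ u ∈ U, w A u * τ u) / ρ := by
          rw [← mul_div_assoc, Finset.sum_mul]
          refine div_le_div_of_nonneg_right (Finset.sum_le_sum fun u hu => ?_) hρ0.le
          by_cases h : w A u = 0
          · simp [h]
          · have hpos := lt_of_le_of_ne (h0 A u) (Ne.symm h)
            exact mul_le_mul_of_nonneg_left
              (hfle A hA u' hu' u (hUL u hu) (by rwa [hsymm])) (h0 A u)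
        linarith
      have hm1 := (le_max_left 0 _).trans_lt hlt
      have hm2 := (le_max_right 0 _).trans_lt hlt
      have hle : ∑ v ∈ L2, w A v ≤ ∑ v ∈ L', w A v :=
        Finset.sum_le_sum_of_subset_of_nonneg (Finset.filter_subset _ _) fun v _ _ => h0 A v
      have hq2 : (1 - r) * κ - q1 < q2 := by linarith
      have : ((1 - r) * κ - q1) * (τ u' / ρ) ≤ q2 * (τ u' / ρ) :=
        mul_le_mul_of_nonneg_right hq2.le ht0
      have h5 : ρ * q1 ≤ q1 := by nlinarith
      have h6 : 0 ≤ q1 * (1 - τ u' / ρ) := mul_nonneg hS0 (by linarith)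
      nlinarith
    · push Not at hB
      rw [Finset.sum_eq_zero fun v hv => le_antisymm (hB v hv) (h0 A v)]
      have : 0 ≤ (1 - r) * κ * (1 - τ u' / ρ) :=
        mul_nonneg (mul_nonneg (by linarith) hκ.le) (by linarith)
      linarith
  -- The bound for `A` is averaged over the sources `u'` with weights `f u' A`, which add up to `1`.
  have hfin : ∑ A ∈ Q, ∑ v ∈ L2, w A v ≤
      ∑ A ∈ Q, ∑ u ∈ S', w A u + (1 - r) * κ * ∑ u ∈ U, (ρ - τ u) := by
    calc ∑ A ∈ Q, ∑ v ∈ L2, w A v = ∑ A ∈ Q, ∑ u' ∈ U, f u' A * ∑ v ∈ L2, w A v := by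
          refine Finset.sum_congr rfl fun A hA => ?_
          rw [← Finset.sum_mul, hQsum A hA, one_mul]
      _ ≤ ∑ A ∈ Q, ∑ u' ∈ U,
            f u' A * (∑ u ∈ S', w A u + (1 - r) * κ * (1 - τ u' / ρ)) := by
          refine Finset.sum_le_sum fun A hA => Finset.sum_le_sum fun u' hu' => ?_
          by_cases h : f u' A = 0
          · simp [h]
          · exact mul_le_mul_of_nonneg_left
              (hQL2 A hA u' (lt_of_le_of_ne (f0 _ _) (Ne.symm h))) (f0 _ _)
      _ = ∑ A ∈ Q, ∑ u ∈ S', w A u + ∑ u' ∈ U, τ u' * ((1 - r) * κ * (1 - τ u' / ρ)) := by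
          simp only [mul_add, Finset.sum_add_distrib]
          congr 1
          · refine Finset.sum_congr rfl fun A hA => ?_
            rw [← Finset.sum_mul, hQsum A hA, one_mul]
          · rw [Finset.sum_comm]
            refine Finset.sum_congr rfl fun u' hu' => ?_
            rw [← Finset.sum_mul, hUsum u' hu']
      _ ≤ _ := by
          rw [Finset.mul_sum]
          refine add_le_add le_rfl (Finset.sum_le_sum fun u' _ => ?_)
          have h1 : τ u' * (1 - τ u' / ρ) ≤ ρ - τ u' := by
            have e : ρ - τ u' = ρ * (1 - τ u' / ρ) := by field_simp
            rw [e]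
            refine mul_le_mul_of_nonneg_right (f3 u') ?_
            rw [sub_nonneg, div_le_one hρ0]
            exact f3 u'
          have h2 : 0 ≤ (1 - r) * κ := mul_nonneg (by linarith) hκ.le
          have h3 := mul_le_mul_of_nonneg_left h1 h2
          linarith
  have hcomm : ∑ A ∈ L2, ∑ v ∈ Q, w A v = ∑ A ∈ Q, ∑ v ∈ L2, w A v := by
    rw [Finset.sum_comm]
    exact Finset.sum_congr rfl fun _ _ => Finset.sum_congr rfl fun _ _ => hsymm _ _
  have hL2c : (0 : ℝ) ≤ L2.card * (r * κ) :=
    mul_nonneg (Nat.cast_nonneg _) (mul_nonneg hr0.le hκ.le)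
  -- From `S'` the weight is at most `r * κ * S'.card`. From `L` it exceeds `(1 - r) * κ * (L'.card
  -- - ∑ u ∈ U, (ρ - τ u))`, which by `hstar` is at least the same number.
  rw [hdc] at hS'deg
  rw [← hL2, hcomm] at hsumlt
  have hfs := mul_le_mul_of_nonneg_right hstar hκ.le
  clear_value L' Q S' U L2
  clear hI hII hno hQL2 hQsum hUsum sumL sumS sumAll hL2L' hL'deg hfle f4
  linarith

/-- Demands at vertices of large degree can be greedily distributed over their neighbourhoods. -/
theorem exists_greedy_extension {ι : Type*} [Fintype ι] [DecidableEq ι] (w : ι → ι → ℝ)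
    (h0 : ∀ u v, 0 ≤ w u v) (h1 : ∀ u v, w u v ≤ 1) (κ : ℝ) (s : Finset ι)
    (hs : ∀ v ∈ s, κ < ∑ u, w v u) (l : ι → ℝ) (l0 : ∀ u, 0 ≤ l u) (l1 : ∀ u, l u ≤ 1)
    (e : ι → ℝ) (he : ∀ v, 0 ≤ e v) (htot : ∑ u, l u + ∑ v ∈ s, e v ≤ κ) :
    ∃ h : ι → ι → ℝ, (∀ v u, 0 ≤ h v u) ∧ (∀ v u, h v u ≠ 0 → v ∈ s ∧ 0 < w v u) ∧
      (∀ v ∈ s, ∑ u, h v u = e v) ∧ ∀ u, l u + ∑ v, h v u ≤ 1 := by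
  classical
  induction s using Finset.induction_on with
  | empty => exact ⟨fun _ _ => 0, by simp, by simp, by simp, by simpa using l1⟩
  | insert a s ha ih =>
    rw [Finset.sum_insert ha] at htot
    obtain ⟨h, g0, g1, g2, g3⟩ := ih (fun v hv => hs v (Finset.mem_insert_of_mem hv))
      (by linarith [he a])
    set c : ι → ℝ := fun u => if 0 < w a u then 1 - (l u + ∑ v, h v u) else 0 with hc
    have c0 : ∀ u, 0 ≤ c u := by
      intro u
      simp only [hc]
      split_ifs
      · linarith [g3 u]
      · exact le_rfl
    have hload : ∑ u, (l u + ∑ v, h v u) = ∑ u, l u + ∑ v ∈ s, e v := by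
      rw [Finset.sum_add_distrib, Finset.sum_comm]
      congr 1
      rw [← Finset.sum_subset (Finset.subset_univ s)]
      · exact Finset.sum_congr rfl g2
      · intro v _ hv
        refine Finset.sum_eq_zero fun u _ => ?_
        by_contra hne
        exact hv (g1 v u hne).1
    -- As weights are at most `1`, the free capacity next to `a` is at least its degree minus the
    -- whole present load, and `htot` leaves more than `e a`.
    have hC : e a < ∑ u, c u := by
      have : ∑ u, (w a u - (l u + ∑ v, h v u)) ≤ ∑ u, c u := by
        refine Finset.sum_le_sum fun u _ => ?_
        have hl : 0 ≤ l u + ∑ v, h v u :=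
          add_nonneg (l0 u) (Finset.sum_nonneg fun v _ => g0 v u)
        simp only [hc]
        split_ifs with hw
        · linarith [h1 a u]
        · have := le_antisymm (not_lt.1 hw) (h0 a u)
          linarith
      rw [Finset.sum_sub_distrib, hload] at this
      linarith [hs a (Finset.mem_insert_self a s)]
    have hC0 : 0 < ∑ u, c u := (he a).trans_lt hC
    -- The demand of `a` is spread in proportion to the free capacities.
    refine ⟨fun v u => h v u + if v = a then e a * c u / ∑ u, c u else 0, ?_, ?_, ?_, ?_⟩
    · intro v u
      have := g0 v u
      have := he a
      have := c0 u
      dsimp only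
      split_ifs
      · positivity
      · linarith
    · intro v u hne
      by_cases hv : v = a
      · subst hv
        refine ⟨Finset.mem_insert_self v s, ?_⟩
        by_contra hw
        have h2 : h v u = 0 := by
          by_contra hh
          exact ha (g1 v u hh).1
        apply hne
        simp [hc, hw, h2]
      · simp only [hv, if_false, add_zero] at hne
        exact ⟨Finset.mem_insert_of_mem (g1 v u hne).1, (g1 v u hne).2⟩
    · intro v hv
      rw [Finset.sum_add_distrib]
      by_cases hva : v = a
      · subst hva
        have h2 : ∀ u, h v u = 0 := by
          intro u
          by_contra hh
          exact ha (g1 v u hh).1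
        simp only [h2, Finset.sum_const_zero, if_true, zero_add, ← Finset.sum_div,
          ← Finset.mul_sum]
        field_simp
      · simp only [hva, if_false, Finset.sum_const_zero, add_zero]
        exact g2 v (Finset.mem_of_mem_insert_of_ne hv hva)
    · intro u
      rw [Finset.sum_add_distrib, Finset.sum_ite_eq' Finset.univ a]
      simp only [Finset.mem_univ, if_true]
      have h3 : e a * c u / ∑ u, c u ≤ c u := by
        rw [div_le_iff₀ hC0, mul_comm]
        exact mul_le_mul_of_nonneg_left hC.le (c0 u)
      by_cases hw : 0 < w a u
      · simp only [hc, hw, if_true] at h3 ⊢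
        linarith
      · simp only [hc, hw, if_false] at h3 ⊢
        have := g3 u
        simp only [mul_zero, zero_div]
        linarith

set_option maxHeartbeats 1000000 in
/-- The fractional packing of the components of a cut tree into a weighted graph in which an
`r`-fraction of the vertices has degree more than `κ`. -/
theorem exists_allocation {ι : Type*} [Fintype ι] [DecidableEq ι] (w : ι → ι → ℝ)
    (hsymm : ∀ u v, w u v = w v u) (h0 : ∀ u v, 0 ≤ w u v) (h1 : ∀ u v, w u v ≤ 1)
    (κ r : ℝ) (hκ : 0 < κ) (hr0 : 0 < r) (hr : r ≤ 1 / 2) (L : Finset ι)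
    (hL : ∀ v ∈ L, κ < ∑ u, w v u) (hcard : r * Fintype.card ι ≤ L.card) (hne : L.Nonempty)
    (a₁ a₂ b₁ b₂ : ℝ) (ha₁ : 0 < a₁) (ha₂ : 0 < a₂) (hb₁ : 0 < b₁) (hb₂ : 0 < b₂)
    (hx : a₂ + b₁ ≤ r * κ) (hy : a₁ + b₂ ≤ (1 - r) * κ) :
    ∃ (A B : ι) (α β : ι → ι → ℝ), 0 < w A B ∧ (∀ i j, 0 ≤ α i j) ∧ (∀ i j, 0 ≤ β i j) ∧
      (∀ i j, 0 < α i j → 0 < w A i ∧ 0 < w i j) ∧ (∀ i j, 0 < β i j → 0 < w B i ∧ 0 < w i j) ∧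
      ∑ i, ∑ j, α i j = 1 ∧ ∑ i, ∑ j, β i j = 1 ∧
      (∀ i, a₁ * ∑ j, α i j + a₂ * ∑ j, α j i + b₁ * ∑ j, β i j + b₂ * ∑ j, β j i ≤ 1) ∧
      (∀ i, b₁ * ∑ j, β i j ≤ w B i) ∧
      ∀ i, (∃ j, 0 < α i j) → a₁ * ∑ j, α i j + b₁ * ∑ j, β i j ≤ w A i := by
  classical
  have hr1 : 0 < 1 - r := by linarith
  set ρ := r / (1 - r) with hρdef
  have hρ : (1 - r) * ρ = r := by rw [hρdef]; field_simp
  have hρ0 : 0 < ρ := by positivity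
  obtain ⟨f, f0, f1, f2, f3, f4⟩ :=
    exists_fair_flow (fun u v => u ∉ L ∧ v ∈ L ∧ 0 < w u v) ρ hρ0.le
  obtain ⟨A, hA, B, hAB, hp', hcases⟩ := exists_hub_edge w hsymm h0 κ r hκ hr0 hr L hL hcard hne
    f ρ hρ f0 f1 f3 f4
  set τ : ι → ℝ := fun u => ∑ v, f u v with hτ
  have τ0 : ∀ u, 0 ≤ τ u := fun u => Finset.sum_nonneg fun v _ => f0 u v
  have τL : ∀ u ∈ L, ∀ v, f u v = 0 := by
    intro u hu v
    by_contra h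
    exact (f1 u v h).1 hu
  set p' := ∑ v ∈ L, w B v with hp'def
  have hrκ : 0 < r * κ := by positivity
  have hr1κ : 0 < (1 - r) * κ := by positivity
  have hp'0 : 0 < p' := hrκ.trans_le hp'
  -- Components at `B` are rooted in `L` in proportion to the weights. The degree `p' ≥ r * κ ≥ b₁`
  -- keeps the load at `v` below `w B v`.
  set wB : ι → ℝ := fun v => if v ∈ L then w B v / p' else 0 with hwB
  have wB0 : ∀ v, 0 ≤ wB v := by
    intro v
    simp only [hwB]
    split_ifs
    · exact div_nonneg (h0 _ _) hp'0.le
    · exact le_rfl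
  have wBsum : ∑ v, wB v = 1 := by
    simp only [hwB]
    rw [Finset.sum_ite_mem, Finset.univ_inter, ← Finset.sum_div]
    exact div_self hp'0.ne'
  have wBle : ∀ v, wB v * (r * κ) ≤ w B v := by
    intro v
    simp only [hwB]
    split_ifs
    · rw [div_mul_eq_mul_div, div_le_iff₀ hp'0]
      exact mul_le_mul_of_nonneg_left hp' (h0 _ _)
    · simpa using h0 B v
  set G := ∑ u, w A u * τ u with hG
  have hGL : ∑ u ∈ Lᶜ, w A u * τ u = G := by
    have : ∑ u ∈ L, w A u * τ u = 0 :=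
      Finset.sum_eq_zero fun u hu => by simp [hτ, τL u hu]
    rw [hG, ← Finset.sum_add_sum_compl L, this, zero_add]
  rw [show (∑ u ∈ Lᶜ, w A u * ∑ v, f u v) = G from hGL] at hcases
  have hG0 : 0 ≤ G := Finset.sum_nonneg fun u _ => mul_nonneg (h0 _ _) (τ0 u)
  -- Sending the components at `A` along the whole flow would use root mass `G / (r * κ)`; `s`
  -- scales this down when it exceeds `1`.
  obtain ⟨s, hs0, hs1, hsG, hs2⟩ : ∃ s : ℝ, 0 ≤ s ∧ s ≤ 1 ∧ s * G ≤ r * κ ∧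
      (s = 1 ∨ s * G = r * κ) := by
    rcases le_or_gt G (r * κ) with h | h
    · exact ⟨1, zero_le_one, le_rfl, by linarith, Or.inl rfl⟩
    · have hGpos := hrκ.trans h
      refine ⟨r * κ / G, by positivity, by rw [div_le_one hGpos]; exact h.le, ?_, Or.inr ?_⟩ <;>
      rw [div_mul_cancel₀ _ hGpos.ne']
  set m : ι → ℝ := fun v => a₂ * ∑ u, f u v * w A u / (r * κ) with hm
  have m0 : ∀ v, 0 ≤ m v := fun v => mul_nonneg ha₂.le
    (Finset.sum_nonneg fun u _ => div_nonneg (mul_nonneg (f0 _ _) (h0 _ _)) hrκ.le)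
  have hm' : ∀ v, m v * (r * κ) = a₂ * ∑ u, f u v * w A u := by
    intro v
    simp only [hm]
    rw [← Finset.sum_div]
    field_simp
  have mle : ∀ v, m v * (r * κ) ≤ a₂ := by
    intro v
    rw [hm']
    have : ∑ u, f u v * w A u ≤ 1 := by
      refine le_trans (Finset.sum_le_sum fun u _ => ?_) (f2 v)
      exact mul_le_of_le_one_right (f0 _ _) (h1 _ _)
    nlinarith
  have msum : (∑ v, m v) * (r * κ) = a₂ * G := by
    rw [Finset.sum_mul, Finset.sum_congr rfl fun v _ => hm' v, ← Finset.mul_sum,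
      Finset.sum_comm]
    congr 1
    refine Finset.sum_congr rfl fun u _ => ?_
    rw [← Finset.sum_mul, mul_comm]
  -- The room at `v ∈ L` for roots of components at `A`, once the roots from `B` and the other sides
  -- carried by the unscaled flow are provided for.
  set hv : ι → ℝ := fun v => if v ∈ L then max 0 (w A v - b₁ * wB v - m v) else 0 with hhv
  have hv0 : ∀ v, 0 ≤ hv v := by
    intro v
    simp only [hhv]
    split_ifs
    · exact le_max_left _ _
    · exact le_rfl
  have hvge : ∀ v ∈ L, w A v - b₁ * wB v - m v ≤ hv v := by
    intro v hvL
    simp only [hhv, hvL, if_true]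
    exact le_max_right _ _
  have hvle : ∀ v, hv v ≠ 0 → v ∈ L ∧ hv v = w A v - b₁ * wB v - m v := by
    intro v hne
    simp only [hhv] at hne ⊢
    split_ifs at hne ⊢ with hvL
    · refine ⟨hvL, ?_⟩
      rcases max_choice 0 (w A v - b₁ * wB v - m v) with h | h
      · exact absurd h hne
      · exact h
    · exact absurd rfl hne
  set H := ∑ v, hv v with hH
  have hH0 : 0 ≤ H := Finset.sum_nonneg fun v _ => hv0 v
  have hHsub : ∀ s : Finset ι, s ⊆ L → ∑ v ∈ s, (w A v - b₁ * wB v - m v) ≤ H := by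
    intro s hs
    refine le_trans (Finset.sum_le_sum fun v hvs => hvge v (hs hvs)) ?_
    exact Finset.sum_le_sum_of_subset_of_nonneg (Finset.subset_univ s) fun v _ _ => hv0 v
  -- the amount of root mass left for `L`
  set z := 1 - s * G / (r * κ) with hz
  have hz0 : 0 ≤ z := by
    rw [hz, sub_nonneg, div_le_one hrκ]
    exact hsG
  have ha₁le : a₁ ≤ (1 - r) * κ := by linarith
  have ha₂le : a₂ ≤ r * κ := by linarith
  have hzH : a₁ * z ≤ H := by
    rcases hs2 with hs2 | hs2
    swap
    · rw [hz, hs2, div_self hrκ.ne', sub_self, mul_zero]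
      exact hH0
    have hzG : z * ((1 - r) * κ) = (1 - r) * κ - G / ρ := by
      rw [hz, hs2, one_mul, hρdef]
      field_simp
    have hzle : a₁ * z ≤ (1 - r) * κ - G / ρ := by
      rw [← hzG, mul_comm z]
      exact mul_le_mul_of_nonneg_right ha₁le hz0
    -- In the first case `G` is `ρ` times the weight `q` from `A` to the outside of `L`, and `H > (1
    -- - r) * κ - q` since the other loads are at most `b₁ + a₂ ≤ r * κ`. In the second case `L'` is
    -- free of roots from `B`, and only saturated sources send other sides there.
    rcases hcases with hc | ⟨L', hL', hc⟩
    · have hGq : G = ρ * ∑ u ∈ Lᶜ, w A u := by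
        rw [← hGL, Finset.mul_sum]
        refine Finset.sum_congr rfl fun u hu => ?_
        by_cases h : w A u = 0
        · simp [h]
        · have := hc u (by simpa using hu) (lt_of_le_of_ne (h0 A u) (Ne.symm h))
          simp only [hτ]
          rw [this, mul_comm]
      have hdeg := hL A hA
      rw [← Finset.sum_add_sum_compl L] at hdeg
      set q := ∑ u ∈ Lᶜ, w A u
      have h2 := hHsub L subset_rfl
      rw [Finset.sum_sub_distrib, Finset.sum_sub_distrib, ← Finset.mul_sum] at h2
      have h3 : ∑ v ∈ L, wB v ≤ 1 := by
        rw [← wBsum]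
        exact Finset.sum_le_sum_of_subset_of_nonneg (Finset.subset_univ _) fun v _ _ => wB0 v
      have h4 : ∑ v ∈ L, m v ≤ ∑ v, m v :=
        Finset.sum_le_sum_of_subset_of_nonneg (Finset.subset_univ _) fun v _ _ => m0 v
      rw [hGq] at msum hzle
      rw [mul_div_cancel_left₀ _ hρ0.ne'] at hzle
      have h5 : (1 - r) * κ - q ≥ 0 := by
        have := hzG
        rw [hGq, mul_div_cancel_left₀ _ hρ0.ne'] at this
        rw [ge_iff_le, ← this]
        positivity
      -- total mate load is `a₂ * q / ((1 - r) κ)`, at most `a₂`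
      have h6 : ∑ v, m v ≤ a₂ := by
        have : (∑ v, m v) * (r * κ) ≤ a₂ * (r * κ) := by
          rw [msum]
          refine mul_le_mul_of_nonneg_left ?_ ha₂.le
          calc ρ * q ≤ ρ * ((1 - r) * κ) := mul_le_mul_of_nonneg_left (by linarith) hρ0.le
            _ = (1 - r) * ρ * κ := by ring
            _ = r * κ := by rw [hρ]
        exact le_of_mul_le_mul_right this hrκ
      have h7 : b₁ * ∑ v ∈ L, wB v ≤ b₁ := by nlinarith
      linarith
    · have hpos : a₁ * z ≤ max 0 (∑ v ∈ L', w A v -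
          ρ * ∑ u ∈ Lᶜ.filter (fun u => τ u = ρ), w A u) := hzle.trans hc
      rcases le_max_iff.1 hpos with h | h
      · exact h.trans hH0
      refine h.trans (le_trans ?_ (hHsub L' fun v hv => (hL' v hv).1))
      rw [Finset.sum_sub_distrib, Finset.sum_sub_distrib]
      have h2 : ∑ v ∈ L', b₁ * wB v = 0 := by
        refine Finset.sum_eq_zero fun v hv => ?_
        simp [hwB, (hL' v hv).2.1]
      have h3 : ∑ v ∈ L', m v ≤ ρ * ∑ u ∈ Lᶜ.filter (fun u => τ u = ρ), w A u := by
        have e1 : (∑ v ∈ L', m v) * (r * κ) =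
            a₂ * ∑ v ∈ L', ∑ u ∈ Lᶜ.filter (fun u => τ u = ρ), f u v * w A u := by
          rw [Finset.sum_mul, Finset.sum_congr rfl fun v _ => hm' v, ← Finset.mul_sum]
          congr 1
          refine Finset.sum_congr rfl fun v hv => ?_
          symm
          refine Finset.sum_subset (Finset.subset_univ _) fun u _ hu => ?_
          by_contra hne
          have hf : f u v ≠ 0 := fun h => hne (by rw [h, zero_mul])
          have := f1 u v hf
          refine hu (Finset.mem_filter.2 ⟨by simpa using this.1, ?_⟩)
          exact (hL' v hv).2.2 u this.1 this.2.2
        have e2 : ∑ v ∈ L', ∑ u ∈ Lᶜ.filter (fun u => τ u = ρ), f u v * w A u ≤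
            ρ * ∑ u ∈ Lᶜ.filter (fun u => τ u = ρ), w A u := by
          rw [Finset.sum_comm, Finset.mul_sum]
          refine Finset.sum_le_sum fun u _ => ?_
          rw [← Finset.sum_mul]
          refine mul_le_mul_of_nonneg_right (le_trans ?_ (f3 u)) (h0 _ _)
          exact Finset.sum_le_sum_of_subset_of_nonneg (Finset.subset_univ _) fun v _ _ => f0 u v
        have e3 : 0 ≤ ∑ v ∈ L', ∑ u ∈ Lᶜ.filter (fun u => τ u = ρ), f u v * w A u :=
          Finset.sum_nonneg fun v _ => Finset.sum_nonneg fun u _ => mul_nonneg (f0 _ _) (h0 _ _)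
        refine le_of_mul_le_mul_right ?_ hrκ
        rw [e1, mul_comm _ (r * κ)]
        exact mul_le_mul ha₂le e2 e3 hrκ.le
      linarith
  set ζ : ι → ℝ := fun v => hv v * (z / H) with hζ
  have ζ0 : ∀ v, 0 ≤ ζ v := fun v => mul_nonneg (hv0 v) (div_nonneg hz0 hH0)
  have ζsum : ∑ v, ζ v = z := by
    rw [hζ, ← Finset.sum_mul, ← hH]
    rcases hH0.eq_or_lt with h | h
    · have : z = 0 := by
        rw [← h] at hzH
        nlinarith
      simp [this]
    · field_simp
  have ζle : ∀ v, a₁ * ζ v ≤ hv v := by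
    intro v
    rcases hH0.eq_or_lt with h | h
    · simp [hζ, ← h, hv0 v]
    · have : a₁ * ζ v = hv v * (a₁ * z / H) := by simp only [hζ]; ring
      rw [this]
      exact mul_le_of_le_one_right (hv0 v) (by rw [div_le_one h]; exact hzH)
  have ζne : ∀ v, ζ v ≠ 0 → hv v ≠ 0 := fun v h h' => h (by simp [hζ, h'])
  set α₁ : ι → ι → ℝ := fun u v => s * (f u v * w A u / (r * κ)) with hα₁
  have α₁0 : ∀ u v, 0 ≤ α₁ u v := fun u v =>
    mul_nonneg hs0 (div_nonneg (mul_nonneg (f0 _ _) (h0 _ _)) hrκ.le)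
  have α₁row : ∀ u, ∑ v, α₁ u v = s * (w A u * τ u) / (r * κ) := by
    intro u
    simp only [hα₁, hτ]
    rw [← Finset.mul_sum, ← Finset.sum_div, ← Finset.sum_mul]
    ring
  have α₁col : ∀ v, a₂ * ∑ u, α₁ u v = s * m v := by
    intro v
    simp only [hα₁, hm]
    rw [← Finset.mul_sum]
    ring
  have α₁sum : ∑ u, ∑ v, α₁ u v = 1 - z := by
    rw [Finset.sum_congr rfl fun u _ => α₁row u, ← Finset.sum_div, ← Finset.mul_sum]
    simp [hz, hG]
  have α₁rowle : ∀ u, a₁ * ∑ v, α₁ u v ≤ w A u := by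
    intro u
    rw [α₁row]
    have h2 : s * (w A u * τ u) ≤ w A u * ρ := by
      have h3 : w A u * τ u ≤ w A u * ρ := mul_le_mul_of_nonneg_left (f3 u) (h0 _ _)
      have h4 : 0 ≤ w A u * τ u := mul_nonneg (h0 _ _) (τ0 u)
      nlinarith
    rw [← mul_div_assoc, div_le_iff₀ hrκ]
    calc a₁ * (s * (w A u * τ u)) ≤ (1 - r) * κ * (w A u * ρ) :=
          mul_le_mul ha₁le h2 (mul_nonneg hs0 (mul_nonneg (h0 _ _) (τ0 u))) hr1κ.le
      _ = w A u * ((1 - r) * ρ * κ) := by ring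
      _ = w A u * (r * κ) := by rw [hρ]
  have α₁rowL : ∀ u ∈ L, ∑ v, α₁ u v = 0 := by
    intro u hu
    exact Finset.sum_eq_zero fun v _ => by simp [hα₁, τL u hu]
  have mS : ∀ v, v ∉ L → m v = 0 := by
    intro v hv
    simp only [hm]
    rw [Finset.sum_eq_zero, mul_zero]
    intro u _
    have : f u v = 0 := by
      by_contra h
      exact hv (f1 u v h).2.1
    simp [this]
  set l : ι → ℝ := fun v => a₁ * ∑ u, α₁ v u + s * m v + a₁ * ζ v + b₁ * wB v with hl
  have l0 : ∀ v, 0 ≤ l v := by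
    intro v
    have e1 : 0 ≤ a₁ * ∑ u, α₁ v u := mul_nonneg ha₁.le (Finset.sum_nonneg fun u _ => α₁0 v u)
    have e2 := mul_nonneg hs0 (m0 v)
    have e3 := mul_nonneg ha₁.le (ζ0 v)
    have e4 := mul_nonneg hb₁.le (wB0 v)
    simp only [hl]
    linarith
  have l1 : ∀ v, l v ≤ 1 := by
    intro v
    simp only [hl]
    by_cases hvL : v ∈ L
    · rw [α₁rowL v hvL, mul_zero, zero_add]
      have e2 : s * m v ≤ m v := mul_le_of_le_one_left (m0 v) hs1
      by_cases hne : hv v = 0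
      · have e3 := ζle v
        rw [hne] at e3
        have e4 := wBle v
        have e5 := mle v
        have e6 := h1 B v
        have e7 : (m v + b₁ * wB v) * (r * κ) ≤ 1 * (r * κ) := by
          have : b₁ * (wB v * (r * κ)) ≤ b₁ * 1 :=
            mul_le_mul_of_nonneg_left (e4.trans e6) hb₁.le
          linarith
        have e8 := le_of_mul_le_mul_right e7 hrκ
        linarith
      · have := (hvle v hne).2
        have := ζle v
        linarith [h1 A v]
    · have e1 : ζ v = 0 := by
        by_contra h
        exact hvL (hvle v (ζne v h)).1
      have e2 : wB v = 0 := by simp [hwB, hvL]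
      rw [e1, e2, mS v hvL]
      linarith [α₁rowle v, h1 A v]
  -- The other sides of all components rooted at `v`. They are placed greedily, which is possible
  -- because the four masses together are at most `κ`.
  set e : ι → ℝ := fun v => a₂ * ζ v + b₂ * wB v with he
  have e0 : ∀ v, 0 ≤ e v := fun v =>
    add_nonneg (mul_nonneg ha₂.le (ζ0 v)) (mul_nonneg hb₂.le (wB0 v))
  have htot : ∑ u, l u + ∑ v ∈ L, e v ≤ κ := by
    have e1 : ∑ v ∈ L, e v ≤ a₂ * z + b₂ := by
      have : ∑ v, e v = a₂ * z + b₂ := by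
        simp only [he]
        rw [Finset.sum_add_distrib, ← Finset.mul_sum, ← Finset.mul_sum, ζsum, wBsum, mul_one]
      rw [← this]
      exact Finset.sum_le_sum_of_subset_of_nonneg (Finset.subset_univ _) fun v _ _ => e0 v
    have e2 : ∑ u, l u = a₁ * (1 - z) + a₂ * (1 - z) + a₁ * z + b₁ := by
      simp only [hl]
      rw [Finset.sum_add_distrib, Finset.sum_add_distrib, Finset.sum_add_distrib,
        ← Finset.mul_sum (f := fun v => ∑ u, α₁ v u), ← Finset.mul_sum (f := m),
        ← Finset.mul_sum (f := ζ), ← Finset.mul_sum (f := wB), ζsum, wBsum, α₁sum]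
      have : s * ∑ v, m v = a₂ * (1 - z) := by
        rw [Finset.mul_sum, ← Finset.sum_congr rfl fun v _ => α₁col v, ← Finset.mul_sum,
          Finset.sum_comm, α₁sum]
      rw [this]
      ring
    rw [e2]
    linarith
  obtain ⟨h, g0, g1, g2, g3⟩ := exists_greedy_extension w h0 h1 κ L hL l l0 l1 e e0 htot
  have rowext : ∀ (c : ι → ℝ), (∀ v, 0 ≤ c v) → (∀ v, c v ≠ 0 → v ∈ L ∧ 0 < e v) → ∀ v,
      ∑ u, h v u * (c v / e v) = c v := by
    intro c c0 hc v
    by_cases hcv : c v = 0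
    · simp [hcv]
    · obtain ⟨hvL, hev⟩ := hc v hcv
      rw [← Finset.sum_mul, g2 v hvL]
      field_simp
  have wBne : ∀ v, wB v ≠ 0 → v ∈ L ∧ 0 < e v := by
    intro v hv
    refine ⟨?_, ?_⟩
    · by_contra h
      exact hv (by simp [hwB, h])
    · have : 0 < wB v := lt_of_le_of_ne (wB0 v) (Ne.symm hv)
      have := mul_pos hb₂ this
      have := mul_nonneg ha₂.le (ζ0 v)
      simp only [he]
      linarith
  have ζne' : ∀ v, ζ v ≠ 0 → v ∈ L ∧ 0 < e v := by
    intro v hv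
    refine ⟨(hvle v (ζne v hv)).1, ?_⟩
    have : 0 < ζ v := lt_of_le_of_ne (ζ0 v) (Ne.symm hv)
    have := mul_pos ha₂ this
    have := mul_nonneg hb₂.le (wB0 v)
    simp only [he]
    linarith
  have rowζ := rowext ζ ζ0 ζne'
  have rowB := rowext wB wB0 wBne
  have rowα : ∀ i, ∑ j, (α₁ i j + h i j * (ζ i / e i)) = ∑ j, α₁ i j + ζ i := by
    intro i
    rw [Finset.sum_add_distrib, rowζ]
  -- The components at `A` and at `B` that are rooted at `i` share the greedy assignment `h i` in
  -- the ratio of their masses `ζ i` and `wB i`.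
  refine ⟨A, B, fun i j => α₁ i j + h i j * (ζ i / e i), fun i j => h i j * (wB i / e i), hAB,
    fun i j => add_nonneg (α₁0 i j) (mul_nonneg (g0 i j) (div_nonneg (ζ0 i) (e0 i))),
    fun i j => mul_nonneg (g0 i j) (div_nonneg (wB0 i) (e0 i)), ?_, ?_, ?_, ?_, ?_, ?_, ?_⟩
  · intro i j hpos
    dsimp only at hpos
    by_cases hα : α₁ i j = 0
    · rw [hα, zero_add] at hpos
      have hh : h i j ≠ 0 := fun h' => by simp [h'] at hpos
      have hζi : ζ i ≠ 0 := fun h' => by simp [h'] at hpos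
      refine ⟨?_, (g1 i j hh).2⟩
      have h2 := hvle i (ζne i hζi)
      have h3 : 0 < hv i := lt_of_le_of_ne (hv0 i) (Ne.symm (ζne i hζi))
      have h4 := mul_nonneg hb₁.le (wB0 i)
      have h5 := m0 i
      linarith
    · have hf : f i j ≠ 0 := fun h' => hα (by simp [hα₁, h'])
      have hw : w A i ≠ 0 := fun h' => hα (by simp [hα₁, h'])
      exact ⟨lt_of_le_of_ne (h0 _ _) (Ne.symm hw), (f1 i j hf).2.2⟩
  · intro i j hpos
    dsimp only at hpos
    have hh : h i j ≠ 0 := fun h' => by simp [h'] at hpos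
    have hwi : wB i ≠ 0 := fun h' => by simp [h'] at hpos
    refine ⟨lt_of_le_of_ne (h0 _ _) ?_, (g1 i j hh).2⟩
    rintro h'
    apply hwi
    simp [hwB, ← h']
  · rw [Finset.sum_congr rfl fun i _ => rowα i, Finset.sum_add_distrib, α₁sum, ζsum]
    ring
  · rw [Finset.sum_congr rfl fun i _ => rowB i, wBsum]
  · intro i
    rw [rowα, rowB, Finset.sum_add_distrib, mul_add a₂, α₁col]
    refine le_trans (le_of_eq ?_) (g3 i)
    have : ∑ v, h v i = a₂ * ∑ j, h j i * (ζ j / e j) + b₂ * ∑ j, h j i * (wB j / e j) := by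
      rw [Finset.mul_sum, Finset.mul_sum, ← Finset.sum_add_distrib]
      refine Finset.sum_congr rfl fun j _ => ?_
      by_cases hj : h j i = 0
      · simp [hj]
      · have hjL := (g1 j i hj).1
        have hpos : 0 < e j := by
          rw [← g2 j hjL]
          exact lt_of_lt_of_le (lt_of_le_of_ne (g0 j i) (Ne.symm hj))
            (Finset.single_le_sum (fun u _ => g0 j u) (Finset.mem_univ i))
        have h6 : a₂ * (h j i * (ζ j / e j)) + b₂ * (h j i * (wB j / e j)) =
            h j i * (e j / e j) := by
          simp only [he]
          ring
        rw [h6, div_self hpos.ne', mul_one]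
    rw [this]
    simp only [hl]
    ring
  · intro i
    rw [rowB]
    refine le_trans ?_ (wBle i)
    rw [mul_comm]
    exact mul_le_mul_of_nonneg_left (by linarith) (wB0 i)
  · rintro i ⟨j, hpos⟩
    rw [rowα, rowB]
    by_cases hiL : i ∈ L
    · rw [α₁rowL i hiL, zero_add]
      have hζi : ζ i ≠ 0 := by
        intro h'
        dsimp only at hpos
        simp only [h', zero_div, mul_zero, add_zero] at hpos
        simp [hα₁, τL i hiL] at hpos
      have h2 := hvle i (ζne i hζi)
      linarith [ζle i, m0 i]
    · have e1 : ζ i = 0 := by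
        by_contra h
        exact hiL (hvle i (ζne i h)).1
      have e2 : wB i = 0 := by simp [hwB, hiL]
      rw [e1, e2]
      linarith [α₁rowle i]

/-! ### Cutting a rooted tree into small components. -/

/-- For the vertex `v` of a rooted tree on `0, …, k - 1` with parent function `par`: the size and
the vertex set of the part hanging at `v` after all parts of size more than `b` were cut off. -/
noncomputable def cutData (par : ℕ → ℕ) (k b : ℕ) (v : ℕ) : ℕ × Finset ℕ :=
  (1 + ∑ c : {c // c ∈ (Finset.Ioo v k).filter (fun c => par c = v)},
      if (cutData par k b c).1 ≤ b then (cutData par k b c).1 else 0,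
    insert v (Finset.univ.biUnion
      fun c : {c // c ∈ (Finset.Ioo v k).filter (fun c => par c = v)} =>
        if (cutData par k b c).1 ≤ b then (cutData par k b c).2 else ∅))
termination_by k - v
decreasing_by
  all_goals
    have := (Finset.mem_Ioo.1 (Finset.mem_filter.1 c.2).1)
    omega

theorem cutData_fst (par : ℕ → ℕ) (k b v : ℕ) :
    (cutData par k b v).1 = 1 + ∑ c ∈ (Finset.Ioo v k).filter (fun c => par c = v),
      if (cutData par k b c).1 ≤ b then (cutData par k b c).1 else 0 := by
  rw [cutData]
  simp only
  rw [Finset.sum_coe_sort ((Finset.Ioo v k).filter (fun c => par c = v))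
    (fun c => if (cutData par k b c).1 ≤ b then (cutData par k b c).1 else 0)]

theorem mem_cutData_snd (par : ℕ → ℕ) (k b v x : ℕ) :
    x ∈ (cutData par k b v).2 ↔ x = v ∨ ∃ c, v < c ∧ c < k ∧ par c = v ∧
      (cutData par k b c).1 ≤ b ∧ x ∈ (cutData par k b c).2 := by
  rw [cutData]
  simp only [Finset.mem_insert, Finset.mem_biUnion, Finset.mem_univ, true_and, Subtype.exists,
    Finset.mem_filter, Finset.mem_Ioo]
  refine or_congr Iff.rfl ⟨?_, ?_⟩
  · rintro ⟨c, ⟨⟨h1, h2⟩, h3⟩, h4⟩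
    split_ifs at h4 with h5
    · exact ⟨c, h1, h2, h3, h5, h4⟩
    · simp at h4
  · rintro ⟨c, h1, h2, h3, h4, h5⟩
    exact ⟨c, ⟨⟨h1, h2⟩, h3⟩, by rwa [if_pos h4]⟩

/-- Only an upper bound is needed, so the parts below different children need not be shown disjoint.
The induction is on `k - v` because children have larger labels. -/
theorem card_cutData_snd_le (par : ℕ → ℕ) (k b : ℕ) :
    ∀ n v, k - v ≤ n → (cutData par k b v).2.card ≤ (cutData par k b v).1 := by
  intro n
  induction n with
  | zero =>
    intro v hv
    rw [cutData_fst]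
    have : (cutData par k b v).2 = {v} := by
      ext x
      rw [mem_cutData_snd, Finset.mem_singleton]
      refine ⟨?_, Or.inl⟩
      rintro (h | ⟨c, h1, h2, -⟩)
      · exact h
      · omega
    rw [this]
    simp
  | succ n ih =>
    intro v hv
    have hsub : (cutData par k b v).2 ⊆
        insert v (((Finset.Ioo v k).filter (fun c => par c = v)).biUnion
          fun c => if (cutData par k b c).1 ≤ b then (cutData par k b c).2 else ∅) := by
      intro x hx
      rw [mem_cutData_snd] at hx
      rcases hx with h | ⟨c, h1, h2, h3, h4, h5⟩
      · simp [h]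
      · refine Finset.mem_insert_of_mem (Finset.mem_biUnion.2 ⟨c, ?_, by rwa [if_pos h4]⟩)
        simp [h1, h2, h3]
    rw [cutData_fst, add_comm]
    refine (Finset.card_le_card hsub).trans ((Finset.card_insert_le _ _).trans ?_)
    refine Nat.add_le_add_right (Finset.card_biUnion_le.trans (Finset.sum_le_sum fun c hc => ?_)) 1
    have := Finset.mem_Ioo.1 (Finset.mem_filter.1 hc).1
    split_ifs
    · exact ih c (by omega)
    · simp

/-- In the recursion summed over all `v`, every uncut size appears once more at the parent and
cancels; the sizes that survive are those cut off. -/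
theorem sum_cutData_fst_le (par : ℕ → ℕ) (k b : ℕ) (hpar : ∀ v, 0 < v → v < k → par v < v) :
    ∑ v ∈ (Finset.range k).filter (fun v => b < (cutData par k b v).1), (cutData par k b v).1
      ≤ k := by
  set s := fun v => (cutData par k b v).1 with hs
  have h1 : ∑ v ∈ Finset.range k, s v = k + ∑ v ∈ Finset.range k,
      ∑ c ∈ (Finset.Ioo v k).filter (fun c => par c = v), if s c ≤ b then s c else 0 := by
    simp only [hs]
    rw [Finset.sum_congr rfl fun v _ => cutData_fst par k b v, Finset.sum_add_distrib]
    simp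
  have h2 : ∑ v ∈ Finset.range k,
      ∑ c ∈ (Finset.Ioo v k).filter (fun c => par c = v), (if s c ≤ b then s c else 0) =
      ∑ c ∈ Finset.Ioo 0 k, if s c ≤ b then s c else 0 := by
    have : ∀ v ∈ Finset.range k, (Finset.Ioo v k).filter (fun c => par c = v) =
        (Finset.Ioo 0 k).filter (fun c => par c = v) := by
      intro v _
      ext c
      simp only [Finset.mem_filter, Finset.mem_Ioo]
      refine ⟨fun h => ⟨⟨by omega, h.1.2⟩, h.2⟩, fun h => ⟨⟨?_, h.1.2⟩, h.2⟩⟩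
      have := hpar c h.1.1 h.1.2
      omega
    rw [Finset.sum_congr rfl fun v hv => by rw [this v hv]]
    refine Finset.sum_fiberwise_of_maps_to (fun c hc => ?_) _
    have := Finset.mem_Ioo.1 hc
    have := hpar c this.1 this.2
    rw [Finset.mem_range]
    omega
  have h3 : ∑ c ∈ Finset.Ioo 0 k, (if s c ≤ b then s c else 0) ≤
      ∑ c ∈ (Finset.range k).filter (fun c => ¬ b < s c), s c := by
    simp only [not_lt]
    rw [Finset.sum_filter]
    refine Finset.sum_le_sum_of_subset fun c hc => ?_
    have := Finset.mem_Ioo.1 hc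
    rw [Finset.mem_range]
    omega
  have h4 := Finset.sum_filter_add_sum_filter_not (Finset.range k) (fun v => b < s v) s
  have h5 : ∑ v ∈ (Finset.range k).filter (fun v => b < s v), s v ≤ k := by omega
  exact h5

/-- The topmost vertex reached from `v` by passing to parents without meeting `W`. -/
noncomputable def compTop (par : ℕ → ℕ) (W : Finset ℕ) (v : ℕ) : ℕ :=
  open Classical in
  if _ : par v ∈ W ∨ v ≤ par v then v else compTop par W (par v)
termination_by v
decreasing_by omega

theorem compTop_of_mem {par : ℕ → ℕ} {W : Finset ℕ} {v : ℕ} (h : par v ∈ W) :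
    compTop par W v = v := by
  rw [compTop, dif_pos (Or.inl h)]

theorem compTop_of_notMem {par : ℕ → ℕ} {W : Finset ℕ} {v : ℕ} (h : par v ∉ W)
    (hv : par v < v) : compTop par W v = compTop par W (par v) := by
  rw [compTop, dif_neg]
  push Not
  exact ⟨h, hv⟩

theorem compTop_spec {par : ℕ → ℕ} {W : Finset ℕ} {k : ℕ}
    (hpar : ∀ v, 0 < v → v < k → par v < v) (h0 : 0 ∈ W) :
    ∀ v, v < k → v ∉ W → compTop par W v ∉ W ∧ 0 < compTop par W v ∧ compTop par W v ≤ v ∧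
      par (compTop par W v) ∈ W ∧ compTop par W (compTop par W v) = compTop par W v := by
  intro v
  induction v using Nat.strong_induction_on with
  | _ v ih =>
    intro hv hvW
    have hv0 : 0 < v := Nat.pos_of_ne_zero fun h => hvW (h ▸ h0)
    have hlt := hpar v hv0 hv
    by_cases hp : par v ∈ W
    · rw [compTop_of_mem hp]
      exact ⟨hvW, hv0, le_rfl, hp, compTop_of_mem hp⟩
    · rw [compTop_of_notMem hp hlt]
      obtain ⟨h1, h2, h3, h4, h5⟩ := ih (par v) hlt (hlt.trans hv) hp
      exact ⟨h1, h2, h3.trans hlt.le, h4, h5⟩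

/-- A rooted tree can be cut at a small set `W` of seeds into small components such that each
component touches seeds of a single colour class only; outside a very small set `H` of seeds,
the seeds carry few vertices. -/
theorem exists_tree_cut (k : ℕ) (hk : 0 < k) (par : ℕ → ℕ) (cls : ℕ → Bool)
    (hpar : ∀ v, 0 < v → v < k → par v < v) (hcls : ∀ v, 0 < v → v < k → cls v ≠ cls (par v))
    (b h : ℕ) (hbh : b ≤ h) :
    ∃ W H : Finset ℕ, W ⊆ Finset.range k ∧ H ⊆ W ∧ 0 ∈ H ∧
      (b + 1) * W.card ≤ 4 * k + 4 * (b + 1) ∧ (h + 1) * H.card ≤ k + (h + 1) ∧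
      (∀ w ∈ W, 0 < w → par w ∉ W → cls w = cls (par (compTop par W (par w)))) ∧
      (∀ t, ((Finset.range k).filter (fun v => v ∉ W ∧ compTop par W v = t)).card ≤ b) ∧
      (∀ w ∈ W, w ∉ H →
        ((Finset.range k).filter (fun v => v ∉ W ∧ par (compTop par W v) = w)).card ≤ h) ∧
      ∀ w ∈ H, 0 < w → par w ∈ W := by
  classical
  set s := fun v => (cutData par k b v).1 with hs
  set F := fun v => (cutData par k b v).2 with hF
  have hFs : ∀ v, (F v).card ≤ s v := fun v => card_cutData_snd_le par k b (k - v) v le_rfl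
  have hFself : ∀ v, v ∈ F v := fun v => (mem_cutData_snd par k b v v).2 (Or.inl rfl)
  have hFsub : ∀ c, 0 < c → c < k → s c ≤ b → F c ⊆ F (par c) := by
    intro c hc0 hck hsc x hx
    exact (mem_cutData_snd par k b _ x).2 (Or.inr ⟨c, hpar c hc0 hck, hck, rfl, hsc, hx⟩)
  set W₀ := (Finset.range k).filter (fun v => b < s v) with hW₀
  set H₀ := (Finset.range k).filter (fun v => h < s v) with hH₀
  have hsum : ∑ v ∈ W₀, s v ≤ k := sum_cutData_fst_le par k b hpar
  have hW₀c : (b + 1) * W₀.card ≤ k := by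
    refine le_trans ?_ hsum
    rw [mul_comm, ← smul_eq_mul]
    exact Finset.card_nsmul_le_sum _ _ _ fun v hv => (Finset.mem_filter.1 hv).2
  have hH₀W₀ : H₀ ⊆ W₀ := by
    intro v hv
    obtain ⟨h1, h2⟩ := Finset.mem_filter.1 hv
    exact Finset.mem_filter.2 ⟨h1, hbh.trans_lt h2⟩
  have hH₀c : (h + 1) * H₀.card ≤ k := by
    refine le_trans ?_ ((Finset.sum_le_sum_of_subset hH₀W₀).trans hsum)
    rw [mul_comm, ← smul_eq_mul]
    exact Finset.card_nsmul_le_sum _ _ _ fun v hv => (Finset.mem_filter.1 hv).2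
  set H := insert 0 H₀ with hH
  -- Parents of heavy seeds become seeds. The heavy seeds are embedded before everything else, so no
  -- component may have to be joined to them from above.
  set W₁ := W₀ ∪ insert 0 ((H.filter (fun w => 0 < w)).image par) with hW₁
  set c₁ := fun v => cls (par (compTop par W₁ v)) with hc₁
  -- A component hanging at a seed of class `c₁` may have a seed of the other class below it. The
  -- parent of that seed has class `c₁`, so cutting there repairs the conflict without changing the
  -- class attached to any component.
  set W := W₁ ∪ ((W₁.filter (fun w => 0 < w ∧ par w ∉ W₁ ∧ cls w ≠ c₁ (par w))).image par)
    with hW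
  have hW₀W₁ : W₀ ⊆ W₁ := Finset.subset_union_left
  have hW₁W : W₁ ⊆ W := Finset.subset_union_left
  have h0W₁ : 0 ∈ W₁ := by simp [hW₁]
  have h0W : 0 ∈ W := hW₁W h0W₁
  have hHk : H ⊆ Finset.range k := by
    intro v hv
    rcases Finset.mem_insert.1 hv with rfl | hv
    · simpa using hk
    · exact (Finset.mem_filter.1 hv).1
  have hHW₁ : H ⊆ W₁ := by
    intro v hv
    rcases Finset.mem_insert.1 hv with rfl | hv
    · exact h0W₁
    · exact hW₀W₁ (hH₀W₀ hv)
  have hW₁k : W₁ ⊆ Finset.range k := by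
    intro v hv
    rcases Finset.mem_union.1 hv with hv | hv
    · exact (Finset.mem_filter.1 hv).1
    rcases Finset.mem_insert.1 hv with rfl | hv
    · simpa using hk
    · obtain ⟨w, hw, rfl⟩ := Finset.mem_image.1 hv
      obtain ⟨h1, h2⟩ := Finset.mem_filter.1 hw
      have h3 := Finset.mem_range.1 (hHk h1)
      exact Finset.mem_range.2 ((hpar w h2 h3).trans h3)
  have hWk : W ⊆ Finset.range k := by
    intro v hv
    rcases Finset.mem_union.1 hv with hv | hv
    · exact hW₁k hv
    · obtain ⟨w, hw, rfl⟩ := Finset.mem_image.1 hv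
      obtain ⟨h1, h2, -⟩ := Finset.mem_filter.1 hw
      have h3 := Finset.mem_range.1 (hW₁k h1)
      exact Finset.mem_range.2 ((hpar w h2 h3).trans h3)
  have hHc : H.card ≤ H₀.card + 1 := Finset.card_insert_le _ _
  have hW₁c : W₁.card ≤ 2 * W₀.card + 2 := by
    have e1 : W₁.card ≤ W₀.card + (insert 0 ((H.filter (fun w => 0 < w)).image par)).card :=
      Finset.card_union_le _ _
    have e2 : (insert 0 ((H.filter (fun w => 0 < w)).image par)).card ≤
      ((H.filter (fun w => 0 < w)).image par).card + 1 := Finset.card_insert_le _ _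
    have e3 : ((H.filter (fun w => 0 < w)).image par).card ≤ (H.filter (fun w => 0 < w)).card :=
      Finset.card_image_le
    have e4 : (H.filter (fun w => 0 < w)).card ≤ H₀.card := by
      refine Finset.card_le_card fun v hv => ?_
      obtain ⟨h1, h2⟩ := Finset.mem_filter.1 hv
      rcases Finset.mem_insert.1 h1 with rfl | h1
      · omega
      · exact h1
    have e5 := Finset.card_le_card hH₀W₀
    omega
  have hWc : W.card ≤ 2 * W₁.card := by
    refine (Finset.card_union_le _ _).trans ?_
    have := (Finset.card_image_le (s := W₁.filter (fun w => 0 < w ∧ par w ∉ W₁ ∧ cls w ≠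
      c₁ (par w))) (f := par)).trans (Finset.card_filter_le _ _)
    omega
  -- the class of the seed above a component does not change from `W₁` to `W`
  have hpW : ∀ w ∈ W, w ∉ W₁ → cls w = c₁ w := by
    intro w hw hw₁
    rcases Finset.mem_union.1 hw with hw | hw
    · exact absurd hw hw₁
    · obtain ⟨w', hw', rfl⟩ := Finset.mem_image.1 hw
      obtain ⟨h1, h2, -, h3⟩ := Finset.mem_filter.1 hw'
      have h4 := hcls w' h2 (Finset.mem_range.1 (hW₁k h1))
      revert h3 h4
      cases cls w' <;> cases cls (par w') <;> cases c₁ (par w') <;> simp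
  have hc₁par : ∀ v, 0 < v → v < k → par v ∉ W₁ → c₁ v = c₁ (par v) := by
    intro v hv0 hvk hp
    simp only [hc₁]
    rw [compTop_of_notMem hp (hpar v hv0 hvk)]
  have hceq : ∀ v, v < k → v ∉ W → cls (par (compTop par W v)) = c₁ v := by
    intro v
    induction v using Nat.strong_induction_on with
    | _ v ih =>
      intro hv hvW
      have hv0 : 0 < v := Nat.pos_of_ne_zero fun h => hvW (h ▸ h0W)
      have hlt := hpar v hv0 hv
      by_cases hp : par v ∈ W
      · rw [compTop_of_mem hp]
        by_cases hp₁ : par v ∈ W₁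
        · simp only [hc₁]
          rw [compTop_of_mem hp₁]
        · rw [hc₁par v hv0 hv hp₁]
          exact hpW _ hp hp₁
      · rw [compTop_of_notMem hp hlt, hc₁par v hv0 hv fun h => hp (hW₁W h)]
        exact ih _ hlt (hlt.trans hv) hp
  have hlight : ∀ v, v < k → v ∉ W → s v ≤ b := by
    intro v hv hvW
    by_contra hlt
    exact hvW (hW₁W (hW₀W₁ (Finset.mem_filter.2 ⟨Finset.mem_range.2 hv, not_le.1 hlt⟩)))
  have hFtop : ∀ v, v < k → v ∉ W → F v ⊆ F (compTop par W v) := by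
    intro v
    induction v using Nat.strong_induction_on with
    | _ v ih =>
      intro hv hvW
      have hv0 : 0 < v := Nat.pos_of_ne_zero fun h => hvW (h ▸ h0W)
      have hlt := hpar v hv0 hv
      by_cases hp : par v ∈ W
      · rw [compTop_of_mem hp]
      · rw [compTop_of_notMem hp hlt]
        exact (hFsub v hv0 hv (hlight v hv hvW)).trans (ih _ hlt (hlt.trans hv) hp)
  refine ⟨W, H, hWk, hHW₁.trans hW₁W, Finset.mem_insert_self _ _, ?_, ?_, ?_, ?_, ?_, ?_⟩
  -- The two rounds at most double the number of seeds each, up to the root: `W.card ≤ 2 * W₁.card ≤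
  -- 4 * W₀.card + 4`.
  · nlinarith
  · nlinarith
  · intro w hw hw0 hpw
    have hwk := Finset.mem_range.1 (hWk hw)
    rw [hceq _ ((hpar w hw0 hwk).trans hwk) hpw]
    by_cases hw₁ : w ∈ W₁
    · by_contra hne
      apply hpw
      refine Finset.mem_union_right _ (Finset.mem_image.2 ⟨w, ?_, rfl⟩)
      exact Finset.mem_filter.2 ⟨hw₁, hw0, fun h => hpw (hW₁W h), hne⟩
    · rw [hpW w hw hw₁, hc₁par w hw0 hwk fun h => hpw (hW₁W h)]
  · intro t
    rcases Finset.eq_empty_or_nonempty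
      ((Finset.range k).filter (fun v => v ∉ W ∧ compTop par W v = t)) with he | ⟨v, hv⟩
    · simp [he]
    obtain ⟨h1, h2, h3⟩ := Finset.mem_filter.1 hv
    have h1 := Finset.mem_range.1 h1
    obtain ⟨g1, g2, g3, -⟩ := compTop_spec hpar h0W v h1 h2
    rw [h3] at g1 g3
    refine le_trans (Finset.card_le_card ?_) ((hFs t).trans (hlight t (g3.trans_lt h1) g1))
    intro u hu
    obtain ⟨e1, e2, e3⟩ := Finset.mem_filter.1 hu
    rw [← e3]
    exact hFtop u (Finset.mem_range.1 e1) e2 (hFself u)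
  · intro w hw hwH
    have hsw : s w ≤ h := by
      by_contra hlt
      exact hwH (Finset.mem_insert_of_mem (Finset.mem_filter.2 ⟨hWk hw, not_le.1 hlt⟩))
    refine le_trans (Finset.card_le_card ?_) ((hFs w).trans hsw)
    intro u hu
    obtain ⟨e1, e2, e3⟩ := Finset.mem_filter.1 hu
    have e1 := Finset.mem_range.1 e1
    obtain ⟨g1, g2, g3, -⟩ := compTop_spec hpar h0W u e1 e2
    rw [← e3]
    exact hFsub _ g2 (g3.trans_lt e1) (hlight _ (g3.trans_lt e1) g1)
      (hFtop u e1 e2 (hFself u))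
  · intro w hw hw0
    apply hW₁W
    refine Finset.mem_union_right _ (Finset.mem_insert_of_mem (Finset.mem_image.2 ⟨w, ?_, rfl⟩))
    exact Finset.mem_filter.2 ⟨hw, hw0⟩

/-! ### Mostly dense pairs and greedy embedding of one component. -/

section
open scoped Classical

/-- The neighbours of `x` in `Q`. -/
noncomputable def nbrIn {V : Type*} (G : SimpleGraph V) (x : V) (Q : Finset V) : Finset V :=
  Q.filter (G.Adj x)

theorem mem_nbrIn {V : Type*} {G : SimpleGraph V} {x y : V} {Q : Finset V} :
    y ∈ nbrIn G x Q ↔ y ∈ Q ∧ G.Adj x y := Finset.mem_filter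

theorem nbrIn_subset {V : Type*} {G : SimpleGraph V} {x : V} {Q : Finset V} :
    nbrIn G x Q ⊆ Q := Finset.filter_subset _ _

/-- Fewer than `σ` vertices of `P` have fewer than `d * #Q` neighbours in `Q`, for every subset
`Q` of `P'` of size at least `σ`. -/
def MostlyDense {V : Type*} (G : SimpleGraph V) (σ d : ℝ) (P P' : Finset V) : Prop :=
  ∀ Q ⊆ P', σ ≤ Q.card →
    ((P.filter fun x => ((nbrIn G x Q).card : ℝ) < d * Q.card).card : ℝ) < σ

theorem MostlyDense.mono {V : Type*} {G : SimpleGraph V} {σ d : ℝ} {P P' R R' : Finset V}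
    (h : MostlyDense G σ d P P') (hR : R ⊆ P) (hR' : R' ⊆ P') : MostlyDense G σ d R R' := by
  intro Q hQ hσ
  refine lt_of_le_of_lt ?_ (h Q (hQ.trans hR') hσ)
  exact_mod_cast Finset.card_le_card (Finset.filter_subset_filter _ hR)

/-- A small rooted tree embeds greedily into a bipartite graph of large minimum degree. -/
theorem exists_embedding_of_le_card_nbrIn {V : Type*} (G : SimpleGraph V) (par : ℕ → ℕ)
    (cls : ℕ → Bool) (t : ℕ) (X : Bool → Finset V) (r : V) (hr : r ∈ X (cls t)) :
    ∀ (n : ℕ) (K : Finset ℕ), K.card = n → t ∈ K →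
      (∀ v ∈ K, v ≠ t → par v ∈ K ∧ par v < v ∧ cls v ≠ cls (par v)) →
      (∀ c, ∀ x ∈ X c, n ≤ (nbrIn G x (X !c)).card) →
      ∃ ψ : ℕ → V, ψ t = r ∧ Set.InjOn ψ K ∧ (∀ v ∈ K, ψ v ∈ X (cls v)) ∧
        ∀ v ∈ K, v ≠ t → G.Adj (ψ (par v)) (ψ v) := by
  intro n
  induction n with
  | zero =>
    intro K hK ht
    rw [Finset.card_eq_zero.1 hK] at ht
    simp at ht
  | succ n ih =>
    intro K hK ht hpar hX
    by_cases hne : (K.erase t).Nonempty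
    -- Parents have smaller labels, so the largest label other than `t` belongs to a leaf.
    · set u := (K.erase t).max' hne with hu
      have huK := Finset.mem_of_mem_erase ((K.erase t).max'_mem hne)
      have hut := Finset.ne_of_mem_erase ((K.erase t).max'_mem hne)
      rw [← hu] at huK hut
      have hcard : (K.erase u).card = n := by rw [Finset.card_erase_of_mem huK, hK]; rfl
      have hpe : ∀ v ∈ K, v ≠ t → par v ∈ K.erase u := by
        intro v hv hvt
        obtain ⟨h1, h2, -⟩ := hpar v hv hvt
        refine Finset.mem_erase.2 ⟨?_, h1⟩
        have : v ≤ u := Finset.le_max' _ _ (Finset.mem_erase.2 ⟨hvt, hv⟩)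
        omega
      obtain ⟨ψ, h1, h2, h3, h4⟩ := ih (K.erase u) hcard (Finset.mem_erase.2 ⟨hut.symm, ht⟩)
        (fun v hv hvt => ⟨hpe v (Finset.mem_of_mem_erase hv) hvt,
          (hpar v (Finset.mem_of_mem_erase hv) hvt).2⟩)
        (fun c x hx => (Nat.le_succ n).trans (hX c x hx))
      have hpu := hpe u huK hut
      have hlt : ((K.erase u).image ψ).card < (nbrIn G (ψ (par u)) (X !(cls (par u)))).card :=
        (Finset.card_image_le.trans hcard.le).trans_lt (hX _ _ (h3 _ hpu))
      obtain ⟨y, hy, hyn⟩ := Finset.exists_mem_notMem_of_card_lt_card hlt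
      have hcu : cls u = !cls (par u) := by
        have := (hpar u huK hut).2.2
        revert this
        cases cls u <;> cases cls (par u) <;> simp
      have hne' : ∀ v ∈ K.erase u, ψ v ≠ y := fun v hv h =>
        hyn (Finset.mem_image.2 ⟨v, hv, h⟩)
      refine ⟨Function.update ψ u y, ?_, ?_, ?_, ?_⟩
      · rw [Function.update_of_ne hut.symm, h1]
      · intro a ha a' ha' h
        rw [Finset.mem_coe] at ha ha'
        by_cases e : a = u <;> by_cases e' : a' = u
        · rw [e, e']
        · subst e
          rw [Function.update_self, Function.update_of_ne e'] at h
          exact absurd h.symm (hne' a' (Finset.mem_erase.2 ⟨e', ha'⟩))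
        · subst e'
          rw [Function.update_self, Function.update_of_ne e] at h
          exact absurd h (hne' a (Finset.mem_erase.2 ⟨e, ha⟩))
        · rw [Function.update_of_ne e, Function.update_of_ne e'] at h
          exact h2 (by simp [e, ha]) (by simp [e', ha']) h
      · intro v hv
        by_cases e : v = u
        · rw [e, Function.update_self, hcu]
          exact nbrIn_subset hy
        · rw [Function.update_of_ne e]
          exact h3 v (Finset.mem_erase.2 ⟨e, hv⟩)
      · intro v hv hvt
        have hp := hpe v hv hvt
        rw [Function.update_of_ne (Finset.ne_of_mem_erase hp)]
        by_cases e : v = u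
        · rw [e, Function.update_self]
          exact (mem_nbrIn.1 hy).2
        · rw [Function.update_of_ne e]
          exact h4 v (Finset.mem_erase.2 ⟨e, hv⟩) hvt
    · rw [Finset.not_nonempty_iff_eq_empty] at hne
      have hKt : ∀ v ∈ K, v = t := by
        intro v hv
        by_contra h
        have : v ∈ K.erase t := Finset.mem_erase.2 ⟨h, hv⟩
        rw [hne] at this
        simp at this
      refine ⟨fun _ => r, rfl, ?_, ?_, ?_⟩
      · intro a ha a' ha' _
        rw [hKt a ha, hKt a' ha']
      · intro v hv
        rw [hKt v hv]
        exact hr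
      · intro v hv hvt
        exact absurd (hKt v hv) hvt

/-- A small rooted tree embeds into a mostly dense pair, with prescribed candidates for the root,
avoiding a small exceptional set on the side of the root. -/
theorem exists_embedding_of_mostlyDense {V : Type*} (G : SimpleGraph V) (par : ℕ → ℕ)
    (cls : ℕ → Bool) (t : ℕ) (K : Finset ℕ) (ht : t ∈ K)
    (hpar : ∀ v ∈ K, v ≠ t → par v ∈ K ∧ par v < v ∧ cls v ≠ cls (par v))
    (σ d g : ℝ) (hd : 0 ≤ d) (hσg : σ ≤ g) (hK : K.card + 2 * σ ≤ d * g)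
    (P P' R bad : Finset V) (hP : g ≤ P.card) (hP' : g ≤ P'.card)
    (h1 : MostlyDense G σ d P P') (h2 : MostlyDense G σ d P' P) (hRP : R ⊆ P)
    (hR : 2 * σ ≤ R.card) (hbad : ((P.filter (· ∈ bad)).card : ℝ) < σ) :
    ∃ ψ : ℕ → V, ψ t ∈ R ∧ Set.InjOn ψ K ∧
      (∀ v ∈ K, ψ v ∈ if cls v = cls t then P \ bad else P') ∧
      ∀ v ∈ K, v ≠ t → G.Adj (ψ (par v)) (ψ v) := by
  -- Deleting `bad` and the vertices of small degree removes fewer than `2 * σ` vertices on either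
  -- side, which leaves minimum degree at least `d * g - 2 * σ ≥ K.card`.
  set B₁ := P.filter fun x => ((nbrIn G x P').card : ℝ) < d * P'.card with hB₁
  set B₂ := P'.filter fun x => ((nbrIn G x P).card : ℝ) < d * P.card with hB₂
  have hB₁c : (B₁.card : ℝ) < σ := h1 P' subset_rfl (hσg.trans hP')
  have hB₂c : (B₂.card : ℝ) < σ := h2 P subset_rfl (hσg.trans hP)
  set B := B₁ ∪ P.filter (· ∈ bad) with hB
  have hBc : (B.card : ℝ) < 2 * σ := by
    have : (B.card : ℝ) ≤ B₁.card + (P.filter (· ∈ bad)).card := by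
      exact_mod_cast Finset.card_union_le _ _
    linarith
  have hloss : ∀ (x : V) (Q B : Finset V),
      ((nbrIn G x Q).card : ℝ) ≤ (nbrIn G x (Q \ B)).card + B.card := by
    intro x Q B
    have : nbrIn G x Q ⊆ nbrIn G x (Q \ B) ∪ B := by
      intro y hy
      by_cases h : y ∈ B
      · exact Finset.mem_union_right _ h
      · refine Finset.mem_union_left _ (mem_nbrIn.2 ⟨?_, (mem_nbrIn.1 hy).2⟩)
        exact Finset.mem_sdiff.2 ⟨(mem_nbrIn.1 hy).1, h⟩
    exact_mod_cast (Finset.card_le_card this).trans (Finset.card_union_le _ _)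
  set X : Bool → Finset V := fun c => if c = cls t then P \ B else P' \ B₂ with hX
  have hXt : X (cls t) = P \ B := by simp [hX]
  have hXt' : X (!cls t) = P' \ B₂ := by simp [hX]
  have hdeg₁ : ∀ x ∈ P \ B, K.card ≤ (nbrIn G x (P' \ B₂)).card := by
    intro x hx
    obtain ⟨hx1, hx2⟩ := Finset.mem_sdiff.1 hx
    have h3 : d * P'.card ≤ (nbrIn G x P').card := by
      by_contra h
      exact hx2 (Finset.mem_union_left _ (Finset.mem_filter.2 ⟨hx1, not_le.1 h⟩))
    have h4 := hloss x P' B₂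
    have h5 := mul_le_mul_of_nonneg_left hP' hd
    have : (K.card : ℝ) ≤ (nbrIn G x (P' \ B₂)).card := by linarith
    exact_mod_cast this
  have hdeg₂ : ∀ x ∈ P' \ B₂, K.card ≤ (nbrIn G x (P \ B)).card := by
    intro x hx
    obtain ⟨hx1, hx2⟩ := Finset.mem_sdiff.1 hx
    have h3 : d * P.card ≤ (nbrIn G x P).card := by
      by_contra h
      exact hx2 (Finset.mem_filter.2 ⟨hx1, not_le.1 h⟩)
    have h4 := hloss x P B
    have h5 := mul_le_mul_of_nonneg_left hP hd
    have : (K.card : ℝ) ≤ (nbrIn G x (P \ B)).card := by linarith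
    exact_mod_cast this
  have hlt : B.card < R.card := by exact_mod_cast hBc.trans_le hR
  obtain ⟨r, hr, hrB⟩ := Finset.exists_mem_notMem_of_card_lt_card hlt
  obtain ⟨ψ, g1, g2, g3, g4⟩ := exists_embedding_of_le_card_nbrIn G par cls t X r
    (by rw [hXt]; exact Finset.mem_sdiff.2 ⟨hRP hr, hrB⟩) K.card K rfl ht hpar (by
      intro c x hx
      by_cases hc : c = cls t
      · subst hc
        rw [hXt] at hx
        rw [hXt']
        exact hdeg₁ x hx
      · have hc' : c = !cls t := by
          revert hc
          cases c <;> cases cls t <;> simp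
        rw [hc', hXt'] at hx
        rw [hc', Bool.not_not, hXt]
        exact hdeg₂ x hx)
  refine ⟨ψ, by rwa [g1], g2, fun v hv => ?_, g4⟩
  have := g3 v hv
  simp only [hX] at this
  split_ifs at this ⊢ with h
  · obtain ⟨e1, e2⟩ := Finset.mem_sdiff.1 this
    refine Finset.mem_sdiff.2 ⟨e1, fun e3 => e2 (Finset.mem_union_right _ ?_)⟩
    exact Finset.mem_filter.2 ⟨e1, e3⟩
  · exact (Finset.mem_sdiff.1 this).1

end

/-! ### Tree packings: data, quotas and remaining space. -/

section
open scoped Classical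

/-- A rooted tree, cut into seeds and components, together with places in a graph `G` for the
seeds (`hub` for the heavy seeds `H`, `star` for the others) and disjoint regions `reg` between
which the components are to be distributed with the frequencies `α`. -/
structure TreePacking (V ι Cl : Type*) [Fintype ι] [Fintype Cl] where
  G : SimpleGraph V
  k : ℕ
  par : ℕ → ℕ
  cls : ℕ → Bool
  W : Finset ℕ
  H : Finset ℕ
  hub : ℕ → V
  star : Bool → Finset V
  reg : ι → Finset V
  cl : ℕ → Cl
  α : Cl → ι → ι → ℝ
  σ : ℝ
  d : ℝ
  g : ℝ
  gR : ℝ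
  δ : ℝ
  γ : ℝ
  μ : ℝ
  b : ℕ
  h : ℕ
  par_lt : ∀ v, 0 < v → v < k → par v < v
  cls_ne : ∀ v, 0 < v → v < k → cls v ≠ cls (par v)
  W_sub : W ⊆ Finset.range k
  H_sub : H ⊆ W
  zero_mem : 0 ∈ H
  cross : ∀ w ∈ W, 0 < w → par w ∉ W → cls w = cls (par (compTop par W (par w)))
  comp_le : ∀ t, ((Finset.range k).filter (fun v => v ∉ W ∧ compTop par W v = t)).card ≤ b
  light_le : ∀ w ∈ W, w ∉ H →
    ((Finset.range k).filter (fun v => v ∉ W ∧ par (compTop par W v) = w)).card ≤ h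
  par_heavy : ∀ w ∈ H, 0 < w → par w ∈ W
  star_reg : ∀ c i, Disjoint (star c) (reg i)
  reg_reg : ∀ i j, i ≠ j → Disjoint (reg i) (reg j)
  hub_inj : Set.InjOn hub H
  hub_star : ∀ w ∈ H, ∀ c, hub w ∉ star c
  hub_reg : ∀ w ∈ H, ∀ i, hub w ∉ reg i
  hub_adj : ∀ w ∈ H, ∀ w' ∈ H, cls w ≠ cls w' → G.Adj (hub w) (hub w')
  hub_star_adj : ∀ w ∈ H, ∀ x ∈ star (!cls w), G.Adj (hub w) x
  star_dense : ∀ c, MostlyDense G σ d (star c) (star !c)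
  α_nonneg : ∀ κ i j, 0 ≤ α κ i j
  α_sum : ∀ κ, ∑ i, ∑ j, α κ i j = 1
  dense_reg : ∀ w ∈ W, ∀ i j, 0 < α (cl w) i j →
    MostlyDense G σ d (reg i) (reg j) ∧ MostlyDense G σ d (reg j) (reg i)
  dense_star : ∀ w ∈ W, ∀ i j, 0 < α (cl w) i j → MostlyDense G σ d (reg i) (star (cls w))
  dense_light : ∀ w ∈ W, w ∉ H → ∀ i j, 0 < α (cl w) i j →
    MostlyDense G σ d (star (cls w)) (reg i)
  reg_heavy : ∀ w ∈ H, ∀ i j, 0 < α (cl w) i j → ∀ x ∈ reg i, G.Adj (hub w) x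
  -- Beyond the expected load the region has room for rounding: one component, with at most `b`
  -- vertices on a side, for each bin and each of the pairs having `i` as first or as second member.
  -- The reserve `g` allows the next component to be embedded.
  capacity : ∀ w ∈ W, ∀ i j, 0 < α (cl w) i j ∨ 0 < α (cl w) j i →
    (1 + γ) * ∑ t ∈ (Finset.range k).filter (fun v => v ∉ W ∧ compTop par W v = v),
      (((Finset.range k).filter
          (fun v => (v ∉ W ∧ compTop par W v = t) ∧ cls v = cls t)).card * ∑ j, α (cl (par t)) i j +
        ((Finset.range k).filter
          (fun v => (v ∉ W ∧ compTop par W v = t) ∧ cls v ≠ cls t)).card *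
            ∑ j, α (cl (par t)) j i) +
      2 * Fintype.card ι * (Fintype.card Cl * (b + 1) ^ 2) * b + g ≤ (reg i).card
  capacity_light : ∀ w ∈ W, w ∉ H → ∀ i j, 0 < α (cl w) i j →
    (1 + γ) * ∑ t ∈ (Finset.range k).filter (fun v => v ∉ W ∧ compTop par W v = v),
      (((Finset.range k).filter
          (fun v => (v ∉ W ∧ compTop par W v = t) ∧ cls v = cls t)).card * ∑ j, α (cl (par t)) i j +
        ((Finset.range k).filter
          (fun v => (v ∉ W ∧ compTop par W v = t) ∧ cls v ≠ cls t)).card *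
            ∑ j, α (cl (par t)) j i) +
      2 * Fintype.card ι * (Fintype.card Cl * (b + 1) ^ 2) * b + gR ≤ (reg i).card
  mass_le : ∀ w ∈ W, w ∉ H → ∀ i, ∑ j, α (cl w) i j ≤ μ
  σ_pos : 0 < σ
  d_pos : 0 < d
  d_le : d ≤ 1
  σ_g : 2 * σ ≤ g
  σ_gR : 4 * σ ≤ d * gR
  b_g : b + 2 * σ ≤ d * g
  δ_pos : 0 < δ
  γ_nonneg : 0 ≤ γ
  γ_δ : 1 ≤ (1 + γ) * (1 - δ)
  -- The at most `h` vertices hanging at a light seed can use up `d * gR / 2` vertices only in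
  -- regions of total mass at most `δ / 2`.
  exhaust : 4 * h * μ ≤ δ * (d * gR)
  -- The neighbours of a parent in the reservoir must outnumber the images of seeds, the vertices
  -- atypical to the other reservoir, and those atypical to too much of the free regions.
  star_card : ∀ c, W.card + σ + 2 * σ / δ < d * (star c).card

namespace TreePacking

variable {V ι Cl : Type*} [Fintype ι] [Fintype Cl] (S : TreePacking V ι Cl)

noncomputable def top (v : ℕ) : ℕ := compTop S.par S.W v

noncomputable def comp (t : ℕ) : Finset ℕ :=
  (Finset.range S.k).filter (fun v => v ∉ S.W ∧ S.top v = t)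

noncomputable def rootSide (t : ℕ) : ℕ :=
  ((Finset.range S.k).filter (fun v => (v ∉ S.W ∧ S.top v = t) ∧ S.cls v = S.cls t)).card

noncomputable def otherSide (t : ℕ) : ℕ :=
  ((Finset.range S.k).filter (fun v => (v ∉ S.W ∧ S.top v = t) ∧ S.cls v ≠ S.cls t)).card

noncomputable def tops : Finset ℕ :=
  (Finset.range S.k).filter (fun v => v ∉ S.W ∧ S.top v = v)

/-- Components in one bin are interchangeable: they have the same group of seeds above and the same
two side sizes. The number of bins is independent of `k`, so a rounding error per bin is harmless.
Reduction modulo `b + 1` loses nothing, as the sides have size at most `b`. -/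
noncomputable def bin (t : ℕ) : Cl × Fin (S.b + 1) × Fin (S.b + 1) :=
  (S.cl (S.par t), Fin.ofNat (S.b + 1) (S.rootSide t), Fin.ofNat (S.b + 1) (S.otherSide t))

/-- The region to which `v` is sent when the components are sent to the pairs `e`. -/
noncomputable def region (e : ℕ → ι × ι) (v : ℕ) : ι :=
  if S.cls v = S.cls (S.top v) then (e (S.top v)).1 else (e (S.top v)).2

noncomputable def load (i : ι) : ℝ :=
  (1 + S.γ) * ∑ t ∈ S.tops, (S.rootSide t * ∑ j, S.α (S.cl (S.par t)) i j +
    S.otherSide t * ∑ j, S.α (S.cl (S.par t)) j i) +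
  2 * Fintype.card ι * (Fintype.card Cl * (S.b + 1) ^ 2) * S.b

theorem rootSide_le (t : ℕ) : S.rootSide t ≤ S.b :=
  (Finset.card_le_card fun v hv => by
    rw [Finset.mem_filter] at hv ⊢
    exact ⟨hv.1, hv.2.1⟩).trans (S.comp_le t)

theorem otherSide_le (t : ℕ) : S.otherSide t ≤ S.b :=
  (Finset.card_le_card fun v hv => by
    rw [Finset.mem_filter] at hv ⊢
    exact ⟨hv.1, hv.2.1⟩).trans (S.comp_le t)

theorem bin_rootSide (t : ℕ) : ((S.bin t).2.1 : ℕ) = S.rootSide t :=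
  Nat.mod_eq_of_lt (Nat.lt_succ_of_le (S.rootSide_le t))

theorem bin_otherSide (t : ℕ) : ((S.bin t).2.2 : ℕ) = S.otherSide t :=
  Nat.mod_eq_of_lt (Nat.lt_succ_of_le (S.otherSide_le t))

theorem top_spec {v : ℕ} (hv : v < S.k) (hW : v ∉ S.W) :
    S.top v ∉ S.W ∧ 0 < S.top v ∧ S.top v ≤ v ∧ S.par (S.top v) ∈ S.W ∧
      S.top (S.top v) = S.top v :=
  compTop_spec S.par_lt (S.H_sub S.zero_mem) v hv hW

theorem top_mem_tops {v : ℕ} (hv : v < S.k) (hW : v ∉ S.W) : S.top v ∈ S.tops := by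
  obtain ⟨h1, -, h3, -, h5⟩ := S.top_spec hv hW
  exact Finset.mem_filter.2 ⟨Finset.mem_range.2 (h3.trans_lt hv), h1, h5⟩

theorem pos_of_notMem {v : ℕ} (hW : v ∉ S.W) : 0 < v :=
  Nat.pos_of_ne_zero fun h => hW (h ▸ S.H_sub S.zero_mem)

theorem top_of_par_mem {v : ℕ} (h : S.par v ∈ S.W) : S.top v = v := compTop_of_mem h

theorem top_of_par_notMem {v : ℕ} (hv : v < S.k) (hv0 : 0 < v) (h : S.par v ∉ S.W) :
    S.top v = S.top (S.par v) := compTop_of_notMem h (S.par_lt v hv0 hv)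

theorem cls_eq_not {v : ℕ} (hv0 : 0 < v) (hv : v < S.k) : S.cls v = !S.cls (S.par v) := by
  have := S.cls_ne v hv0 hv
  revert this
  cases S.cls v <;> cases S.cls (S.par v) <;> simp

/-- The partial embedding `φ` of the vertices in `I`, with the components sent to the pairs of
regions given by `e`, is as wanted. -/
structure Good (I : Finset ℕ) (φ : ℕ → V) (e : ℕ → ι × ι) : Prop where
  sub : I ⊆ Finset.range S.k
  H_sub : S.H ⊆ I
  inj : Set.InjOn φ I
  adj : ∀ v ∈ I, 0 < v → S.par v ∈ I → S.G.Adj (φ (S.par v)) (φ v)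
  heavy : ∀ w ∈ S.H, φ w = S.hub w
  seed : ∀ w ∈ I, w ∈ S.W → w ∉ S.H → φ w ∈ S.star (S.cls w)
  comp : ∀ v ∈ I, v ∉ S.W → φ v ∈ S.reg (S.region e v)
  typ : ∀ v ∈ I, v ∉ S.H → (v ∈ S.W ∨ S.cls v = S.cls (S.top v)) →
    S.d * (S.star !S.cls v).card ≤ (nbrIn S.G (φ v) (S.star !S.cls v)).card
  closed : ∀ v < S.k, v ∉ S.W → (v ∈ I ↔ S.top v ∈ I)
  quota : ∀ (β : Cl × Fin (S.b + 1) × Fin (S.b + 1)) (p : ι × ι),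
    ((S.tops.filter (fun t => t ∈ I ∧ S.bin t = β ∧ e t = p)).card : ℝ) ≤
      (1 + S.γ) * S.α β.1 p.1 p.2 * (S.tops.filter (fun t => S.bin t = β)).card + 1

variable {S}

/-- The passage from quotas per bin and pair to any quantity `v` depending only on the bin, such as
a side size: each bin and pair exceeds its share by at most one component. -/
theorem sum_le_of_quota {T : Finset ℕ} {e : ℕ → ι × ι}
    (hq : ∀ (β : Cl × Fin (S.b + 1) × Fin (S.b + 1)) (p : ι × ι),
      ((T.filter (fun t => S.bin t = β ∧ e t = p)).card : ℝ) ≤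
        (1 + S.γ) * S.α β.1 p.1 p.2 * (S.tops.filter (fun t => S.bin t = β)).card + 1)
    (v : Cl × Fin (S.b + 1) × Fin (S.b + 1) → ℝ) (v0 : ∀ β, 0 ≤ v β) (v1 : ∀ β, v β ≤ S.b)
    (P : Finset (ι × ι)) :
    ∑ t ∈ T.filter (fun t => e t ∈ P), v (S.bin t) ≤
      (1 + S.γ) * ∑ t ∈ S.tops, v (S.bin t) * ∑ p ∈ P, S.α (S.cl (S.par t)) p.1 p.2 +
      P.card * (Fintype.card Cl * (S.b + 1) ^ 2) * S.b := by
  have e1 : ∑ t ∈ T.filter (fun t => e t ∈ P), v (S.bin t) =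
      ∑ p ∈ P, ∑ β, v β * (T.filter (fun t => S.bin t = β ∧ e t = p)).card := by
    rw [← Finset.sum_fiberwise_of_maps_to (s := T.filter (fun t => e t ∈ P)) (t := P) (g := e)
      (fun t ht => (Finset.mem_filter.1 ht).2)]
    refine Finset.sum_congr rfl fun p hp => ?_
    rw [← Finset.sum_fiberwise_of_maps_to
      (s := (T.filter (fun t => e t ∈ P)).filter (fun t => e t = p)) (t := Finset.univ) (g := S.bin)
      (fun t _ => Finset.mem_univ _)]
    refine Finset.sum_congr rfl fun β _ => ?_
    rw [Finset.sum_congr rfl (g := fun _ => v β)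
      (fun t ht => by rw [(Finset.mem_filter.1 ht).2]), Finset.sum_const, nsmul_eq_mul, mul_comm]
    congr 2
    congr 1
    ext t
    simp only [Finset.mem_filter]
    constructor
    · rintro ⟨⟨⟨h1, -⟩, h3⟩, h4⟩
      exact ⟨h1, h4, h3⟩
    · rintro ⟨h1, h4, h3⟩
      exact ⟨⟨⟨h1, h3 ▸ hp⟩, h3⟩, h4⟩
  have e2 : ∀ p ∈ P, ∑ β, v β * ((T.filter (fun t => S.bin t = β ∧ e t = p)).card : ℝ) ≤
      (1 + S.γ) * ∑ t ∈ S.tops, v (S.bin t) * S.α (S.cl (S.par t)) p.1 p.2 +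
        (Fintype.card Cl * (S.b + 1) ^ 2) * S.b := by
    intro p _
    have e3 : ∑ t ∈ S.tops, v (S.bin t) * S.α (S.cl (S.par t)) p.1 p.2 =
        ∑ β, v β * (S.α β.1 p.1 p.2 * (S.tops.filter (fun t => S.bin t = β)).card) := by
      rw [← Finset.sum_fiberwise_of_maps_to (s := S.tops) (t := Finset.univ) (g := S.bin)
        (fun t _ => Finset.mem_univ _)]
      refine Finset.sum_congr rfl fun β _ => ?_
      rw [Finset.sum_congr rfl (g := fun _ => v β * S.α β.1 p.1 p.2)
        (fun t ht => by rw [← (Finset.mem_filter.1 ht).2]; rfl), Finset.sum_const, nsmul_eq_mul]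
      ring
    calc _ ≤ ∑ β, (v β * ((1 + S.γ) * S.α β.1 p.1 p.2 *
            (S.tops.filter (fun t => S.bin t = β)).card) + v β) := by
          refine Finset.sum_le_sum fun β _ => ?_
          have := mul_le_mul_of_nonneg_left (hq β p) (v0 β)
          linarith
      _ = (1 + S.γ) * ∑ t ∈ S.tops, v (S.bin t) * S.α (S.cl (S.par t)) p.1 p.2 + ∑ β, v β := by
          rw [Finset.sum_add_distrib, e3, Finset.mul_sum]
          congr 1
          refine Finset.sum_congr rfl fun β _ => ?_
          ring
      _ ≤ _ := by
          have : ∑ β, v β ≤ ∑ _β : Cl × Fin (S.b + 1) × Fin (S.b + 1), (S.b : ℝ) :=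
            Finset.sum_le_sum fun β _ => v1 β
          rw [Finset.sum_const, Finset.card_univ, nsmul_eq_mul] at this
          simp only [Fintype.card_prod, Fintype.card_fin] at this
          push_cast at this
          linarith
  rw [e1]
  refine (Finset.sum_le_sum e2).trans (le_of_eq ?_)
  rw [Finset.sum_add_distrib, ← Finset.mul_sum, Finset.sum_comm, Finset.sum_const, nsmul_eq_mul]
  simp only [Finset.mul_sum]
  ring

/-- A vertex in region `i` lies on the root side of a component sent to a pair `(i, j)` or on the
other side of one sent to `(j, i)`, and both sides are controlled by the quotas. -/
theorem Good.card_region_le {I : Finset ℕ} {φ : ℕ → V} {e : ℕ → ι × ι} (hI : S.Good I φ e)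
    (i : ι) :
    ((I.filter (fun v => v ∉ S.W ∧ S.region e v = i)).card : ℝ) ≤ S.load i := by
  set T := S.tops.filter (· ∈ I) with hT
  have hq : ∀ (β : Cl × Fin (S.b + 1) × Fin (S.b + 1)) (p : ι × ι),
      ((T.filter (fun t => S.bin t = β ∧ e t = p)).card : ℝ) ≤
        (1 + S.γ) * S.α β.1 p.1 p.2 * (S.tops.filter (fun t => S.bin t = β)).card + 1 := by
    intro β p
    rw [hT, Finset.filter_filter]
    exact hI.quota β p
  have h1 := sum_le_of_quota hq (fun β => ((β.2.1 : ℕ) : ℝ)) (fun β => Nat.cast_nonneg _)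
    (fun β => by exact_mod_cast Nat.le_of_lt_succ β.2.1.2) (Finset.univ.filter (fun p => p.1 = i))
  have h2 := sum_le_of_quota hq (fun β => ((β.2.2 : ℕ) : ℝ)) (fun β => Nat.cast_nonneg _)
    (fun β => by exact_mod_cast Nat.le_of_lt_succ β.2.2.2) (Finset.univ.filter (fun p => p.2 = i))
  have hc1 : (Finset.univ.filter (fun p : ι × ι => p.1 = i)).card = Fintype.card ι := by
    rw [Finset.card_filter, Fintype.sum_prod_type, Finset.sum_eq_single i] <;> simp +contextual
  have hc2 : (Finset.univ.filter (fun p : ι × ι => p.2 = i)).card = Fintype.card ι := by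
    rw [Finset.card_filter, Fintype.sum_prod_type_right, Finset.sum_eq_single i] <;>
      simp +contextual
  have hs1 : ∀ κ, ∑ p ∈ Finset.univ.filter (fun p : ι × ι => p.1 = i), S.α κ p.1 p.2 =
      ∑ j, S.α κ i j := by
    intro κ
    rw [Finset.sum_filter, Fintype.sum_prod_type, Finset.sum_eq_single i] <;> simp +contextual
  have hs2 : ∀ κ, ∑ p ∈ Finset.univ.filter (fun p : ι × ι => p.2 = i), S.α κ p.1 p.2 =
      ∑ j, S.α κ j i := by
    intro κ
    rw [Finset.sum_filter, Fintype.sum_prod_type_right, Finset.sum_eq_single i] <;>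
      simp +contextual
  simp only [bin_rootSide, bin_otherSide, hc1, hc2, hs1, hs2, Finset.mem_filter,
    Finset.mem_univ, true_and] at h1 h2
  have h3 : (I.filter (fun v => v ∉ S.W ∧ S.region e v = i)).card ≤
      ∑ t ∈ T, ((if (e t).1 = i then S.rootSide t else 0) +
        if (e t).2 = i then S.otherSide t else 0) := by
    have hsub : I.filter (fun v => v ∉ S.W ∧ S.region e v = i) ⊆
        T.biUnion (fun t => (S.comp t).filter (fun v => S.region e v = i)) := by
      intro v hv
      obtain ⟨g1, g2, g3⟩ := Finset.mem_filter.1 hv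
      have hvk := Finset.mem_range.1 (hI.sub g1)
      refine Finset.mem_biUnion.2 ⟨S.top v, Finset.mem_filter.2 ⟨S.top_mem_tops hvk g2,
        (hI.closed v hvk g2).1 g1⟩, Finset.mem_filter.2 ⟨?_, g3⟩⟩
      exact Finset.mem_filter.2 ⟨Finset.mem_range.2 hvk, g2, rfl⟩
    refine (Finset.card_le_card hsub).trans (Finset.card_biUnion_le.trans
      (Finset.sum_le_sum fun t _ => ?_))
    have hsub2 : (S.comp t).filter (fun v => S.region e v = i) ⊆
        (if (e t).1 = i then (Finset.range S.k).filter
          (fun v => (v ∉ S.W ∧ S.top v = t) ∧ S.cls v = S.cls t) else ∅) ∪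
        (if (e t).2 = i then (Finset.range S.k).filter
          (fun v => (v ∉ S.W ∧ S.top v = t) ∧ S.cls v ≠ S.cls t) else ∅) := by
      intro v hv
      obtain ⟨g1, g2⟩ := Finset.mem_filter.1 hv
      obtain ⟨g3, g4, g5⟩ := Finset.mem_filter.1 g1
      simp only [region, g5] at g2
      split_ifs at g2 with h
      · refine Finset.mem_union_left _ ?_
        rw [if_pos g2]
        exact Finset.mem_filter.2 ⟨g3, ⟨g4, g5⟩, h⟩
      · refine Finset.mem_union_right _ ?_
        rw [if_pos g2]
        exact Finset.mem_filter.2 ⟨g3, ⟨g4, g5⟩, h⟩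
    refine (Finset.card_le_card hsub2).trans ((Finset.card_union_le _ _).trans ?_)
    refine Nat.add_le_add ?_ ?_ <;> split_ifs <;> simp [rootSide, otherSide]
  have h4 : ((I.filter (fun v => v ∉ S.W ∧ S.region e v = i)).card : ℝ) ≤
      ∑ t ∈ T.filter (fun t => (e t).1 = i), (S.rootSide t : ℝ) +
      ∑ t ∈ T.filter (fun t => (e t).2 = i), (S.otherSide t : ℝ) := by
    rw [Finset.sum_filter (s := T), Finset.sum_filter (s := T), ← Finset.sum_add_distrib]
    refine le_trans (Nat.cast_le.2 h3) (le_of_eq ?_)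
    push_cast
    rfl
  refine h4.trans ((add_le_add h1 h2).trans (le_of_eq ?_))
  rw [load, Finset.sum_add_distrib]
  ring

/-- The part of a region that is not yet occupied. -/
noncomputable def free (S : TreePacking V ι Cl) (I : Finset ℕ) (φ : ℕ → V) (i : ι) : Finset V :=
  S.reg i \ I.image φ

theorem Good.le_card_free {I : Finset ℕ} {φ : ℕ → V} {e : ℕ → ι × ι} (hI : S.Good I φ e)
    (i : ι) : ((S.reg i).card : ℝ) - S.load i ≤ (S.free I φ i).card := by
  have h1 : S.reg i ∩ I.image φ ⊆ (I.filter (fun v => v ∉ S.W ∧ S.region e v = i)).image φ := by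
    intro x hx
    obtain ⟨hx1, hx2⟩ := Finset.mem_inter.1 hx
    obtain ⟨v, hv, rfl⟩ := Finset.mem_image.1 hx2
    refine Finset.mem_image.2 ⟨v, Finset.mem_filter.2 ⟨hv, ?_⟩, rfl⟩
    by_cases hvH : v ∈ S.H
    · rw [hI.heavy v hvH] at hx1
      exact absurd hx1 (S.hub_reg v hvH i)
    by_cases hvW : v ∈ S.W
    · exact absurd hx1 (Finset.disjoint_left.1 (S.star_reg _ i) (hI.seed v hv hvW hvH))
    refine ⟨hvW, ?_⟩
    by_contra hne
    exact Finset.disjoint_left.1 (S.reg_reg _ _ hne) (hI.comp v hv hvW) hx1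
  have h2 : ((S.reg i ∩ I.image φ).card : ℝ) ≤ S.load i := by
    refine le_trans ?_ (hI.card_region_le i)
    exact_mod_cast (Finset.card_le_card h1).trans Finset.card_image_le
  have h3 := Finset.card_sdiff_add_card_inter (S.reg i) (I.image φ)
  have h4 : ((S.free I φ i).card : ℝ) + (S.reg i ∩ I.image φ).card = (S.reg i).card := by
    exact_mod_cast h3
  linarith

theorem Good.g_le_card_free {I : Finset ℕ} {φ : ℕ → V} {e : ℕ → ι × ι} (hI : S.Good I φ e)
    {w : ℕ} (hw : w ∈ S.W) {i j : ι} (h : 0 < S.α (S.cl w) i j ∨ 0 < S.α (S.cl w) j i) :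
    S.g ≤ (S.free I φ i).card := by
  have h1 := hI.le_card_free i
  have h2 : S.load i + S.g ≤ (S.reg i).card := S.capacity w hw i j h
  linarith

theorem Good.gR_le_card_free {I : Finset ℕ} {φ : ℕ → V} {e : ℕ → ι × ι} (hI : S.Good I φ e)
    {w : ℕ} (hw : w ∈ S.W) (hwH : w ∉ S.H) {i j : ι} (h : 0 < S.α (S.cl w) i j) :
    S.gR ≤ (S.free I φ i).card := by
  have h1 := hI.le_card_free i
  have h2 : S.load i + S.gR ≤ (S.reg i).card := S.capacity_light w hw hwH i j h
  linarith

end TreePacking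
end

/-! ### Embedding one component. -/

section
open scoped Classical
namespace TreePacking

variable {V ι Cl : Type*} [Fintype ι] [Fintype Cl] {S : TreePacking V ι Cl}

theorem mem_comp {v t : ℕ} : v ∈ S.comp t ↔ v < S.k ∧ v ∉ S.W ∧ S.top v = t := by
  rw [comp, Finset.mem_filter, Finset.mem_range]

theorem mem_tops {t : ℕ} : t ∈ S.tops ↔ t < S.k ∧ t ∉ S.W ∧ S.top t = t := by
  rw [tops, Finset.mem_filter, Finset.mem_range]

theorem par_mem_comp {v t : ℕ} (hv : v ∈ S.comp t) (hvt : v ≠ t) : S.par v ∈ S.comp t := by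
  obtain ⟨h1, h2, h3⟩ := mem_comp.1 hv
  have h0 := S.pos_of_notMem h2
  by_cases h : S.par v ∈ S.W
  · exact absurd (h3 ▸ S.top_of_par_mem h) (Ne.symm hvt)
  · exact mem_comp.2 ⟨(S.par_lt v h0 h1).trans h1, h, by rw [← S.top_of_par_notMem h1 h0 h, h3]⟩

theorem σ_le_star (c : Bool) : S.σ ≤ (S.star c).card := by
  have h1 := S.star_card c
  have h2 : S.d * (S.star c).card ≤ (S.star c).card :=
    mul_le_of_le_one_left (Nat.cast_nonneg _) S.d_le
  have h3 : 0 ≤ 2 * S.σ / S.δ := div_nonneg (by linarith [S.σ_pos]) S.δ_pos.le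
  have h4 : (0 : ℝ) ≤ S.W.card := Nat.cast_nonneg _
  linarith

theorem Good.disjoint_comp {I : Finset ℕ} {φ : ℕ → V} {e : ℕ → ι × ι} (hI : S.Good I φ e) {t : ℕ}
    (ht : t ∉ I) {v : ℕ} (hv : v ∈ I) : v ∉ S.comp t := by
  intro h
  obtain ⟨h1, h2, h3⟩ := mem_comp.1 h
  exact ht (h3 ▸ (hI.closed v h1 h2).1 hv)

/-- Some pair of regions still has room in the quota. -/
theorem Good.exists_pair {I : Finset ℕ} {φ : ℕ → V} {e : ℕ → ι × ι} (_hI : S.Good I φ e)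
    {t : ℕ} (ht : t ∈ S.tops) (htI : t ∉ I) {D : Finset ι}
    (hD : 1 - S.δ ≤ ∑ i ∈ D, ∑ j, S.α (S.cl (S.par t)) i j) :
    ∃ i ∈ D, ∃ j, 0 < S.α (S.cl (S.par t)) i j ∧
      ((S.tops.filter (fun u => u ∈ I ∧ S.bin u = S.bin t ∧ e u = (i, j))).card : ℝ) ≤
        (1 + S.γ) * S.α (S.cl (S.par t)) i j *
          (S.tops.filter (fun u => S.bin u = S.bin t)).card := by
  -- If every pair with first member in `D` had reached its quota, at least `(1 + γ) * (1 - δ) * n ≥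
  -- n` components of the bin of `t` would be embedded, although `t` itself is not.
  by_contra hcon
  push Not at hcon
  set n := (S.tops.filter (fun u => S.bin u = S.bin t)).card with hn
  set A := S.tops.filter (fun u => u ∈ I ∧ S.bin u = S.bin t) with hA
  have h1 : A.card < n := by
    refine Finset.card_lt_card (Finset.ssubset_iff_of_subset ?_ |>.2 ⟨t, ?_, ?_⟩)
    · intro u hu
      obtain ⟨h1, -, h2⟩ := Finset.mem_filter.1 hu
      exact Finset.mem_filter.2 ⟨h1, h2⟩
    · exact Finset.mem_filter.2 ⟨ht, rfl⟩
    · intro h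
      exact htI (Finset.mem_filter.1 h).2.1
  have h2 : ∑ p ∈ D ×ˢ Finset.univ, (A.filter (fun u => e u = p)).card ≤ A.card := by
    rw [← Finset.card_biUnion]
    · refine Finset.card_le_card fun u hu => ?_
      obtain ⟨p, -, hp⟩ := Finset.mem_biUnion.1 hu
      exact (Finset.mem_filter.1 hp).1
    · intro p _ q _ hpq
      refine Finset.disjoint_left.2 fun u hu hu' => hpq ?_
      rw [← (Finset.mem_filter.1 hu).2, (Finset.mem_filter.1 hu').2]
  have h3 : ∀ i ∈ D, ∀ j, (1 + S.γ) * S.α (S.cl (S.par t)) i j * n ≤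
      ((A.filter (fun u => e u = (i, j))).card : ℝ) := by
    intro i hi j
    rcases (S.α_nonneg (S.cl (S.par t)) i j).eq_or_lt with h0 | h0
    · rw [← h0, mul_zero, zero_mul]
      exact Nat.cast_nonneg _
    · refine (hcon i hi j h0).le.trans (le_of_eq ?_)
      rw [hA, Finset.filter_filter]
      congr 2
      ext u
      simp only [Finset.mem_filter, and_assoc]
  have h4 : (1 + S.γ) * (∑ i ∈ D, ∑ j, S.α (S.cl (S.par t)) i j) * n ≤ A.card := by
    refine le_trans ?_ (Nat.cast_le.2 h2)
    rw [Nat.cast_sum, Finset.sum_product, Finset.mul_sum, Finset.sum_mul]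
    refine Finset.sum_le_sum fun i hi => ?_
    rw [Finset.mul_sum, Finset.sum_mul]
    exact Finset.sum_le_sum fun j _ => h3 i hi j
  have h5 : 1 ≤ (1 + S.γ) * ∑ i ∈ D, ∑ j, S.α (S.cl (S.par t)) i j :=
    S.γ_δ.trans (mul_le_mul_of_nonneg_left hD (by linarith [S.γ_nonneg]))
  have h6 : (n : ℝ) ≤ A.card := by
    refine le_trans ?_ h4
    nlinarith [Nat.cast_nonneg (α := ℝ) n]
  exact absurd h1 (not_lt.2 (by exact_mod_cast h6))

/-- By `hchild` nothing embedded so far hangs below the component, so it has to be joined only to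
its seed. Its root side avoids the vertices atypical to the reservoir of the seed's class: these
vertices may become parents of later seeds, which by `cross` lie in that reservoir. -/
theorem Good.exists_component {I : Finset ℕ} {φ : ℕ → V} {e : ℕ → ι × ι} (hI : S.Good I φ e)
    {t : ℕ} (ht : t ∈ S.tops) (htI : t ∉ I) (hw : S.par t ∈ S.W) (hwI : S.par t ∈ I)
    (hchild : ∀ u ∈ I, 0 < u → S.par u ∉ S.comp t) {D : Finset ι}
    (hD : 1 - S.δ ≤ ∑ i ∈ D, ∑ j, S.α (S.cl (S.par t)) i j)
    (hcand : ∀ i ∈ D, ∀ j, 0 < S.α (S.cl (S.par t)) i j →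
      2 * S.σ ≤ (nbrIn S.G (φ (S.par t)) (S.free I φ i)).card) :
    ∃ φ' e', S.Good (I ∪ S.comp t) φ' e' ∧ Set.EqOn φ' φ I := by
  obtain ⟨i, hi, j, hij, hq⟩ := hI.exists_pair ht htI hD
  obtain ⟨htk, htW, htt⟩ := mem_tops.1 ht
  have ht0 := S.pos_of_notMem htW
  have htc : t ∈ S.comp t := mem_comp.2 ⟨htk, htW, htt⟩
  set w := S.par t with hwdef
  set bad := (S.reg i).filter (fun x =>
    ((nbrIn S.G x (S.star (S.cls w))).card : ℝ) < S.d * (S.star (S.cls w)).card) with hbad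
  have hfi : S.free I φ i ⊆ S.reg i := Finset.sdiff_subset
  have hfj : S.free I φ j ⊆ S.reg j := Finset.sdiff_subset
  have hbadc : (bad.card : ℝ) < S.σ := S.dense_star w hw i j hij _ subset_rfl (σ_le_star _)
  obtain ⟨ψ, p1, p2, p3, p4⟩ := exists_embedding_of_mostlyDense S.G S.par S.cls t (S.comp t) htc
    (fun v hv hvt => by
      obtain ⟨g1, g2, g3⟩ := mem_comp.1 hv
      have g0 := S.pos_of_notMem g2
      exact ⟨par_mem_comp hv hvt, S.par_lt v g0 g1, S.cls_ne v g0 g1⟩)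
    S.σ S.d S.g S.d_pos.le (by linarith [S.σ_g, S.σ_pos])
    (by
      have : ((S.comp t).card : ℝ) ≤ S.b := by exact_mod_cast S.comp_le t
      linarith [S.b_g])
    (S.free I φ i) (S.free I φ j) (nbrIn S.G (φ w) (S.free I φ i)) bad
    (hI.g_le_card_free hw (Or.inl hij)) (hI.g_le_card_free hw (Or.inr hij))
    ((S.dense_reg w hw i j hij).1.mono hfi hfj) ((S.dense_reg w hw i j hij).2.mono hfj hfi)
    nbrIn_subset (hcand i hi j hij)
    (lt_of_le_of_lt (by
      exact_mod_cast Finset.card_le_card fun x hx => (Finset.mem_filter.1 hx).2) hbadc)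
  have hdis : ∀ v ∈ I, v ∉ S.comp t := fun v hv => hI.disjoint_comp htI hv
  have hψI : ∀ v ∈ S.comp t, ∀ u ∈ I, ψ v ≠ φ u := by
    intro v hv u hu h
    have h1 := p3 v hv
    have h2 : φ u ∈ I.image φ := Finset.mem_image_of_mem _ hu
    rw [← h] at h2
    split_ifs at h1
    · exact (Finset.mem_sdiff.1 (Finset.mem_sdiff.1 h1).1).2 h2
    · exact (Finset.mem_sdiff.1 h1).2 h2
  have hct : S.cls t = !S.cls w := S.cls_eq_not ht0 htk
  have hφI : ∀ v ∈ I, (if v ∈ S.comp t then ψ v else φ v) = φ v := fun v hv =>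
    if_neg (hdis v hv)
  have htop : ∀ v ∈ I, v ∉ S.W → S.top v ≠ t := fun v hv hvW h =>
    htI (h ▸ (hI.closed v (Finset.mem_range.1 (hI.sub hv)) hvW).1 hv)
  refine ⟨fun v => if v ∈ S.comp t then ψ v else φ v, Function.update e t (i, j), ?_, hφI⟩
  constructor
  · exact Finset.union_subset hI.sub (Finset.filter_subset _ _)
  · exact hI.H_sub.trans Finset.subset_union_left
  · intro u hu v hv huv
    dsimp only at huv
    rw [Finset.mem_coe, Finset.mem_union] at hu hv
    rcases hu with hu | hu <;> rcases hv with hv | hv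
    · rw [hφI u hu, hφI v hv] at huv
      exact hI.inj hu hv huv
    · rw [hφI u hu, if_pos hv] at huv
      exact absurd huv.symm (hψI v hv u hu)
    · rw [hφI v hv, if_pos hu] at huv
      exact absurd huv (hψI u hu v hv)
    · rw [if_pos hu, if_pos hv] at huv
      exact p2 hu hv huv
  · intro v hv hv0 hpv
    rcases Finset.mem_union.1 hv with hv | hv
    · rcases Finset.mem_union.1 hpv with hpv | hpv
      · rw [hφI v hv, hφI _ hpv]
        exact hI.adj v hv hv0 hpv
      · exact absurd hpv (hchild v hv hv0)
    · rw [if_pos hv]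
      by_cases hvt : v = t
      · subst hvt
        rw [hφI _ hwI]
        exact (mem_nbrIn.1 p1).2
      · rw [if_pos (par_mem_comp hv hvt)]
        exact p4 v hv hvt
  · intro v hv
    rw [hφI v (hI.H_sub hv)]
    exact hI.heavy v hv
  · intro v hv hvW hvH
    have hvI : v ∈ I := (Finset.mem_union.1 hv).resolve_right fun h => (mem_comp.1 h).2.1 hvW
    rw [hφI v hvI]
    exact hI.seed v hvI hvW hvH
  · intro v hv hvW
    rcases Finset.mem_union.1 hv with hv | hv
    · rw [hφI v hv, region, Function.update_of_ne (htop v hv hvW)]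
      exact hI.comp v hv hvW
    · rw [if_pos hv, region, (mem_comp.1 hv).2.2, Function.update_self]
      have h1 := p3 v hv
      split_ifs at h1 ⊢
      · exact hfi (Finset.mem_sdiff.1 h1).1
      · exact hfj h1
  · intro v hv hvH hc
    rcases Finset.mem_union.1 hv with hv | hv
    · rw [hφI v hv]
      exact hI.typ v hv hvH hc
    · rw [if_pos hv]
      obtain ⟨g1, g2, g3⟩ := mem_comp.1 hv
      have h1 := p3 v hv
      have h2 := hc.resolve_left g2
      rw [g3] at h2
      rw [if_pos h2] at h1
      obtain ⟨h3, h4⟩ := Finset.mem_sdiff.1 h1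
      rw [h2, hct, Bool.not_not]
      by_contra h
      exact h4 (Finset.mem_filter.2 ⟨hfi h3, not_le.1 h⟩)
  · intro v hv hvW
    obtain ⟨-, -, -, -, h5⟩ := S.top_spec hv hvW
    obtain ⟨h6, h7, h8⟩ := mem_tops.1 (S.top_mem_tops hv hvW)
    rw [Finset.mem_union, Finset.mem_union, hI.closed v hv hvW, mem_comp, mem_comp, h5]
    tauto
  · intro β p
    by_cases hβ : β = S.bin t ∧ p = (i, j)
    · obtain ⟨rfl, rfl⟩ := hβ
      have hsub : S.tops.filter (fun u => u ∈ I ∪ S.comp t ∧ S.bin u = S.bin t ∧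
          Function.update e t (i, j) u = (i, j)) ⊆ insert t
          (S.tops.filter (fun u => u ∈ I ∧ S.bin u = S.bin t ∧ e u = (i, j))) := by
        intro u hu
        obtain ⟨g1, g2, g3, g4⟩ := Finset.mem_filter.1 hu
        by_cases hut : u = t
        · exact Finset.mem_insert.2 (Or.inl hut)
        · rw [Function.update_of_ne hut] at g4
          refine Finset.mem_insert_of_mem (Finset.mem_filter.2 ⟨g1, ?_, g3, g4⟩)
          refine (Finset.mem_union.1 g2).resolve_right fun h => hut ?_
          rw [← (mem_comp.1 h).2.2, (mem_tops.1 g1).2.2]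
      have h1 := (Finset.card_le_card hsub).trans (Finset.card_insert_le _ _)
      have h2 : ((S.tops.filter (fun u => u ∈ I ∪ S.comp t ∧ S.bin u = S.bin t ∧
          Function.update e t (i, j) u = (i, j))).card : ℝ) ≤
          (S.tops.filter (fun u => u ∈ I ∧ S.bin u = S.bin t ∧ e u = (i, j))).card + 1 := by
        exact_mod_cast h1
      exact h2.trans (add_le_add hq le_rfl)
    · refine le_trans ?_ (hI.quota β p)
      have hsub : S.tops.filter (fun u => u ∈ I ∪ S.comp t ∧ S.bin u = β ∧
          Function.update e t (i, j) u = p) ⊆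
          S.tops.filter (fun u => u ∈ I ∧ S.bin u = β ∧ e u = p) := by
        intro u hu
        obtain ⟨g1, g2, g3, g4⟩ := Finset.mem_filter.1 hu
        by_cases hut : u = t
        · subst hut
          rw [Function.update_self] at g4
          exact absurd ⟨g3.symm, g4.symm⟩ hβ
        · rw [Function.update_of_ne hut] at g4
          refine Finset.mem_filter.2 ⟨g1, ?_, g3, g4⟩
          refine (Finset.mem_union.1 g2).resolve_right fun h => hut ?_
          rw [← (mem_comp.1 h).2.2, (mem_tops.1 g1).2.2]
      exact_mod_cast Finset.card_le_card hsub

end TreePacking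
end

/-! ### Embedding the seeds and all that hangs at them. -/

section
open scoped Classical
namespace TreePacking

variable {V ι Cl : Type*} [Fintype ι] [Fintype Cl] {S : TreePacking V ι Cl}

/-- The vertices of the components hanging at the seed `w`. -/
noncomputable def hanging (S : TreePacking V ι Cl) (w : ℕ) : Finset ℕ :=
  (Finset.range S.k).filter (fun v => v ∉ S.W ∧ S.par (S.top v) = w)

/-- The proportion of the regions in which `x` has too few free neighbours. -/
noncomputable def atypicalMass (S : TreePacking V ι Cl) (κ : Cl) (Q : ι → Finset V) (x : V) : ℝ :=
  ∑ i ∈ Finset.univ.filter (fun i => ((nbrIn S.G x (Q i)).card : ℝ) < S.d * (Q i).card),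
    ∑ j, S.α κ i j

theorem mem_hanging {v w : ℕ} :
    v ∈ S.hanging w ↔ v < S.k ∧ v ∉ S.W ∧ S.par (S.top v) = w := by
  rw [hanging, Finset.mem_filter, Finset.mem_range]

theorem comp_subset_hanging {t w : ℕ} (h : S.par t = w) : S.comp t ⊆ S.hanging w := by
  intro v hv
  obtain ⟨h1, h2, h3⟩ := mem_comp.1 hv
  exact mem_hanging.2 ⟨h1, h2, by rw [h3, h]⟩

theorem biUnion_comp_eq (w : ℕ) :
    (S.tops.filter (fun t => S.par t = w)).biUnion S.comp = S.hanging w := by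
  ext v
  rw [Finset.mem_biUnion]
  constructor
  · rintro ⟨t, ht, hv⟩
    exact comp_subset_hanging (Finset.mem_filter.1 ht).2 hv
  · intro hv
    obtain ⟨h1, h2, h3⟩ := mem_hanging.1 hv
    exact ⟨S.top v, Finset.mem_filter.2 ⟨S.top_mem_tops h1 h2, h3⟩, mem_comp.2 ⟨h1, h2, rfl⟩⟩

/-- Components are added one by one under a fixed image of `w`. A heavy seed is adjacent to all of
its regions. A light seed needs regions where it still has enough free neighbours, and those it
loses have mass at most `δ`. -/
theorem Good.exists_hanging {I : Finset ℕ} {φ : ℕ → V} {e : ℕ → ι × ι} (hI : S.Good I φ e)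
    {w : ℕ} (hw : w ∈ S.W) (hwI : w ∈ I)
    (h1 : ∀ v ∈ I, v ∉ S.W → S.par (S.top v) ≠ w)
    (h2 : ∀ v ∈ I, 0 < v → S.par v ∉ S.hanging w)
    (hlight : w ∉ S.H → S.atypicalMass (S.cl w) (S.free I φ) (φ w) ≤ S.δ / 2) :
    ∃ φ' e', S.Good (I ∪ S.hanging w) φ' e' := by
  suffices H : ∀ F ⊆ S.tops.filter (fun t => S.par t = w),
      ∃ φ' e', S.Good (I ∪ F.biUnion S.comp) φ' e' ∧ Set.EqOn φ' φ I by
    obtain ⟨φ', e', h, -⟩ := H _ subset_rfl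
    rw [biUnion_comp_eq] at h
    exact ⟨φ', e', h⟩
  intro F
  induction F using Finset.induction_on with
  | empty =>
    intro _
    refine ⟨φ, e, ?_, fun _ _ => rfl⟩
    rwa [Finset.biUnion_empty, Finset.union_empty]
  | insert t F htF ih =>
    intro hF
    obtain ⟨φ', e', hG, heq⟩ := ih ((Finset.subset_insert _ _).trans hF)
    obtain ⟨htop, htw⟩ := Finset.mem_filter.1 (hF (Finset.mem_insert_self _ _))
    obtain ⟨htk, htW, htt⟩ := mem_tops.1 htop
    set J := F.biUnion S.comp with hJ
    have hJh : J ⊆ S.hanging w := Finset.biUnion_subset.2 fun u hu =>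
      comp_subset_hanging (Finset.mem_filter.1 (hF (Finset.mem_insert_of_mem hu))).2
    have htI : t ∉ I ∪ J := by
      intro h
      rcases Finset.mem_union.1 h with h | h
      · exact h1 t h htW (by rw [htt, htw])
      · obtain ⟨u, hu, htu⟩ := Finset.mem_biUnion.1 h
        have := (mem_comp.1 htu).2.2
        rw [htt] at this
        exact htF (this ▸ hu)
    have hchild : ∀ u ∈ I ∪ J, 0 < u → S.par u ∉ S.comp t := by
      intro u hu hu0 hp
      rcases Finset.mem_union.1 hu with hu | hu
      · exact h2 u hu hu0 (comp_subset_hanging htw hp)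
      · obtain ⟨s, hs, hus⟩ := Finset.mem_biUnion.1 hu
        obtain ⟨g1, g2, g3⟩ := mem_comp.1 hus
        obtain ⟨g4, g5, g6⟩ := mem_comp.1 hp
        have := S.top_of_par_notMem g1 hu0 g5
        rw [g3, g6] at this
        exact htF (this ▸ hs)
    have hφw : φ' w = φ w := heq hwI
    have key : ∃ D : Finset ι, 1 - S.δ ≤ ∑ i ∈ D, ∑ j, S.α (S.cl w) i j ∧
        ∀ i ∈ D, ∀ j, 0 < S.α (S.cl w) i j →
          2 * S.σ ≤ (nbrIn S.G (φ w) (S.free (I ∪ J) φ' i)).card := by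
      by_cases hwH : w ∈ S.H
      · refine ⟨Finset.univ, by rw [S.α_sum]; linarith [S.δ_pos], fun i _ j hij => ?_⟩
        have hfull : nbrIn S.G (φ w) (S.free (I ∪ J) φ' i) = S.free (I ∪ J) φ' i := by
          refine Finset.filter_true_of_mem fun x hx => ?_
          rw [hI.heavy w hwH]
          exact S.reg_heavy w hwH i j hij x (Finset.mem_sdiff.1 hx).1
        rw [hfull]
        exact S.σ_g.trans (hG.g_le_card_free hw (Or.inl hij))
      · have hmass := hlight hwH
        set At := Finset.univ.filter (fun i =>
          ((nbrIn S.G (φ w) (S.free I φ i)).card : ℝ) < S.d * (S.free I φ i).card) with hAt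
        set u : ι → Finset V := fun i => S.reg i ∩ J.image φ' with hu
        -- `At` collects the regions where `φ w` was atypical at the outset, `E` those that the
        -- earlier components at `w` have used substantially. Each has mass at most `δ / 2`.
        set E := Finset.univ.filter (fun i => S.d * S.gR / 2 ≤ ((u i).card : ℝ)) with hE
        have hdg : 0 < S.d * S.gR := by linarith [S.σ_gR, S.σ_pos]
        have hEc : (E.card : ℝ) * (S.d * S.gR / 2) ≤ S.h := by
          have e1 : ∑ i ∈ E, (u i).card ≤ S.h := by
            rw [← Finset.card_biUnion]
            · refine le_trans (Finset.card_le_card (t := J.image φ') ?_) ?_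
              · exact Finset.biUnion_subset.2 fun i _ => Finset.inter_subset_right
              · exact Finset.card_image_le.trans
                  ((Finset.card_le_card hJh).trans (S.light_le w hw hwH))
            · intro i _ j _ hij
              exact (S.reg_reg i j hij).mono Finset.inter_subset_left Finset.inter_subset_left
          have e2 : ∑ _i ∈ E, (S.d * S.gR / 2) ≤ ∑ i ∈ E, ((u i).card : ℝ) :=
            Finset.sum_le_sum fun i hi => (Finset.mem_filter.1 hi).2
          rw [Finset.sum_const, nsmul_eq_mul] at e2
          exact e2.trans (by exact_mod_cast e1)
        have hEm : ∑ i ∈ E, ∑ j, S.α (S.cl w) i j ≤ S.δ / 2 := by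
          rcases E.eq_empty_or_nonempty with h0 | ⟨i0, -⟩
          · rw [h0, Finset.sum_empty]
            linarith [S.δ_pos]
          have hμ : 0 ≤ S.μ := le_trans (Finset.sum_nonneg fun j _ => S.α_nonneg (S.cl w) i0 j)
            (S.mass_le w hw hwH i0)
          have e1 : ∑ i ∈ E, ∑ j, S.α (S.cl w) i j ≤ E.card * S.μ := by
            rw [← nsmul_eq_mul]
            exact Finset.sum_le_card_nsmul _ _ _ fun i _ => S.mass_le w hw hwH i
          have e2 := mul_le_mul_of_nonneg_right hEc hμ
          have e3 := S.exhaust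
          have e4 : (E.card * S.μ) * (S.d * S.gR) ≤ S.δ / 2 * (S.d * S.gR) := by nlinarith
          exact e1.trans (le_of_mul_le_mul_right e4 hdg)
        refine ⟨(Finset.univ \ (At ∪ E)), ?_, ?_⟩
        · have e1 := Finset.sum_sdiff (f := fun i => ∑ j, S.α (S.cl w) i j)
            (Finset.subset_univ (At ∪ E))
          rw [S.α_sum] at e1
          have e2 : ∑ i ∈ At ∪ E, ∑ j, S.α (S.cl w) i j ≤
              ∑ i ∈ At, ∑ j, S.α (S.cl w) i j + ∑ i ∈ E, ∑ j, S.α (S.cl w) i j := by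
            rw [← Finset.sum_union_inter]
            exact le_add_of_nonneg_right (Finset.sum_nonneg fun i _ =>
              Finset.sum_nonneg fun j _ => S.α_nonneg _ i j)
          have e3 : ∑ i ∈ At, ∑ j, S.α (S.cl w) i j ≤ S.δ / 2 := hmass
          linarith
        · intro i hi j hij
          obtain ⟨-, hi⟩ := Finset.mem_sdiff.1 hi
          have hiA : S.d * (S.free I φ i).card ≤ (nbrIn S.G (φ w) (S.free I φ i)).card := by
            by_contra h
            exact hi (Finset.mem_union_left _
              (Finset.mem_filter.2 ⟨Finset.mem_univ _, not_le.1 h⟩))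
          have hiE : ((u i).card : ℝ) < S.d * S.gR / 2 := by
            by_contra h
            exact hi (Finset.mem_union_right _
              (Finset.mem_filter.2 ⟨Finset.mem_univ _, not_lt.1 h⟩))
          have hsub : nbrIn S.G (φ w) (S.free I φ i) ⊆
              nbrIn S.G (φ w) (S.free (I ∪ J) φ' i) ∪ u i := by
            intro x hx
            obtain ⟨g1, g2⟩ := mem_nbrIn.1 hx
            obtain ⟨g3, g4⟩ := Finset.mem_sdiff.1 g1
            by_cases hxJ : x ∈ J.image φ'
            · exact Finset.mem_union_right _ (Finset.mem_inter.2 ⟨g3, hxJ⟩)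
            · refine Finset.mem_union_left _ (mem_nbrIn.2 ⟨Finset.mem_sdiff.2 ⟨g3, ?_⟩, g2⟩)
              rw [Finset.image_union, Finset.mem_union]
              rintro (h | h)
              · refine g4 ?_
                rwa [Finset.image_congr heq] at h
              · exact hxJ h
          have hc : ((nbrIn S.G (φ w) (S.free I φ i)).card : ℝ) ≤
              (nbrIn S.G (φ w) (S.free (I ∪ J) φ' i)).card + (u i).card := by
            exact_mod_cast (Finset.card_le_card hsub).trans (Finset.card_union_le _ _)
          have hg := mul_le_mul_of_nonneg_left (hI.gR_le_card_free hw hwH hij) S.d_pos.le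
          linarith [S.σ_gR]
    obtain ⟨D, hD, hcand⟩ := key
    obtain ⟨φ'', e'', hG', heq'⟩ := hG.exists_component htop htI (htw ▸ hw)
      (htw ▸ Finset.mem_union_left _ hwI) hchild (D := D) (by rw [htw]; exact hD)
      (by rw [htw, hφw]; exact hcand)
    refine ⟨φ'', e'', ?_, fun v hv => ?_⟩
    · rwa [Finset.biUnion_insert, Finset.union_comm (S.comp t), ← Finset.union_assoc]
    · rw [heq' (Finset.mem_union_left _ hv), heq hv]

/-- Markov's inequality: every region of positive mass is atypical for fewer than `σ` vertices of
the reservoir, so the atypical masses add up to at most `σ`. -/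
theorem Good.card_atypical_le {I : Finset ℕ} {φ : ℕ → V} {e : ℕ → ι × ι} (hI : S.Good I φ e)
    {w : ℕ} (hw : w ∈ S.W) (hwH : w ∉ S.H) :
    (((S.star (S.cls w)).filter (fun x =>
      S.δ / 2 < S.atypicalMass (S.cl w) (S.free I φ) x)).card : ℝ) ≤ 2 * S.σ / S.δ := by
  set B := (S.star (S.cls w)).filter (fun x =>
    S.δ / 2 < S.atypicalMass (S.cl w) (S.free I φ) x) with hB
  set p : V → ι → Prop := fun x i =>
    ((nbrIn S.G x (S.free I φ i)).card : ℝ) < S.d * (S.free I φ i).card with hp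
  have h1 : (B.card : ℝ) * (S.δ / 2) ≤
      ∑ x ∈ S.star (S.cls w), S.atypicalMass (S.cl w) (S.free I φ) x := by
    rw [← nsmul_eq_mul]
    refine (Finset.card_nsmul_le_sum B _ _ fun x hx => (Finset.mem_filter.1 hx).2.le).trans ?_
    refine Finset.sum_le_sum_of_subset_of_nonneg (Finset.filter_subset _ _) fun x _ _ => ?_
    exact Finset.sum_nonneg fun i _ => Finset.sum_nonneg fun j _ => S.α_nonneg _ i j
  have h2 : ∑ x ∈ S.star (S.cls w), S.atypicalMass (S.cl w) (S.free I φ) x =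
      ∑ i, ((S.star (S.cls w)).filter (fun x => p x i)).card * ∑ j, S.α (S.cl w) i j := by
    simp only [atypicalMass, Finset.sum_filter]
    rw [Finset.sum_comm]
    refine Finset.sum_congr rfl fun i _ => ?_
    rw [← Finset.sum_filter, Finset.sum_const, nsmul_eq_mul]
  have h3 : ∑ i, ((S.star (S.cls w)).filter (fun x => p x i)).card * ∑ j, S.α (S.cl w) i j ≤
      ∑ i, S.σ * ∑ j, S.α (S.cl w) i j := by
    refine Finset.sum_le_sum fun i _ => ?_
    rw [Finset.mul_sum, Finset.mul_sum]
    refine Finset.sum_le_sum fun j _ => ?_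
    rcases (S.α_nonneg (S.cl w) i j).eq_or_lt with h0 | h0
    · rw [← h0, mul_zero, mul_zero]
    · refine mul_le_mul_of_nonneg_right (le_of_lt ?_) h0.le
      refine S.dense_light w hw hwH i j h0 _ Finset.sdiff_subset ?_
      have := hI.g_le_card_free hw (Or.inl h0)
      linarith [S.σ_g, S.σ_pos]
  rw [← Finset.mul_sum, S.α_sum, mul_one] at h3
  rw [le_div_iff₀ S.δ_pos]
  linarith [h1.trans (h2.le.trans h3)]

/-- The image is a neighbour of the parent in the reservoir. Children embedded earlier are heavy,
and their hubs are adjacent to the whole reservoir. -/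
theorem Good.exists_light {I : Finset ℕ} {φ : ℕ → V} {e : ℕ → ι × ι} (hI : S.Good I φ e)
    {w : ℕ} (hw : w ∈ S.W) (hwH : w ∉ S.H) (hwI : w ∉ I) (hp : S.par w ∈ I)
    (hchild : ∀ u ∈ I, 0 < u → S.par u = w → u ∈ S.H) :
    ∃ φ', S.Good (insert w I) φ' e ∧
      S.atypicalMass (S.cl w) (S.free (insert w I) φ') (φ' w) ≤ S.δ / 2 := by
  have hwk : w < S.k := Finset.mem_range.1 (S.W_sub hw)
  have hw0 : 0 < w := Nat.pos_of_ne_zero fun h => hwH (h ▸ S.zero_mem)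
  have hpw := S.par_lt w hw0 hwk
  have hc := S.cls_eq_not hw0 hwk
  have hcand : S.d * (S.star (S.cls w)).card ≤
      (nbrIn S.G (φ (S.par w)) (S.star (S.cls w))).card := by
    by_cases hpH : S.par w ∈ S.H
    · have : nbrIn S.G (φ (S.par w)) (S.star (S.cls w)) = S.star (S.cls w) := by
        refine Finset.filter_true_of_mem fun x hx => ?_
        rw [hI.heavy _ hpH]
        exact S.hub_star_adj _ hpH x (hc ▸ hx)
      rw [this]
      exact mul_le_of_le_one_left (Nat.cast_nonneg _) S.d_le
    · rw [hc]
      refine hI.typ _ hp hpH ?_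
      by_cases hpW : S.par w ∈ S.W
      · exact Or.inl hpW
      -- By `cross`, `w` has the class of the seed above its parent's component, so the parent is on
      -- the root side and was kept typical to this reservoir.
      · refine Or.inr ?_
        obtain ⟨-, g2, g3, -, -⟩ := S.top_spec (hpw.trans hwk) hpW
        have h1 := S.cross w hw hw0 hpW
        rw [S.cls_eq_not g2 (g3.trans_lt (hpw.trans hwk)), show
          S.cls (S.par (S.top (S.par w))) = S.cls w from h1.symm, hc, Bool.not_not]
  set B₁ := (S.star (S.cls w)).filter (fun x =>
    ((nbrIn S.G x (S.star !S.cls w)).card : ℝ) < S.d * (S.star !S.cls w).card) with hB₁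
  set B₂ := (S.star (S.cls w)).filter (fun x =>
      S.δ / 2 < S.atypicalMass (S.cl w) (S.free I φ) x) with hB₂
  have hB₁c : (B₁.card : ℝ) < S.σ := S.star_dense (S.cls w) _ subset_rfl (σ_le_star _)
  have hB₂c : (B₂.card : ℝ) ≤ 2 * S.σ / S.δ := hI.card_atypical_le hw hwH
  have hlt : (S.W.image φ ∪ (B₁ ∪ B₂)).card <
      (nbrIn S.G (φ (S.par w)) (S.star (S.cls w))).card := by
    have h1 : (S.W.image φ ∪ (B₁ ∪ B₂)).card ≤ S.W.card + (B₁.card + B₂.card) :=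
      (Finset.card_union_le _ _).trans (Nat.add_le_add Finset.card_image_le
        (Finset.card_union_le _ _))
    have h2 : ((S.W.image φ ∪ (B₁ ∪ B₂)).card : ℝ) ≤ S.W.card + (B₁.card + B₂.card) := by
      exact_mod_cast h1
    have h3 := S.star_card (S.cls w)
    have : ((S.W.image φ ∪ (B₁ ∪ B₂)).card : ℝ) <
      (nbrIn S.G (φ (S.par w)) (S.star (S.cls w))).card := by linarith
    exact_mod_cast this
  obtain ⟨x, hx, hxn⟩ := Finset.exists_mem_notMem_of_card_lt_card hlt
  obtain ⟨hxs, hxa⟩ := mem_nbrIn.1 hx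
  have hx1 : x ∉ S.W.image φ := fun h => hxn (Finset.mem_union_left _ h)
  have hx2 : x ∉ B₁ := fun h =>
    hxn (Finset.mem_union_right _ (Finset.mem_union_left _ h))
  have hx3 : x ∉ B₂ := fun h =>
    hxn (Finset.mem_union_right _ (Finset.mem_union_right _ h))
  have hxI : ∀ u ∈ I, φ u ≠ x := by
    rintro u hu rfl
    by_cases huH : u ∈ S.H
    · rw [hI.heavy u huH] at hxs
      exact S.hub_star u huH _ hxs
    by_cases huW : u ∈ S.W
    · exact hx1 (Finset.mem_image_of_mem _ huW)
    · exact Finset.disjoint_left.1 (S.star_reg _ _) hxs (hI.comp u hu huW)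
  have hφI : ∀ u ∈ I, Function.update φ w x u = φ u := fun u hu =>
    Function.update_of_ne (ne_of_mem_of_not_mem hu hwI) _ _
  have hfree : S.free (insert w I) (Function.update φ w x) = S.free I φ := by
    funext i
    rw [free, free, Finset.image_insert, Function.update_self,
      Finset.image_congr (g := φ) (fun u hu => hφI u hu), Finset.sdiff_insert,
      Finset.erase_eq_of_notMem]
    intro h
    exact Finset.disjoint_left.1 (S.star_reg _ _) hxs (Finset.mem_sdiff.1 h).1
  refine ⟨Function.update φ w x, ?_, ?_⟩
  · constructor
    · exact Finset.insert_subset (S.W_sub hw) hI.sub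
    · exact hI.H_sub.trans (Finset.subset_insert _ _)
    · intro u hu v hv huv
      rw [Finset.mem_coe, Finset.mem_insert] at hu hv
      rcases hu with rfl | hu <;> rcases hv with rfl | hv
      · rfl
      · rw [Function.update_self, hφI v hv] at huv
        exact absurd huv.symm (hxI v hv)
      · rw [Function.update_self, hφI u hu] at huv
        exact absurd huv (hxI u hu)
      · rw [hφI u hu, hφI v hv] at huv
        exact hI.inj hu hv huv
    · intro v hv hv0 hpv
      rcases Finset.mem_insert.1 hv with rfl | hv
      · rw [Function.update_self, hφI _ hp]
        exact hxa
      · rw [hφI v hv]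
        by_cases hpv' : S.par v = w
        · have hvH := hchild v hv hv0 hpv'
          rw [hpv', Function.update_self, hI.heavy v hvH]
          refine (S.hub_star_adj v hvH x ?_).symm
          rw [S.cls_eq_not hv0 (Finset.mem_range.1 (hI.sub hv)), hpv', Bool.not_not]
          exact hxs
        · have hpvI := (Finset.mem_insert.1 hpv).resolve_left hpv'
          rw [hφI _ hpvI]
          exact hI.adj v hv hv0 hpvI
    · intro v hv
      rw [hφI v (hI.H_sub hv)]
      exact hI.heavy v hv
    · intro v hv hvW hvH
      rcases Finset.mem_insert.1 hv with rfl | hv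
      · rw [Function.update_self]
        exact hxs
      · rw [hφI v hv]
        exact hI.seed v hv hvW hvH
    · intro v hv hvW
      rcases Finset.mem_insert.1 hv with rfl | hv
      · exact absurd hw hvW
      · rw [hφI v hv]
        exact hI.comp v hv hvW
    · intro v hv hvH hcv
      rcases Finset.mem_insert.1 hv with rfl | hv
      · rw [Function.update_self]
        by_contra h
        exact hx2 (Finset.mem_filter.2 ⟨hxs, not_le.1 h⟩)
      · rw [hφI v hv]
        exact hI.typ v hv hvH hcv
    · intro v hv hvW
      have h1 : v ≠ w := fun h => hvW (h ▸ hw)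
      have h2 : S.top v ≠ w := fun h => (S.top_spec hv hvW).1 (h ▸ hw)
      rw [Finset.mem_insert, Finset.mem_insert, hI.closed v hv hvW]
      tauto
    · intro β p
      refine le_trans ?_ (hI.quota β p)
      have hsub : S.tops.filter (fun u => u ∈ insert w I ∧ S.bin u = β ∧ e u = p) ⊆
          S.tops.filter (fun u => u ∈ I ∧ S.bin u = β ∧ e u = p) := by
        intro u hu
        obtain ⟨g1, g2, g3⟩ := Finset.mem_filter.1 hu
        refine Finset.mem_filter.2 ⟨g1, (Finset.mem_insert.1 g2).resolve_left ?_, g3⟩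
        rintro rfl
        exact (mem_tops.1 g1).2.1 hw
      exact_mod_cast Finset.card_le_card hsub
  · rw [hfree, Function.update_self]
    by_contra h
    exact hx3 (Finset.mem_filter.2 ⟨hxs, not_le.1 h⟩)

variable (S)

theorem good_hub (e : ℕ → ι × ι) : S.Good S.H S.hub e := by
  have hW : ∀ {v : ℕ}, v ∉ S.W → v ∉ S.H := fun h h' => h (S.H_sub h')
  constructor
  · exact S.H_sub.trans S.W_sub
  · exact subset_rfl
  · exact S.hub_inj
  · intro v hv hv0 hp
    refine S.hub_adj _ hp _ hv ?_
    exact (S.cls_ne v hv0 (Finset.mem_range.1 (S.W_sub (S.H_sub hv)))).symm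
  · exact fun _ _ => rfl
  · exact fun v hv _ h => absurd hv h
  · exact fun v hv h => absurd hv (hW h)
  · exact fun v hv h => absurd hv h
  · exact fun v hv h => iff_of_false (hW h) (hW (S.top_spec hv h).1)
  · intro β p
    have h0 : S.tops.filter (fun t => t ∈ S.H ∧ S.bin t = β ∧ e t = p) = ∅ :=
      Finset.filter_false_of_mem fun t ht h => hW (mem_tops.1 ht).2.1 h.1
    rw [h0, Finset.card_empty, Nat.cast_zero]
    have := S.α_nonneg β.1 p.1 p.2
    have := S.γ_nonneg
    positivity

/-- Seeds are treated in increasing order, each together with the components hanging at it. The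
parent of the next seed is then already embedded: it is a smaller seed or lies in a component whose
upper seed is smaller. -/
theorem exists_good (n : ℕ) (hn : n ≤ S.k) :
    ∃ φ e, S.Good (S.H ∪ (Finset.range S.k).filter (fun v =>
      (v ∈ S.W ∧ v < n) ∨ (v ∉ S.W ∧ S.par (S.top v) < n))) φ e := by
  induction n with
  | zero =>
    have hne : Nonempty ι := by
      by_contra h
      rw [not_nonempty_iff] at h
      have := S.α_sum (S.cl 0)
      simp at this
    obtain ⟨i⟩ := hne
    refine ⟨S.hub, fun _ => (i, i), ?_⟩
    simp only [not_lt_zero, and_false, or_self, Finset.filter_false, Finset.union_empty]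
    exact S.good_hub _
  | succ n ih =>
    obtain ⟨φ, e, hG⟩ := ih (Nat.le_of_succ_le hn)
    set I := S.H ∪ (Finset.range S.k).filter (fun v =>
      (v ∈ S.W ∧ v < n) ∨ (v ∉ S.W ∧ S.par (S.top v) < n)) with hIdef
    have hI : ∀ v, v ∈ I ↔ v ∈ S.H ∨ v < S.k ∧
        ((v ∈ S.W ∧ v < n) ∨ (v ∉ S.W ∧ S.par (S.top v) < n)) := by
      intro v
      rw [hIdef, Finset.mem_union, Finset.mem_filter, Finset.mem_range]
    by_cases hnW : n ∈ S.W
    · have hWH : ∀ {v : ℕ}, v ∈ S.H → v ∈ S.W := fun h => S.H_sub h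
      have hpt : ∀ v < S.k, v ∉ S.W → S.par (S.top v) < v := by
        intro v hv hvW
        obtain ⟨-, g2, g3, -, -⟩ := S.top_spec hv hvW
        exact (S.par_lt _ g2 (g3.trans_lt hv)).trans_le g3
      have hmain : ∀ (φ : ℕ → V), S.Good (insert n I) φ e →
          (n ∉ S.H → S.atypicalMass (S.cl n) (S.free (insert n I) φ) (φ n) ≤ S.δ / 2) →
          ∃ φ' e', S.Good (insert n I ∪ S.hanging n) φ' e' := by
        intro φ hφ hl
        refine hφ.exists_hanging hnW (Finset.mem_insert_self _ _) ?_ ?_ hl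
        · intro v hv hvW
          rcases Finset.mem_insert.1 hv with rfl | hv
          · exact absurd hnW hvW
          · rcases (hI v).1 hv with h | ⟨-, h | h⟩
            · exact absurd (hWH h) hvW
            · exact absurd h.1 hvW
            · exact h.2.ne
        · intro v hv hv0 hp
          obtain ⟨g1, g2, g3⟩ := mem_hanging.1 hp
          have hvk : v < S.k := Finset.mem_range.1 (hφ.sub hv)
          have hlt := hpt _ g1 g2
          have hlt' := S.par_lt v hv0 hvk
          rcases Finset.mem_insert.1 hv with rfl | hv
          · omega
          · rcases (hI v).1 hv with h | ⟨-, h | h⟩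
            · exact g2 (S.par_heavy v h hv0)
            · omega
            · rw [S.top_of_par_notMem hvk hv0 g2] at h
              omega
      have hfin : ∀ φ' e', S.Good (insert n I ∪ S.hanging n) φ' e' →
          ∃ φ e, S.Good (S.H ∪ (Finset.range S.k).filter (fun v =>
            (v ∈ S.W ∧ v < n + 1) ∨ (v ∉ S.W ∧ S.par (S.top v) < n + 1))) φ e := by
        intro φ' e' h
        refine ⟨φ', e', ?_⟩
        convert h using 1
        ext v
        rw [Finset.mem_union, Finset.mem_union, Finset.mem_insert, hI, mem_hanging,
          Finset.mem_filter, Finset.mem_range]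
        constructor
        · rintro (h | ⟨h1, ⟨h2, h3⟩ | ⟨h2, h3⟩⟩)
          · tauto
          · rcases Nat.lt_succ_iff_lt_or_eq.1 h3 with h | h <;> tauto
          · rcases Nat.lt_succ_iff_lt_or_eq.1 h3 with h | h <;> tauto
        · rintro ((rfl | h | ⟨h1, ⟨h2, h3⟩ | ⟨h2, h3⟩⟩) | ⟨h1, h2, h3⟩)
          · exact Or.inr ⟨Finset.mem_range.1 (S.W_sub hnW), Or.inl ⟨hnW, Nat.lt_succ_self _⟩⟩
          · exact Or.inl h
          · exact Or.inr ⟨h1, Or.inl ⟨h2, Nat.lt_succ_of_lt h3⟩⟩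
          · exact Or.inr ⟨h1, Or.inr ⟨h2, Nat.lt_succ_of_lt h3⟩⟩
          · exact Or.inr ⟨h1, Or.inr ⟨h2, h3 ▸ Nat.lt_succ_self _⟩⟩
      by_cases hnH : n ∈ S.H
      · have hnI : insert n I = I := Finset.insert_eq_of_mem ((hI n).2 (Or.inl hnH))
        obtain ⟨φ', e', h⟩ := hmain φ (by rwa [hnI]) (fun h => absurd hnH h)
        exact hfin φ' e' h
      · have hn0 : 0 < n := Nat.pos_of_ne_zero fun h => hnH (h ▸ S.zero_mem)
        have hnk : n < S.k := hn
        have hpn := S.par_lt n hn0 hnk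
        have hnI : n ∉ I := by
          rw [hI]
          rintro (h | ⟨-, h | h⟩)
          · exact hnH h
          · exact lt_irrefl _ h.2
          · exact h.1 hnW
        have hpI : S.par n ∈ I := by
          rw [hI]
          refine Or.inr ⟨hpn.trans hnk, ?_⟩
          by_cases hpW : S.par n ∈ S.W
          · exact Or.inl ⟨hpW, hpn⟩
          · exact Or.inr ⟨hpW, (hpt _ (hpn.trans hnk) hpW).trans hpn⟩
        obtain ⟨φ', h1, h2⟩ := hG.exists_light hnW hnH hnI hpI (by
          intro u hu hu0 hp
          have huk : u < S.k := Finset.mem_range.1 (hG.sub hu)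
          have hlt := S.par_lt u hu0 huk
          rcases (hI u).1 hu with h | ⟨-, h | h⟩
          · exact h
          · omega
          · rw [S.top_of_par_mem (hp ▸ hnW)] at h
            omega)
        obtain ⟨φ'', e', h⟩ := hmain φ' h1 (fun _ => h2)
        exact hfin φ'' e' h
    · refine ⟨φ, e, ?_⟩
      convert hG using 1
      ext v
      rw [hI, Finset.mem_union, Finset.mem_filter, Finset.mem_range]
      refine or_congr_right (and_congr_right fun hvk => or_congr ?_ ?_)
      · refine and_congr_right fun hvW => ?_
        have : v ≠ n := fun h => hnW (h ▸ hvW)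
        omega
      · refine and_congr_right fun hvW => ?_
        have : S.par (S.top v) ≠ n := fun h => hnW (h ▸ (S.top_spec hvk hvW).2.2.2.1)
        omega

/-- A tree packing yields an embedding of the tree. -/
theorem exists_embedding : ∃ φ : ℕ → V, Set.InjOn φ (Finset.range S.k) ∧
    ∀ v, 0 < v → v < S.k → S.G.Adj (φ (S.par v)) (φ v) := by
  obtain ⟨φ, e, h⟩ := S.exists_good S.k le_rfl
  have huniv : ∀ v < S.k, v ∈ S.H ∪ (Finset.range S.k).filter (fun v =>
      (v ∈ S.W ∧ v < S.k) ∨ (v ∉ S.W ∧ S.par (S.top v) < S.k)) := by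
    intro v hv
    refine Finset.mem_union_right _ (Finset.mem_filter.2 ⟨Finset.mem_range.2 hv, ?_⟩)
    by_cases hvW : v ∈ S.W
    · exact Or.inl ⟨hvW, hv⟩
    · obtain ⟨-, g2, g3, -, -⟩ := S.top_spec hv hvW
      exact Or.inr ⟨hvW, (S.par_lt _ g2 (g3.trans_lt hv)).trans (g3.trans_lt hv)⟩
  refine ⟨φ, fun u hu v hv huv => h.inj (huniv u (Finset.mem_range.1 hu))
    (huniv v (Finset.mem_range.1 hv)) huv, fun v hv0 hv => ?_⟩
  exact h.adj v (huniv v hv) hv0 (huniv _ ((S.par_lt v hv0 hv).trans hv))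

end TreePacking
end

/-! ### The regularity lemma and the weighted reduced graph. -/

section
open scoped Classical

theorem MostlyDense.of_le {V : Type*} {G : SimpleGraph V} {σ σ' d d' : ℝ} {P P' : Finset V}
    (h : MostlyDense G σ d P P') (hσ : σ ≤ σ') (hd : d' ≤ d) : MostlyDense G σ' d' P P' := by
  intro Q hQ hQσ
  refine lt_of_lt_of_le (lt_of_le_of_lt ?_ (h Q hQ (hσ.trans hQσ))) hσ
  refine Nat.cast_le.2 (Finset.card_le_card fun x hx => ?_)
  obtain ⟨h1, h2⟩ := Finset.mem_filter.1 hx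
  exact Finset.mem_filter.2 ⟨h1, h2.trans_le (mul_le_mul_of_nonneg_right hd (Nat.cast_nonneg _))⟩

theorem card_interedges_eq_sum {V : Type*} (G : SimpleGraph V) (S Q : Finset V) :
    (G.interedges S Q).card = ∑ x ∈ S, (nbrIn G x Q).card := by
  rw [SimpleGraph.interedges_def, Finset.card_filter, Finset.sum_product]
  refine Finset.sum_congr rfl fun x _ => ?_
  rw [nbrIn, Finset.card_filter]

theorem edgeDensity_mul {V : Type*} (G : SimpleGraph V) (S Q : Finset V) :
    ((G.edgeDensity S Q : ℚ) : ℝ) * (S.card * Q.card) = ∑ x ∈ S, ((nbrIn G x Q).card : ℝ) := by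
  have h := card_interedges_eq_sum G S Q
  have h' : ((G.interedges S Q).card : ℝ) = ∑ x ∈ S, ((nbrIn G x Q).card : ℝ) := by
    exact_mod_cast h
  rw [← h', SimpleGraph.edgeDensity_def]
  push_cast
  refine div_mul_cancel_of_imp fun h0 => ?_
  have h1 : S.card * Q.card = 0 := by exact_mod_cast h0
  have := SimpleGraph.card_interedges_le_mul G S Q
  rw [h1] at this
  exact_mod_cast Nat.le_zero.1 this

/-- If too many vertices had few neighbours in `Q`, they would form with `Q` a pair of density too
small for uniformity. -/
theorem mostlyDense_of_isUniform {V : Type*} (G : SimpleGraph V) {ε₀ ε s : ℝ} (hε : ε₀ ≤ ε)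
    (h0 : 0 ≤ ε₀) (hs : 0 < ε * s) {P P' : Finset V} (hP : (P.card : ℝ) ≤ s)
    (hP' : (P'.card : ℝ) ≤ s) (h : G.IsUniform ε₀ P P') :
    MostlyDense G (ε * s) (((G.edgeDensity P P' : ℚ) : ℝ) - ε) P P' := by
  intro Q hQ hQs
  by_contra hcon
  rw [not_lt] at hcon
  set S := P.filter fun x =>
    ((nbrIn G x Q).card : ℝ) < (((G.edgeDensity P P' : ℚ) : ℝ) - ε) * Q.card with hS
  have hs0 : 0 ≤ s := (Nat.cast_nonneg _).trans hP
  have hle : ∀ {x : ℝ}, x ≤ s → x * ε₀ ≤ ε * s := fun {x} hx =>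
    (mul_le_mul_of_nonneg_right hx h0).trans (by
      rw [mul_comm]; exact mul_le_mul_of_nonneg_right hε hs0)
  have h1 := abs_lt.1 (h (Finset.filter_subset _ _) hQ ((hle hP).trans hcon) ((hle hP').trans hQs))
  have hSp : (0 : ℝ) < S.card := hs.trans_le hcon
  have hQp : (0 : ℝ) < Q.card := hs.trans_le hQs
  have h2 : ∑ x ∈ S, ((nbrIn G x Q).card : ℝ) ≤
      ∑ _x ∈ S, (((G.edgeDensity P P' : ℚ) : ℝ) - ε) * Q.card :=
    Finset.sum_le_sum fun x hx => (Finset.mem_filter.1 hx).2.le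
  rw [← edgeDensity_mul, Finset.sum_const, nsmul_eq_mul] at h2
  have h3 : 0 < (S.card : ℝ) * Q.card := mul_pos hSp hQp
  have h4 : (((G.edgeDensity S Q : ℚ) : ℝ)) * (S.card * Q.card) ≤
      (((G.edgeDensity P P' : ℚ) : ℝ) - ε) * (S.card * Q.card) := by linarith
  have h5 := le_of_mul_le_mul_right h4 h3
  linarith [h1.1]

theorem sum_card_nbrIn_le {V : Type*} (G : SimpleGraph V) (S Q : Finset V) :
    ∑ x ∈ S, ((nbrIn G x Q).card : ℝ) ≤ S.card * Q.card := by
  rw [← nsmul_eq_mul]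
  exact Finset.sum_le_card_nsmul _ _ _ fun x _ =>
    Nat.cast_le.2 (Finset.card_le_card nbrIn_subset)

/-- The number of clusters that are irregular to many others is small. -/
theorem card_irregular_le {V : Type*} [Fintype V] (G : SimpleGraph V)
    (P : Finpartition (Finset.univ : Finset V)) {ε : ℝ} (hε : 0 < ε)
    (h : P.IsUniform G (ε ^ 2)) :
    ((P.parts.filter fun C => ε * P.parts.card <
      ((P.parts.filter fun D => C ≠ D ∧ ¬ G.IsUniform (ε ^ 2) C D).card : ℝ)).card : ℝ) ≤
      ε * P.parts.card := by
  rcases P.parts.eq_empty_or_nonempty with h0 | h0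
  · rw [h0]
    simp
  have hM : (0 : ℝ) < P.parts.card := Nat.cast_pos.2 h0.card_pos
  set B := P.parts.filter fun C => ε * P.parts.card <
      ((P.parts.filter fun D => C ≠ D ∧ ¬ G.IsUniform (ε ^ 2) C D).card : ℝ) with hB
  -- The square is split by double counting: among at most `ε ^ 2 * M ^ 2` irregular pairs, for `M`
  -- clusters, at most `ε * M` clusters lie in more than `ε * M` of them.
  have h1 : (B.card : ℝ) * (ε * P.parts.card) ≤
      ∑ C ∈ B, ((P.parts.filter fun D => C ≠ D ∧ ¬ G.IsUniform (ε ^ 2) C D).card : ℝ) := by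
    rw [← nsmul_eq_mul]
    exact Finset.card_nsmul_le_sum _ _ _ fun C hC => (Finset.mem_filter.1 hC).2.le
  have h2 : ∑ C ∈ B, (P.parts.filter fun D => C ≠ D ∧ ¬ G.IsUniform (ε ^ 2) C D).card ≤
      (P.nonUniforms G (ε ^ 2)).card := by
    rw [← Finset.card_sigma]
    refine Finset.card_le_card_of_injOn (fun x => (x.1, x.2)) ?_ ?_
    · rintro ⟨C, D⟩ hx
      simp only [Finset.mem_coe, Finset.mem_sigma, Finset.mem_filter, hB] at hx
      exact Finset.mem_coe.2 ((P.mk_mem_nonUniforms G).2 ⟨hx.1.1, hx.2.1, hx.2.2.1, hx.2.2.2⟩)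
    · rintro ⟨C, D⟩ _ ⟨C', D'⟩ _ hxy
      simp only [Prod.mk.injEq] at hxy
      rw [hxy.1, hxy.2]
  have h3 : ((P.nonUniforms G (ε ^ 2)).card : ℝ) ≤ P.parts.card * P.parts.card * ε ^ 2 := by
    refine h.trans (mul_le_mul_of_nonneg_right ?_ (sq_nonneg _))
    exact_mod_cast Nat.mul_le_mul_left _ (Nat.sub_le _ _)
  have h4 : (B.card : ℝ) * (ε * P.parts.card) ≤ (ε * P.parts.card) * (ε * P.parts.card) :=
    h1.trans (le_trans (by exact_mod_cast h2) (h3.trans (le_of_eq (by ring))))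
  exact le_of_mul_le_mul_right h4 (mul_pos hε hM)

/-- The weight of a pair of clusters in the reduced graph. -/
noncomputable def clusterWeight {V : Type*} (G : SimpleGraph V) (ε d : ℝ) (C D : Finset V) : ℝ :=
  if C ≠ D ∧ G.IsUniform ε C D ∧ d ≤ ((G.edgeDensity C D : ℚ) : ℝ) then
    ((G.edgeDensity C D : ℚ) : ℝ) else 0

theorem clusterWeight_comm {V : Type*} (G : SimpleGraph V) (ε d : ℝ) (C D : Finset V) :
    clusterWeight G ε d C D = clusterWeight G ε d D C := by
  have h : G.IsUniform ε C D ↔ G.IsUniform ε D C := ⟨fun h => h.symm, fun h => h.symm⟩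
  simp only [clusterWeight, SimpleGraph.edgeDensity_comm G C D, @ne_comm _ C D, h]

theorem clusterWeight_self {V : Type*} (G : SimpleGraph V) (ε d : ℝ) (C : Finset V) :
    clusterWeight G ε d C C = 0 := if_neg fun h => h.1 rfl

theorem clusterWeight_nonneg {V : Type*} (G : SimpleGraph V) (ε d : ℝ) (C D : Finset V) :
    0 ≤ clusterWeight G ε d C D := by
  rw [clusterWeight]
  split_ifs
  · exact_mod_cast SimpleGraph.edgeDensity_nonneg G C D
  · exact le_rfl

theorem clusterWeight_le_one {V : Type*} (G : SimpleGraph V) (ε d : ℝ) (C D : Finset V) :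
    clusterWeight G ε d C D ≤ 1 := by
  rw [clusterWeight]
  split_ifs
  · exact_mod_cast SimpleGraph.edgeDensity_le_one G C D
  · exact zero_le_one

theorem clusterWeight_pos {V : Type*} {G : SimpleGraph V} {ε d : ℝ} {C D : Finset V}
    (h : 0 < clusterWeight G ε d C D) : G.IsUniform ε C D ∧
      d ≤ ((G.edgeDensity C D : ℚ) : ℝ) ∧
      clusterWeight G ε d C D = ((G.edgeDensity C D : ℚ) : ℝ) := by
  rw [clusterWeight] at h ⊢
  split_ifs at h ⊢ with hc
  · exact ⟨hc.2.1, hc.2.2, rfl⟩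
  · exact absurd h (lt_irrefl _)

/-- Vertices of large degree in a cluster force a large weighted degree of the cluster. -/
theorem le_sum_clusterWeight {V : Type*} [Fintype V] (G : SimpleGraph V)
    (P : Finpartition (Finset.univ : Finset V)) {ε d s K : ℝ} (hε : 0 < ε) (hd : 0 ≤ d)
    (hs : ∀ C ∈ P.parts, (C.card : ℝ) ≤ s) {C : Finset V} (hC : C ∈ P.parts)
    (hirr : ((P.parts.filter fun D => C ≠ D ∧ ¬ G.IsUniform (ε ^ 2) C D).card : ℝ) ≤
      ε * P.parts.card)
    {S : Finset V} (hSC : S ⊆ C) (hSc : ε ^ 2 * C.card ≤ S.card)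
    (hS : ∀ v ∈ S, K ≤ G.degree v) :
    K ≤ s * (∑ D ∈ P.parts, clusterWeight G (ε ^ 2) d C D) +
      s * ((d + ε ^ 2 + ε) * P.parts.card + 1) := by
  have hε2 : 0 < ε ^ 2 := pow_pos hε 2
  have hCp : (0 : ℝ) < C.card := Nat.cast_pos.2 (P.nonempty_of_mem_parts hC).card_pos
  have hSp : (0 : ℝ) < S.card := (mul_pos hε2 hCp).trans_le hSc
  have hs0 : 0 ≤ s := hCp.le.trans (hs C hC)
  have hdeg : ∀ v, (G.degree v : ℝ) = ∑ D ∈ P.parts, ((nbrIn G v D).card : ℝ) := by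
    intro v
    rw [← SimpleGraph.card_neighborFinset_eq_degree, ← Nat.cast_sum, ← Finset.card_biUnion]
    · congr 2
      ext u
      rw [SimpleGraph.mem_neighborFinset, Finset.mem_biUnion]
      constructor
      · intro h
        obtain ⟨D, hD, hu⟩ := P.exists_mem (Finset.mem_univ u)
        exact ⟨D, hD, mem_nbrIn.2 ⟨hu, h⟩⟩
      · rintro ⟨D, -, hu⟩
        exact (mem_nbrIn.1 hu).2
    · intro D hD D' hD' hne
      exact (P.disjoint hD hD' hne).mono nbrIn_subset nbrIn_subset
  have h1 : S.card * K ≤ ∑ D ∈ P.parts, ∑ v ∈ S, ((nbrIn G v D).card : ℝ) := by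
    rw [Finset.sum_comm, ← nsmul_eq_mul]
    refine (Finset.card_nsmul_le_sum _ _ _ hS).trans (le_of_eq ?_)
    exact Finset.sum_congr rfl fun v _ => hdeg v
  -- For a regular pair the density from `S` is within `ε ^ 2` of that from `C`, which the weight
  -- represents up to the cutoff `d`. Irregular pairs and `D = C` get the trivial bound.
  have h2 : ∀ D ∈ P.parts, ∑ v ∈ S, ((nbrIn G v D).card : ℝ) ≤ S.card * (s *
      (clusterWeight G (ε ^ 2) d C D + (d + ε ^ 2) +
        ((if C ≠ D ∧ ¬ G.IsUniform (ε ^ 2) C D then 1 else 0) + if C = D then 1 else 0))) := by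
    intro D hD
    have hw := clusterWeight_nonneg G (ε ^ 2) d C D
    by_cases hr : C ≠ D ∧ G.IsUniform (ε ^ 2) C D
    · have hu := abs_lt.1 (hr.2 hSC subset_rfl (by rw [mul_comm]; exact hSc)
        (mul_le_of_le_one_right (Nat.cast_nonneg _) (by
          by_contra h
          rw [not_le] at h
          have h5 : (S.card : ℝ) ≤ C.card := Nat.cast_le.2 (Finset.card_le_card hSC)
          nlinarith)))
      have h3 : ((G.edgeDensity C D : ℚ) : ℝ) ≤ clusterWeight G (ε ^ 2) d C D + d := by
        rw [clusterWeight]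
        split_ifs with hc
        · linarith
        · have : ¬ d ≤ ((G.edgeDensity C D : ℚ) : ℝ) := fun h => hc ⟨hr.1, hr.2, h⟩
          linarith
      rw [← edgeDensity_mul, if_neg (fun h => h.2 hr.2), if_neg hr.1, add_zero, add_zero]
      have h4 : ((G.edgeDensity S D : ℚ) : ℝ) ≤ clusterWeight G (ε ^ 2) d C D + (d + ε ^ 2) := by
        linarith [hu.2]
      calc _ ≤ (clusterWeight G (ε ^ 2) d C D + (d + ε ^ 2)) * (S.card * D.card) :=
            mul_le_mul_of_nonneg_right h4 (by positivity)
        _ ≤ (clusterWeight G (ε ^ 2) d C D + (d + ε ^ 2)) * (S.card * s) :=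
            mul_le_mul_of_nonneg_left (mul_le_mul_of_nonneg_left (hs D hD) hSp.le) (by positivity)
        _ = _ := by ring
    · have h3 : (1 : ℝ) ≤ (if C ≠ D ∧ ¬ G.IsUniform (ε ^ 2) C D then 1 else 0) +
          if C = D then 1 else 0 := by
        by_cases hCD : C = D
        · rw [if_pos hCD, if_neg (fun h => h.1 hCD), zero_add]
        · rw [if_neg hCD, if_pos ⟨hCD, fun h => hr ⟨hCD, h⟩⟩, add_zero]
      refine (sum_card_nbrIn_le G S D).trans (mul_le_mul_of_nonneg_left ?_ hSp.le)
      refine (hs D hD).trans (le_mul_of_one_le_right hs0 ?_)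
      linarith
  have h3 := h1.trans (Finset.sum_le_sum h2)
  rw [← Finset.mul_sum] at h3
  have h4 := le_of_mul_le_mul_left h3 hSp
  rw [← Finset.mul_sum] at h4
  simp only [Finset.sum_add_distrib, Finset.sum_const, nsmul_eq_mul] at h4
  rw [← Finset.sum_filter, Finset.sum_const, nsmul_eq_mul, mul_one, Finset.sum_ite_eq,
    if_pos hC] at h4
  refine (h4.trans (mul_le_mul_of_nonneg_left (c := ∑ D ∈ P.parts,
    clusterWeight G (ε ^ 2) d C D + ((d + ε ^ 2 + ε) * P.parts.card + 1)) ?_ hs0)).trans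
    (le_of_eq (mul_add _ _ _))
  linarith

/-- The reduced graph of a large graph, with the weighted degrees of its clusters. -/
theorem exists_reduced_graph (ξ ε : ℝ) (hξ : 0 < ξ) (hξ1 : ξ ≤ 1) (hε : 0 < ε) :
    ∃ M₀ : ℕ, ∀ (V : Type) [Fintype V] (G : SimpleGraph V), M₀ ≤ Fintype.card V →
      ∃ (M c : ℕ) (C : Fin M → Finset V) (w : Fin M → Fin M → ℝ),
        0 < M ∧ M ≤ M₀ ∧ M * c ≤ Fintype.card V ∧ Fintype.card V ≤ M * (c + 1) ∧
        (∀ i j, i ≠ j → Disjoint (C i) (C j)) ∧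
        (∀ i, c ≤ (C i).card ∧ (C i).card ≤ c + 1) ∧
        (∀ i, w i i = 0) ∧ (∀ i j, w i j = w j i) ∧ (∀ i j, 0 ≤ w i j) ∧ (∀ i j, w i j ≤ 1) ∧
        (∀ i j, 0 < w i j → ξ / 4 ≤ w i j ∧
          MostlyDense G (ε * (c + 1)) (w i j - ε) (C i) (C j)) ∧
        ∀ K : ℝ, ((Finset.univ.filter fun v => K ≤ G.degree v).card : ℝ) -
            ξ * Fintype.card V ≤
          c * (Finset.univ.filter fun i => K - ξ * Fintype.card V ≤ c * ∑ j, w i j).card := by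
  set ε₁ : ℝ := min (min ε 1) (ξ / 16) with hε₁
  have hε₁0 : 0 < ε₁ := lt_min (lt_min hε one_pos) (by positivity)
  have hε₁1 : ε₁ ≤ 1 := (min_le_left _ _).trans (min_le_right _ _)
  have hε₁ε : ε₁ ≤ ε := (min_le_left _ _).trans (min_le_left _ _)
  have hε₁ξ : ε₁ ≤ ξ / 16 := min_le_right _ _
  have hsq : ε₁ ^ 2 ≤ ε₁ := by nlinarith
  have hsq0 : 0 < ε₁ ^ 2 := pow_pos hε₁0 2
  set l := ⌈16 / ξ⌉₊ with hl
  set B := SzemerediRegularity.bound (ε₁ ^ 2) l with hB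
  -- The choice of `l` makes a cluster smaller than `ξ * n / 16`, and the last bound gives `16 * M ≤
  -- ξ * n`; both absorb the difference between `c` and `c + 1`.
  refine ⟨max (max l B) ⌈16 * B / ξ⌉₊ + 1, fun V _ G hn => ?_⟩
  obtain ⟨P, hP, hlP, hPB, hU⟩ := szemeredi_regularity G hsq0 (l := l) (by
    refine le_trans ?_ hn
    exact ((le_max_left _ _).trans (le_max_left _ _)).trans (Nat.le_succ _))
  set n := Fintype.card V with hn'
  set M := P.parts.card with hM
  set c := n / M with hc
  have hl0 : (16 : ℝ) / ξ ≤ l := Nat.le_ceil _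
  have hMl : (l : ℝ) ≤ M := Nat.cast_le.2 hlP
  have hM16 : 16 ≤ ξ * M := by
    rw [div_le_iff₀ hξ] at hl0
    nlinarith
  have hM0 : 0 < M := by
    rcases Nat.eq_zero_or_pos M with h | h
    · rw [h, Nat.cast_zero, mul_zero] at hM16
      norm_num at hM16
    · exact h
  have hM0' : (0 : ℝ) < M := Nat.cast_pos.2 hM0
  have hMn : 16 * (M : ℝ) ≤ ξ * n := by
    have h1 : (16 * B / ξ : ℝ) ≤ n := by
      refine (Nat.le_ceil _).trans (Nat.cast_le.2 (le_trans ?_ hn))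
      exact (le_max_right _ _).trans (Nat.le_succ _)
    rw [div_le_iff₀ hξ] at h1
    have h2 : (M : ℝ) ≤ B := Nat.cast_le.2 hPB
    linarith
  have hcM : M * c ≤ n := Nat.mul_div_le _ _
  have hcM' : n ≤ M * (c + 1) := (Nat.lt_mul_div_succ n hM0).le
  have hcMr : (M : ℝ) * c ≤ n := by exact_mod_cast hcM
  have hcards : (Finset.univ : Finset V).card = n := Finset.card_univ
  have hlo : ∀ C ∈ P.parts, c ≤ C.card := fun C hC => by
    have := hP.average_le_card_part hC
    rwa [hcards] at this
  have hhi : ∀ C ∈ P.parts, C.card ≤ c + 1 := fun C hC => by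
    have := hP.card_part_le_average_add_one hC
    rwa [hcards] at this
  have hhi' : ∀ C ∈ P.parts, (C.card : ℝ) ≤ (c : ℝ) + 1 := fun C hC => by exact_mod_cast hhi C hC
  set q := P.parts.equivFin with hq
  have hsum : ∀ f : Finset V → ℝ, ∑ j : Fin M, f (q.symm j).1 = ∑ D ∈ P.parts, f D := by
    intro f
    rw [← Finset.sum_coe_sort P.parts f]
    exact Equiv.sum_comp q.symm (fun D : P.parts => f D.1)
  have hcount : ∀ p : Finset V → Prop,
      ((Finset.univ.filter fun j : Fin M => p (q.symm j).1).card : ℝ) =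
        (P.parts.filter p).card := by
    intro p
    rw [Finset.card_filter, Finset.card_filter]
    push_cast
    exact hsum (fun D => if p D then 1 else 0)
  refine ⟨M, c, fun i => (q.symm i).1,
    fun i j => clusterWeight G (ε₁ ^ 2) (ξ / 4) (q.symm i).1 (q.symm j).1, hM0, ?_, hcM, hcM',
    ?_, fun i => ⟨hlo _ (q.symm i).2, hhi _ (q.symm i).2⟩, fun i => clusterWeight_self _ _ _ _,
    fun i j => clusterWeight_comm _ _ _ _ _,
    fun i j => clusterWeight_nonneg _ _ _ _ _, fun i j => clusterWeight_le_one _ _ _ _ _, ?_, ?_⟩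
  · exact hPB.trans (((le_max_right _ _).trans (le_max_left _ _)).trans (Nat.le_succ _))
  · intro i j hij
    refine P.disjoint (q.symm i).2 (q.symm j).2 fun h => hij ?_
    exact q.symm.injective (Subtype.ext h)
  · intro i j hij
    obtain ⟨h1, h2, h3⟩ := clusterWeight_pos hij
    dsimp only
    rw [h3]
    exact ⟨h2, mostlyDense_of_isUniform G (hsq.trans hε₁ε) hsq0.le (by positivity)
      (hhi' _ (q.symm i).2) (hhi' _ (q.symm j).2) h1⟩
  · intro K
    dsimp only
    have hrow : ∀ i : Fin M, ∑ j : Fin M,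
        clusterWeight G (ε₁ ^ 2) (ξ / 4) (q.symm i).1 (q.symm j).1 =
        ∑ D ∈ P.parts, clusterWeight G (ε₁ ^ 2) (ξ / 4) (q.symm i).1 D := fun i => hsum _
    simp only [hrow]
    rw [hcount (fun C => K - ξ * n ≤ c * ∑ D ∈ P.parts, clusterWeight G (ε₁ ^ 2) (ξ / 4) C D)]
    set Λ := Finset.univ.filter fun v : V => K ≤ G.degree v with hΛ
    set good := P.parts.filter fun C =>
      K - ξ * n ≤ c * ∑ D ∈ P.parts, clusterWeight G (ε₁ ^ 2) (ξ / 4) C D with hgood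
    set irr := P.parts.filter fun C => ε₁ * P.parts.card <
      ((P.parts.filter fun D => C ≠ D ∧ ¬ G.IsUniform (ε₁ ^ 2) C D).card : ℝ) with hirr
    have hirrc : (irr.card : ℝ) ≤ ε₁ * M := card_irregular_le G P hε₁0 hU
    -- A cluster that meets `Λ` in more than an `ε₁ ^ 2`-fraction, and is not irregular to many
    -- others, inherits the large degree of those vertices and is good.
    have hmain : ∀ C ∈ P.parts, ((Λ ∩ C).card : ℝ) ≤ (c + 1) *
        (((if C ∈ good then 1 else 0) + if C ∈ irr then 1 else 0) + ε₁ ^ 2) := by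
      intro C hC
      have hΛC : ((Λ ∩ C).card : ℝ) ≤ c + 1 :=
        le_trans (Nat.cast_le.2 (Finset.card_le_card Finset.inter_subset_right)) (hhi' C hC)
      have hc1 : (0 : ℝ) ≤ (c : ℝ) + 1 := by positivity
      by_cases h1 : C ∈ good
      · rw [if_pos h1]
        refine hΛC.trans (le_mul_of_one_le_right hc1 ?_)
        split_ifs <;> linarith
      by_cases h2 : C ∈ irr
      · rw [if_pos h2]
        refine hΛC.trans (le_mul_of_one_le_right hc1 ?_)
        split_ifs
        linarith
      rw [if_neg h1, if_neg h2, zero_add, zero_add]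
      by_contra hcon
      rw [not_le] at hcon
      refine h1 (Finset.mem_filter.2 ⟨hC, ?_⟩)
      have h3 : ((P.parts.filter fun D => C ≠ D ∧ ¬ G.IsUniform (ε₁ ^ 2) C D).card : ℝ) ≤
          ε₁ * P.parts.card := by
        by_contra h
        exact h2 (Finset.mem_filter.2 ⟨hC, not_le.1 h⟩)
      have h4 := le_sum_clusterWeight G P (s := c + 1) (K := K) (d := ξ / 4) hε₁0 (by positivity)
        hhi' hC h3 (S := Λ ∩ C) Finset.inter_subset_right
        (by
          have := mul_le_mul_of_nonneg_left (hhi' C hC) hsq0.le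
          linarith)
        (fun v hv => (Finset.mem_filter.1 (Finset.mem_inter.1 hv).1).2)
      have h5 : ∑ D ∈ P.parts, clusterWeight G (ε₁ ^ 2) (ξ / 4) C D ≤ M := by
        have := Finset.sum_le_card_nsmul P.parts (fun D => clusterWeight G (ε₁ ^ 2) (ξ / 4) C D) 1
          (fun D _ => clusterWeight_le_one _ _ _ _ _)
        rwa [nsmul_eq_mul, mul_one] at this
      rw [← hM] at h4
      have hcn : 16 * (c : ℝ) ≤ ξ * n := by
        have : 16 * (c : ℝ) ≤ ξ * M * c := mul_le_mul_of_nonneg_right hM16 (Nat.cast_nonneg _)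
        nlinarith
      have hM1 : (1 : ℝ) ≤ M := by exact_mod_cast hM0
      have e1 : ξ / 4 + ε₁ ^ 2 + ε₁ ≤ 3 * ξ / 8 := by linarith
      have e2 : ((c : ℝ) + 1) * ((ξ / 4 + ε₁ ^ 2 + ε₁) * M + 1) ≤
          3 * ξ / 8 * (M * c) + 3 * ξ / 8 * M + c + 1 := by
        have : ((c : ℝ) + 1) * ((ξ / 4 + ε₁ ^ 2 + ε₁) * M) ≤ ((c : ℝ) + 1) * (3 * ξ / 8 * M) :=
          mul_le_mul_of_nonneg_left (mul_le_mul_of_nonneg_right e1 hM0'.le) hc1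
        linarith
      have e3 : 3 * ξ / 8 * (M * c) ≤ 3 * ξ / 8 * n := mul_le_mul_of_nonneg_left hcMr (by positivity)
      have e4 : 3 * ξ / 8 * M ≤ M := mul_le_of_le_one_left hM0'.le (by linarith)
      linarith
    have hsum1 : (Λ.card : ℝ) = ∑ C ∈ P.parts, ((Λ ∩ C).card : ℝ) := by
      rw [← Nat.cast_sum, ← Finset.card_biUnion]
      · congr 2
        ext v
        rw [Finset.mem_biUnion]
        constructor
        · intro h
          obtain ⟨D, hD, hv⟩ := P.exists_mem (Finset.mem_univ v)
          exact ⟨D, hD, Finset.mem_inter.2 ⟨h, hv⟩⟩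
        · rintro ⟨D, -, hv⟩
          exact (Finset.mem_inter.1 hv).1
      · intro D hD D' hD' hne
        exact (P.disjoint hD hD' hne).mono Finset.inter_subset_right Finset.inter_subset_right
    have h6 := Finset.sum_le_sum hmain
    rw [← hsum1, ← Finset.mul_sum, Finset.sum_add_distrib, Finset.sum_add_distrib,
      Finset.sum_const, nsmul_eq_mul, ← hM] at h6
    have h7 : ∑ C ∈ P.parts, (if C ∈ good then (1 : ℝ) else 0) = good.card := by
      rw [← Finset.sum_filter, Finset.sum_const, nsmul_eq_mul, mul_one,
        Finset.filter_mem_eq_inter, Finset.inter_eq_right.2 (Finset.filter_subset _ _)]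
    have h8 : ∑ C ∈ P.parts, (if C ∈ irr then (1 : ℝ) else 0) = irr.card := by
      rw [← Finset.sum_filter, Finset.sum_const, nsmul_eq_mul, mul_one,
        Finset.filter_mem_eq_inter, Finset.inter_eq_right.2 (Finset.filter_subset _ _)]
    rw [h7, h8] at h6
    have h9 : (good.card : ℝ) ≤ M := Nat.cast_le.2 (Finset.card_le_card (Finset.filter_subset _ _))
    have hc1 : (0 : ℝ) ≤ (c : ℝ) + 1 := by positivity
    have e1 : (irr.card : ℝ) + M * ε₁ ^ 2 ≤ ξ / 8 * M := by
      have : (M : ℝ) * ε₁ ^ 2 ≤ M * (ξ / 16) :=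
        mul_le_mul_of_nonneg_left (hsq.trans hε₁ξ) hM0'.le
      have h : ε₁ * M ≤ ξ / 16 * M := mul_le_mul_of_nonneg_right hε₁ξ hM0'.le
      linarith
    have e2 := mul_le_mul_of_nonneg_left e1 hc1
    have e3 : ξ / 8 * (M * c) ≤ ξ / 8 * n := mul_le_mul_of_nonneg_left hcMr (by positivity)
    have e4 : ξ / 8 * M ≤ M := mul_le_of_le_one_left hM0'.le (by linarith)
    linarith

end

/-! ### Disjoint regions, hubs and reservoirs. -/

section
open scoped Classical

/-- Vertices that are atypical for a large part of a weighted family are few. -/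
theorem card_filter_mass_le {V ι : Type*} [Fintype ι] (s : Finset V) (p : ι → V → Prop)
    (f : ι → ℝ) (f0 : ∀ i, 0 ≤ f i) (f1 : ∑ i, f i = 1) {σ δ : ℝ}
    (h : ∀ i, 0 < f i → ((s.filter (p i)).card : ℝ) ≤ σ) :
    ((s.filter fun x => δ < ∑ i ∈ Finset.univ.filter (fun i => p i x), f i).card : ℝ) * δ ≤ σ := by
  set B := s.filter fun x => δ < ∑ i ∈ Finset.univ.filter (fun i => p i x), f i with hB
  have h1 : (B.card : ℝ) * δ ≤ ∑ x ∈ s, ∑ i ∈ Finset.univ.filter (fun i => p i x), f i := by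
    rw [← nsmul_eq_mul]
    refine (Finset.card_nsmul_le_sum B _ _ fun x hx => (Finset.mem_filter.1 hx).2.le).trans ?_
    refine Finset.sum_le_sum_of_subset_of_nonneg (Finset.filter_subset _ _) fun x _ _ => ?_
    exact Finset.sum_nonneg fun i _ => f0 i
  have h2 : ∑ x ∈ s, ∑ i ∈ Finset.univ.filter (fun i => p i x), f i =
      ∑ i, ((s.filter (p i)).card : ℝ) * f i := by
    simp only [Finset.sum_filter]
    rw [Finset.sum_comm]
    refine Finset.sum_congr rfl fun i _ => ?_
    rw [← Finset.sum_filter, Finset.sum_const, nsmul_eq_mul]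
  have h3 : ∑ i, ((s.filter (p i)).card : ℝ) * f i ≤ ∑ i, σ * f i := by
    refine Finset.sum_le_sum fun i _ => ?_
    rcases (f0 i).eq_or_lt with h0 | h0
    · rw [← h0, mul_zero, mul_zero]
    · exact mul_le_mul_of_nonneg_right (h i h0) h0.le
  rw [← Finset.mul_sum, f1, mul_one] at h3
  exact h1.trans (h2.le.trans h3)

/-- Greedy choice: each `N w` has room for `U` and for all the sets together. -/
theorem exists_disjoint_subsets {V κ : Type*} (F : Finset κ) (N : κ → Finset V) (z : κ → ℕ)
    (U : Finset V) (h : ∀ w ∈ F, U.card + ∑ u ∈ F, z u ≤ (N w).card) :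
    ∃ Z : κ → Finset V, (∀ w, w ∉ F → Z w = ∅) ∧ (∀ w ∈ F, Z w ⊆ N w \ U ∧ (Z w).card = z w) ∧
      ∀ w w', w ≠ w' → Disjoint (Z w) (Z w') := by
  induction F using Finset.induction_on with
  | empty => exact ⟨fun _ => ∅, by simp, by simp, by simp⟩
  | insert w F hw ih =>
    have hs : ∑ u ∈ insert w F, z u = z w + ∑ u ∈ F, z u := Finset.sum_insert hw
    rw [hs] at h
    obtain ⟨Z, h1, h2, h3⟩ := ih fun u hu => by
      have := h u (Finset.mem_insert_of_mem hu)
      omega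
    set T := F.biUnion Z with hT
    have hTc : T.card ≤ ∑ u ∈ F, z u :=
      Finset.card_biUnion_le.trans (Finset.sum_le_sum fun u hu => (h2 u hu).2.le)
    have hc : z w ≤ ((N w \ U) \ T).card := by
      have e1 := Finset.le_card_sdiff U (N w)
      have e2 := Finset.le_card_sdiff T (N w \ U)
      have e3 := h w (Finset.mem_insert_self _ _)
      omega
    obtain ⟨Q, hQ, hQc⟩ := Finset.exists_subset_card_eq hc
    have hQT : ∀ u, u ≠ w → Disjoint Q (Z u) := by
      intro u _
      by_cases hu : u ∈ F
      · refine (Finset.disjoint_of_subset_left hQ Finset.sdiff_disjoint).mono_right ?_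
        exact Finset.subset_biUnion_of_mem Z hu
      · rw [h1 u hu]
        exact Finset.disjoint_empty_right _
    refine ⟨Function.update Z w Q, ?_, ?_, ?_⟩
    · intro u hu
      rw [Finset.mem_insert, not_or] at hu
      rw [Function.update_of_ne hu.1, h1 u hu.2]
    · intro u hu
      by_cases huw : u = w
      · subst huw
        rw [Function.update_self]
        exact ⟨hQ.trans Finset.sdiff_subset, hQc⟩
      · rw [Function.update_of_ne huw]
        exact h2 u ((Finset.mem_insert.1 hu).resolve_left huw)
    · intro u u' huu
      by_cases huw : u = w
      · subst huw
        rw [Function.update_self, Function.update_of_ne huu.symm]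
        exact hQT u' huu.symm
      · rw [Function.update_of_ne huw]
        by_cases huw' : u' = w
        · subst huw'
          rw [Function.update_self]
          exact (hQT u huw).symm
        · rw [Function.update_of_ne huw']
          exact h3 u u' huu

/-- The indices of type `false` choose first, so they need room only for one another. This matches
the allocation, where the neighbourhood of `B` has to hold the roots from `B` alone, while that of
`A` may have to hold the roots from both. -/
theorem exists_disjoint_subsets_two {V κ : Type*} (F : Finset κ) (typ : κ → Bool)
    (N : κ → Finset V) (z : κ → ℕ)
    (h0 : ∀ w ∈ F, typ w = false → ∑ u ∈ F.filter (fun u => typ u = false), z u ≤ (N w).card)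
    (h1 : ∀ w ∈ F, typ w = true → ∑ u ∈ F, z u ≤ (N w).card) :
    ∃ Z : κ → Finset V, (∀ w, w ∉ F → Z w = ∅) ∧ (∀ w ∈ F, Z w ⊆ N w ∧ (Z w).card = z w) ∧
      ∀ w w', w ≠ w' → Disjoint (Z w) (Z w') := by
  obtain ⟨Y, a1, a2, a3⟩ := exists_disjoint_subsets (F.filter fun u => typ u = false) N z ∅
    fun w hw => by
      rw [Finset.card_empty, zero_add]
      exact h0 w (Finset.mem_filter.1 hw).1 (Finset.mem_filter.1 hw).2
  set U := (F.filter fun u => typ u = false).biUnion Y with hU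
  have hUc : U.card ≤ ∑ u ∈ F.filter (fun u => typ u = false), z u :=
    Finset.card_biUnion_le.trans (Finset.sum_le_sum fun u hu => (a2 u hu).2.le)
  obtain ⟨Z, b1, b2, b3⟩ := exists_disjoint_subsets (F.filter fun u => ¬ typ u = false) N z U
    fun w hw => by
      have h2 := h1 w (Finset.mem_filter.1 hw).1 (by simpa using (Finset.mem_filter.1 hw).2)
      have h3 := Finset.sum_filter_add_sum_filter_not F (fun u => typ u = false) z
      omega
  have hYU : ∀ w, Y w ⊆ U := fun w => by
    by_cases hw : w ∈ F.filter fun u => typ u = false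
    · exact Finset.subset_biUnion_of_mem Y hw
    · rw [a1 w hw]
      exact Finset.empty_subset _
  have hZU : ∀ w, Disjoint (Z w) U := fun w => by
    by_cases hw : w ∈ F.filter fun u => ¬ typ u = false
    · exact Finset.disjoint_of_subset_left (b2 w hw).1 Finset.sdiff_disjoint
    · rw [b1 w hw]
      exact Finset.disjoint_empty_left _
  refine ⟨fun w => if typ w = false then Y w else Z w, ?_, ?_, ?_⟩
  · intro w hw
    dsimp only
    split_ifs with h
    · exact a1 w fun h' => hw (Finset.mem_filter.1 h').1
    · exact b1 w fun h' => hw (Finset.mem_filter.1 h').1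
  · intro w hw
    dsimp only
    split_ifs with h
    · obtain ⟨e1, e2⟩ := a2 w (Finset.mem_filter.2 ⟨hw, h⟩)
      exact ⟨e1.trans Finset.sdiff_subset, e2⟩
    · obtain ⟨e1, e2⟩ := b2 w (Finset.mem_filter.2 ⟨hw, h⟩)
      exact ⟨e1.trans Finset.sdiff_subset, e2⟩
  · intro w w' hww
    dsimp only
    split_ifs
    · exact a3 w w' hww
    · exact ((hZU w').mono_right (hYU w)).symm
    · exact (hZU w).mono_right (hYU w')
    · exact b3 w w' hww

/-- In a mostly dense pair, a few vertices can be chosen with many common neighbours. -/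
theorem exists_common_nbrs {V : Type*} (G : SimpleGraph V) {σ d : ℝ} (hd : 0 ≤ d) (hd1 : d ≤ 1)
    (P Q bad : Finset V) (hPQ : MostlyDense G σ d P Q) (h : ℕ)
    (hP : (bad.card : ℝ) + σ + h ≤ P.card) (hQ : σ ≤ d ^ h * Q.card) :
    ∃ S ⊆ P \ bad, S.card = h ∧
      d ^ h * Q.card ≤ ((Q.filter fun y => ∀ x ∈ S, G.Adj x y).card : ℝ) := by
  induction h with
  | zero => exact ⟨∅, Finset.empty_subset _, rfl, by simp⟩
  | succ h ih =>
    have hle : d ^ (h + 1) * Q.card ≤ d ^ h * Q.card :=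
      mul_le_mul_of_nonneg_right (pow_le_pow_of_le_one hd hd1 (Nat.le_succ h)) (Nat.cast_nonneg _)
    push_cast at hP
    obtain ⟨S, hS, hSc, hSQ⟩ := ih (by linarith) (hQ.trans hle)
    set R := Q.filter fun y => ∀ x ∈ S, G.Adj x y with hR
    -- Any vertex outside `B` keeps at least a `d`-fraction of the current common neighbourhood `R`.
    set B := P.filter fun x => ((nbrIn G x R).card : ℝ) < d * R.card with hB
    have hBc : (B.card : ℝ) < σ := hPQ R (Finset.filter_subset _ _) ((hQ.trans hle).trans hSQ)
    have hlt : (bad ∪ (B ∪ S)).card < P.card := by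
      have h1 : (bad ∪ (B ∪ S)).card ≤ bad.card + (B.card + S.card) :=
        (Finset.card_union_le _ _).trans (Nat.add_le_add_left (Finset.card_union_le _ _) _)
      have h2 : ((bad ∪ (B ∪ S)).card : ℝ) ≤ bad.card + (B.card + S.card) := by exact_mod_cast h1
      rw [hSc] at h2
      have : ((bad ∪ (B ∪ S)).card : ℝ) < P.card := by linarith
      exact_mod_cast this
    obtain ⟨v, hvP, hv⟩ := Finset.exists_mem_notMem_of_card_lt_card hlt
    have hv1 : v ∉ bad := fun h => hv (Finset.mem_union_left _ h)
    have hv2 : v ∉ B := fun h => hv (Finset.mem_union_right _ (Finset.mem_union_left _ h))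
    have hv3 : v ∉ S := fun h => hv (Finset.mem_union_right _ (Finset.mem_union_right _ h))
    refine ⟨insert v S, Finset.insert_subset (Finset.mem_sdiff.2 ⟨hvP, hv1⟩) hS, ?_, ?_⟩
    · rw [Finset.card_insert_of_notMem hv3, hSc]
    · have h1 : d * R.card ≤ (nbrIn G v R).card := by
        by_contra hc
        exact hv2 (Finset.mem_filter.2 ⟨hvP, not_le.1 hc⟩)
      have h2 : nbrIn G v R ⊆ Q.filter fun y => ∀ x ∈ insert v S, G.Adj x y := by
        intro y hy
        obtain ⟨g1, g2⟩ := mem_nbrIn.1 hy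
        obtain ⟨g3, g4⟩ := Finset.mem_filter.1 g1
        refine Finset.mem_filter.2 ⟨g3, fun x hx => ?_⟩
        rcases Finset.mem_insert.1 hx with rfl | hx
        · exact g2
        · exact g4 x hx
      have h3 : ((nbrIn G v R).card : ℝ) ≤
          ((Q.filter fun y => ∀ x ∈ insert v S, G.Adj x y).card : ℝ) :=
        Nat.cast_le.2 (Finset.card_le_card h2)
      have h4 := mul_le_mul_of_nonneg_left hSQ hd
      calc d ^ (h + 1) * (Q.card : ℝ) = d * (d ^ h * Q.card) := by ring
        _ ≤ _ := h4.trans (h1.trans h3)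

/-- The choice of the places for the heavy seeds, and of the reservoirs for the light ones. -/
theorem exists_hubs {V : Type*} (G : SimpleGraph V) {σ d s : ℝ} (hσ : 0 < σ) (hd : 0 ≤ d)
    (hd1 : d ≤ 1) (X bad : Bool → Finset V) (hX : Disjoint (X true) (X false))
    (hdense : ∀ c, MostlyDense G σ d (X c) (X !c)) (H : Finset ℕ) (cls : ℕ → Bool) (n : ℕ)
    (hH : H.card ≤ n) (hbad : ∀ c, ((bad c).card : ℝ) + σ + n ≤ s)
    (hs : ∀ c, s ≤ d ^ n * (X c).card) :
    ∃ (hub : ℕ → V) (star : Bool → Finset V), Set.InjOn hub H ∧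
      (∀ w ∈ H, hub w ∈ X (cls w) \ bad (cls w)) ∧
      (∀ c, star c ⊆ X c) ∧ (∀ w ∈ H, ∀ c, hub w ∉ star c) ∧
      (∀ w ∈ H, ∀ w' ∈ H, cls w ≠ cls w' → G.Adj (hub w) (hub w')) ∧
      (∀ w ∈ H, ∀ x ∈ star (!cls w), G.Adj (hub w) x) ∧
      ∀ c, s - n ≤ (star c).card := by
  set K : Bool → Finset ℕ := fun c => H.filter (fun w => cls w = c) with hK
  have hKn : ∀ c, (K c).card ≤ n := fun c =>
    (Finset.card_le_card (Finset.filter_subset _ _)).trans hH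
  have hKn' : ∀ c, ((K c).card : ℝ) ≤ n := fun c => Nat.cast_le.2 (hKn c)
  have hpow : ∀ c c', s ≤ d ^ (K c').card * (X c).card := fun c c' =>
    (hs c).trans (mul_le_mul_of_nonneg_right (pow_le_pow_of_le_one hd hd1 (hKn c'))
      (Nat.cast_nonneg _))
  have hsX : ∀ c, s ≤ (X c).card := fun c => (hs c).trans
    (mul_le_of_le_one_left (Nat.cast_nonneg _) (pow_le_one₀ hd hd1))
  have hσs : σ ≤ s := by
    have h1 := hbad true
    have h2 : (0 : ℝ) ≤ (bad true).card := Nat.cast_nonneg _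
    have h3 : (0 : ℝ) ≤ n := Nat.cast_nonneg _
    linarith
  obtain ⟨S, hS, hSc, hSX⟩ := exists_common_nbrs G hd hd1 (X true) (X false) (bad true)
    (hdense true) (K true).card (by linarith [hbad true, hKn' true, hsX true])
    (hσs.trans (hpow false true))
  set Y := (X false).filter fun y => ∀ x ∈ S, G.Adj x y with hY
  have hYs : s ≤ Y.card := (hpow false true).trans hSX
  -- `T` is chosen inside the common neighbourhood `Y` of `S`, so the two sets of hubs are
  -- completely joined. What remains of the two common neighbourhoods serves as reservoirs.
  obtain ⟨T, hT, hTc, hTX⟩ := exists_common_nbrs G hd hd1 Y (X true) (bad false)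
    ((hdense false).mono (Finset.filter_subset _ _) subset_rfl) (K false).card
    (by linarith [hbad false, hKn' false]) (hσs.trans (hpow true false))
  set Y' := (X true).filter fun y => ∀ x ∈ T, G.Adj x y with hY'
  have hYs' : s ≤ Y'.card := (hpow true false).trans hTX
  have hST : ∀ x ∈ S, ∀ y ∈ T, G.Adj x y := fun x hx y hy =>
    (Finset.mem_filter.1 (Finset.mem_sdiff.1 (hT hy)).1).2 x hx
  have hS' : S ⊆ X true := hS.trans Finset.sdiff_subset
  have hT' : T ⊆ X false := (hT.trans Finset.sdiff_subset).trans (Finset.filter_subset _ _)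
  have eS := Finset.equivOfCardEq hSc.symm
  have eT := Finset.equivOfCardEq hTc.symm
  have hmem : ∀ w ∈ H, ∀ c, cls w = c → w ∈ K c := fun w hw c hc =>
    Finset.mem_filter.2 ⟨hw, hc⟩
  have hY0 : 0 < Y.card := by exact_mod_cast (hσ.trans_le hσs).trans_le hYs
  obtain ⟨y₀, -⟩ := Finset.card_pos.1 hY0
  obtain ⟨hub, hub1, hub2⟩ : ∃ hub : ℕ → V, (∀ (w) (h : w ∈ K true), hub w = eS ⟨w, h⟩) ∧
      ∀ (w) (h : w ∈ K false), hub w = eT ⟨w, h⟩ := by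
    refine ⟨fun w => if h : w ∈ K true then eS ⟨w, h⟩ else if h : w ∈ K false then
      eT ⟨w, h⟩ else y₀, fun w h => dif_pos h, fun w h => ?_⟩
    have h' : w ∉ K true := fun h' => by
      have h1 := (Finset.mem_filter.1 h).2
      rw [(Finset.mem_filter.1 h').2] at h1
      exact Bool.noConfusion h1
    dsimp only
    rw [dif_neg h', dif_pos h]
  have hubS : ∀ w ∈ H, cls w = true → hub w ∈ S := fun w hw hc => by
    rw [hub1 w (hmem w hw _ hc)]
    exact (eS _).2
  have hubT : ∀ w ∈ H, cls w = false → hub w ∈ T := fun w hw hc => by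
    rw [hub2 w (hmem w hw _ hc)]
    exact (eT _).2
  have hXd : ∀ x ∈ X true, x ∉ X false := fun x hx => Finset.disjoint_left.1 hX hx
  refine ⟨hub, fun c => if c then Y' \ S else Y \ T, ?_, ?_, ?_, ?_, ?_, ?_, ?_⟩
  · intro w hw w' hw' h
    cases hc : cls w <;> cases hc' : cls w'
    · rw [hub2 w (hmem w hw _ hc), hub2 w' (hmem w' hw' _ hc')] at h
      exact congrArg Subtype.val (eT.injective (Subtype.ext h))
    · exact absurd (h ▸ hT' (hubT w hw hc)) (hXd _ (hS' (hubS w' hw' hc')))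
    · exact absurd (h ▸ hT' (hubT w' hw' hc')) (hXd _ (hS' (hubS w hw hc)))
    · rw [hub1 w (hmem w hw _ hc), hub1 w' (hmem w' hw' _ hc')] at h
      exact congrArg Subtype.val (eS.injective (Subtype.ext h))
  · intro w hw
    cases hc : cls w
    · obtain ⟨h1, h2⟩ := Finset.mem_sdiff.1 (hT (hubT w hw hc))
      exact Finset.mem_sdiff.2 ⟨(Finset.mem_filter.1 h1).1, h2⟩
    · exact hS (hubS w hw hc)
  · rintro (_ | _)
    · exact Finset.sdiff_subset.trans (Finset.filter_subset _ _)
    · exact Finset.sdiff_subset.trans (Finset.filter_subset _ _)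
  · rintro w hw (_ | _) hx
    · obtain ⟨h1, h2⟩ := Finset.mem_sdiff.1 hx
      cases hc : cls w
      · exact h2 (hubT w hw hc)
      · exact hXd _ (hS' (hubS w hw hc)) (Finset.mem_filter.1 h1).1
    · obtain ⟨h1, h2⟩ := Finset.mem_sdiff.1 hx
      cases hc : cls w
      · exact hXd _ (Finset.mem_filter.1 h1).1 (hT' (hubT w hw hc))
      · exact h2 (hubS w hw hc)
  · intro w hw w' hw' h
    cases hc : cls w <;> cases hc' : cls w'
    · exact absurd (hc.trans hc'.symm) h
    · exact (hST _ (hubS w' hw' hc') _ (hubT w hw hc)).symm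
    · exact hST _ (hubS w hw hc) _ (hubT w' hw' hc')
    · exact absurd (hc.trans hc'.symm) h
  · intro w hw x hx
    cases hc : cls w <;> rw [hc] at hx
    · exact (Finset.mem_filter.1 (Finset.mem_sdiff.1 hx).1).2 _ (hubT w hw hc)
    · exact (Finset.mem_filter.1 (Finset.mem_sdiff.1 hx).1).2 _ (hubS w hw hc)
  · have key : ∀ (Q R : Finset V) (c : Bool), s ≤ Q.card → R.card = (K c).card →
        s - n ≤ ((Q \ R).card : ℝ) := by
      intro Q R c h1 h2
      have h3 : Q.card ≤ (Q \ R).card + R.card := by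
        have := Finset.le_card_sdiff R Q
        omega
      have h4 : (Q.card : ℝ) ≤ (Q \ R).card + R.card := by exact_mod_cast h3
      rw [h2] at h4
      linarith [hKn' c]
    rintro (_ | _)
    · exact key Y T false hYs hTc
    · exact key Y' S true hYs' hSc

end

/-! ### Spreading a distribution on clusters over regions. -/

section
open scoped Classical

/-- The distribution of components used in the packing: components at the heavy seed `w` are
rooted in the region `(i, some w)`, all others and all second sides are in regions `(i, none)`. -/
noncomputable def spread {M : ℕ} {H : Finset ℕ} (cls : ℕ → Bool)
    (base : Bool → Fin M → Fin M → ℝ) (good : H → Finset (Fin M)) (mass : H → ℝ) :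
    H ⊕ Bool → Fin M × Option H → Fin M × Option H → ℝ
  | Sum.inl w, p, q => if p.2 = some w ∧ q.2 = none then
      (if p.1 ∈ good w then base (cls w) p.1 q.1 / mass w else 0) else 0
  | Sum.inr c, p, q => if p.2 = none ∧ q.2 = none then base c p.1 q.1 else 0

/-- The class of the seeds in a given group. -/
def groupClass {H : Finset ℕ} (cls : ℕ → Bool) : H ⊕ Bool → Bool
  | Sum.inl w => cls w
  | Sum.inr c => c

namespace Spread

variable {M : ℕ} {H : Finset ℕ} {cls : ℕ → Bool} {base : Bool → Fin M → Fin M → ℝ}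
  {good : H → Finset (Fin M)} {mass : H → ℝ}

theorem row_inl_some (w w' : H) (i : Fin M) :
    ∑ q, spread cls base good mass (Sum.inl w) (i, some w') q =
      if w' = w ∧ i ∈ good w then (∑ j, base (cls w) i j) / mass w else 0 := by
  rw [Fintype.sum_prod_type]
  by_cases h : w' = w <;> by_cases h' : i ∈ good w <;>
    simp [spread, h, h', Finset.sum_div]

theorem row_inl_none (w : H) (i : Fin M) :
    ∑ q, spread cls base good mass (Sum.inl w) (i, none) q = 0 := by
  simp [spread]

theorem row_inr_some (c : Bool) (w : H) (i : Fin M) :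
    ∑ q, spread cls base good mass (Sum.inr c) (i, some w) q = 0 := by
  simp [spread]

theorem row_inr_none (c : Bool) (i : Fin M) :
    ∑ q, spread cls base good mass (Sum.inr c) (i, none) q = ∑ j, base c i j := by
  rw [Fintype.sum_prod_type]
  simp [spread]

theorem col_some (κ : H ⊕ Bool) (w : H) (j : Fin M) :
    ∑ p, spread cls base good mass κ p (j, some w) = 0 := by
  cases κ <;> simp [spread]

theorem col_inl_none (w : H) (j : Fin M) :
    ∑ p, spread cls base good mass (Sum.inl w) p (j, none) =
      (∑ i ∈ good w, base (cls w) i j) / mass w := by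
  rw [Fintype.sum_prod_type]
  simp [spread, Finset.sum_div]

theorem col_inr_none (c : Bool) (j : Fin M) :
    ∑ p, spread cls base good mass (Sum.inr c) p (j, none) = ∑ i, base c i j := by
  rw [Fintype.sum_prod_type]
  simp [spread]

theorem nonneg (hbase : ∀ c i j, 0 ≤ base c i j) (hmass : ∀ w, 0 < mass w) (κ : H ⊕ Bool)
    (p q : Fin M × Option H) : 0 ≤ spread cls base good mass κ p q := by
  cases κ with
  | inl w =>
    rw [spread]
    split_ifs
    · exact div_nonneg (hbase _ _ _) (hmass w).le
    · exact le_rfl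
    · exact le_rfl
  | inr c =>
    rw [spread]
    split_ifs
    · exact hbase _ _ _
    · exact le_rfl

theorem pos (hmass : ∀ w, 0 < mass w) {κ : H ⊕ Bool} {p q : Fin M × Option H}
    (h : 0 < spread cls base good mass κ p q) :
    0 < base (groupClass cls κ) p.1 q.1 ∧ q.2 = none ∧
      ((∃ w, κ = Sum.inl w ∧ p.2 = some w ∧ p.1 ∈ good w) ∨
        ∃ c, κ = Sum.inr c ∧ p.2 = none) := by
  cases κ with
  | inl w =>
    rw [spread] at h
    split_ifs at h with h1 h2
    · refine ⟨?_, h1.2, Or.inl ⟨w, rfl, h1.1, h2⟩⟩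
      by_contra hc
      exact absurd h (not_lt.2 (div_nonpos_of_nonpos_of_nonneg (not_lt.1 hc) (hmass w).le))
    · exact absurd h (lt_irrefl _)
    · exact absurd h (lt_irrefl _)
  | inr c =>
    rw [spread] at h
    split_ifs at h with h1
    · exact ⟨h, h1.2, Or.inr ⟨c, rfl, h1.1⟩⟩
    · exact absurd h (lt_irrefl _)

theorem sum_eq_one (hmass : ∀ w, 0 < mass w)
    (hm : ∀ w, ∑ i ∈ good w, ∑ j, base (cls w) i j = mass w)
    (h1 : ∀ c, ∑ i, ∑ j, base c i j = 1) (κ : H ⊕ Bool) :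
    ∑ p, ∑ q, spread cls base good mass κ p q = 1 := by
  rw [Fintype.sum_prod_type]
  cases κ with
  | inl w =>
    simp only [Fintype.sum_option, row_inl_none, row_inl_some, zero_add]
    have : ∀ i, ∑ w', (if w' = w ∧ i ∈ good w then (∑ j, base (cls w) i j) / mass w else 0) =
        if i ∈ good w then (∑ j, base (cls w) i j) / mass w else 0 := by
      intro i
      rw [Finset.sum_eq_single w] <;> simp +contextual
    simp only [this]
    rw [← Finset.sum_filter, Finset.filter_mem_eq_inter, Finset.univ_inter, ← Finset.sum_div, hm,
      div_self (hmass w).ne']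
  | inr c =>
    simp only [Fintype.sum_option, row_inr_none, row_inr_some, Finset.sum_const_zero, add_zero]
    exact h1 c

variable {l : ℝ}

theorem div_mass_le (hmass : ∀ w, 0 < mass w) (hl : ∀ w, 1 ≤ l * mass w) (w : H) {x y : ℝ}
    (hx : x ≤ y) (hy : 0 ≤ y) : x / mass w ≤ l * y := by
  rw [div_le_iff₀ (hmass w)]
  nlinarith [hl w]

/-- A group `Sum.inl w` meets only the private region of `w`. Restricting to the clusters good for
`w` and renormalising increases a row by a factor at most `l`. -/
theorem sum_row_some_le (hbase : ∀ c i j, 0 ≤ base c i j) (hmass : ∀ w, 0 < mass w)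
    (hl0 : 0 ≤ l) (hl : ∀ w, 1 ≤ l * mass w) (F : Finset H) (D : Finset Bool)
    (hF : ∀ w ∈ F, cls w ∈ D) (κ : H ⊕ Bool) (i : Fin M) :
    ∑ w ∈ F, ∑ q, spread cls base good mass κ (i, some w) q ≤
      if groupClass cls κ ∈ D then l * ∑ j, base (groupClass cls κ) i j else 0 := by
  have hrow : ∀ c, 0 ≤ ∑ j, base c i j := fun c => Finset.sum_nonneg fun j _ => hbase c i j
  have hnn : 0 ≤ if groupClass cls κ ∈ D then l * ∑ j, base (groupClass cls κ) i j else 0 := by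
    split_ifs
    · exact mul_nonneg hl0 (hrow _)
    · exact le_rfl
  cases κ with
  | inl w =>
    simp only [row_inl_some]
    by_cases hw : w ∈ F
    · have : groupClass cls (Sum.inl w : H ⊕ Bool) ∈ D := hF w hw
      rw [if_pos this, Finset.sum_eq_single w]
      · split_ifs
        · exact div_mass_le hmass hl w le_rfl (hrow _)
        · exact mul_nonneg hl0 (hrow _)
      · intro w' _ hne
        exact if_neg fun h => hne h.1
      · exact fun h => absurd hw h
    · rw [Finset.sum_eq_zero]
      · exact hnn
      · intro w' hw'
        rw [if_neg]
        rintro ⟨rfl, -⟩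
        exact hw hw'
  | inr c =>
    simp only [row_inr_some, Finset.sum_const_zero]
    exact hnn

theorem sum_row_le (hbase : ∀ c i j, 0 ≤ base c i j) (hmass : ∀ w, 0 < mass w)
    (hl1 : 1 ≤ l) (hl : ∀ w, 1 ≤ l * mass w) (κ : H ⊕ Bool) (i : Fin M) :
    ∑ r, ∑ q, spread cls base good mass κ (i, r) q ≤
      l * ∑ j, base (groupClass cls κ) i j := by
  have hrow : ∀ c, 0 ≤ ∑ j, base c i j := fun c => Finset.sum_nonneg fun j _ => hbase c i j
  rw [Fintype.sum_option]
  cases κ with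
  | inl w =>
    rw [row_inl_none, zero_add]
    have := sum_row_some_le (cls := cls) (good := good) hbase hmass (zero_le_one.trans hl1) hl Finset.univ
      Finset.univ (fun _ _ => Finset.mem_univ _) (Sum.inl w) i
    rwa [if_pos (Finset.mem_univ _)] at this
  | inr c =>
    simp only [row_inr_some, Finset.sum_const_zero, row_inr_none, add_zero]
    exact le_mul_of_one_le_left (hrow c) hl1

theorem sum_col_le (hbase : ∀ c i j, 0 ≤ base c i j) (hmass : ∀ w, 0 < mass w)
    (hl1 : 1 ≤ l) (hl : ∀ w, 1 ≤ l * mass w) (κ : H ⊕ Bool) (j : Fin M) :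
    ∑ r, ∑ p, spread cls base good mass κ p (j, r) ≤
      l * ∑ i, base (groupClass cls κ) i j := by
  have hcol : ∀ c, 0 ≤ ∑ i, base c i j := fun c => Finset.sum_nonneg fun i _ => hbase c i j
  rw [Fintype.sum_option]
  simp only [col_some, Finset.sum_const_zero, add_zero]
  cases κ with
  | inl w =>
    rw [col_inl_none]
    refine div_mass_le hmass hl w ?_ (hcol _)
    exact Finset.sum_le_sum_of_subset_of_nonneg (Finset.subset_univ _) fun i _ _ => hbase _ i j
  | inr c =>
    rw [col_inr_none]
    exact le_mul_of_one_le_left (hcol c) hl1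

theorem sum_mul_class {T : Finset ℕ} (f : ℕ → ℝ) (g : Bool → ℝ) (s : ℕ → Bool) :
    ∑ t ∈ T, f t * g (s t) = ∑ c, (∑ t ∈ T.filter (fun t => s t = c), f t) * g c := by
  rw [← Finset.sum_fiberwise_of_maps_to (t := Finset.univ) (g := s) (fun t _ => Finset.mem_univ _)]
  refine Finset.sum_congr rfl fun c _ => ?_
  rw [Finset.sum_mul]
  exact Finset.sum_congr rfl fun t ht => by rw [(Finset.mem_filter.1 ht).2]

variable (T : Finset ℕ) (ro ot : ℕ → ℝ) (gp : ℕ → H ⊕ Bool)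

/-- The number of vertices that the components of `T` occupy in the region `p`. -/
noncomputable def load (α : H ⊕ Bool → Fin M × Option H → Fin M × Option H → ℝ)
    (p : Fin M × Option H) : ℝ :=
  ∑ t ∈ T, (ro t * ∑ q, α (gp t) p q + ot t * ∑ q, α (gp t) q p)

/-- Once the regions within a cluster are added up, heavy seeds are no longer distinguished and only
the class of the seed matters; the renormalisation costs the factor `l`. -/
theorem sum_load_le (hbase : ∀ c i j, 0 ≤ base c i j) (hmass : ∀ w, 0 < mass w)
    (hl1 : 1 ≤ l) (hl : ∀ w, 1 ≤ l * mass w) (hro : ∀ t, 0 ≤ ro t) (hot : ∀ t, 0 ≤ ot t)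
    (i : Fin M) :
    ∑ r, load T ro ot gp (spread cls base good mass) (i, r) ≤
      l * ∑ c, ((∑ t ∈ T.filter (fun t => groupClass cls (gp t) = c), ro t) * ∑ j, base c i j +
        (∑ t ∈ T.filter (fun t => groupClass cls (gp t) = c), ot t) * ∑ j, base c j i) := by
  rw [Finset.sum_add_distrib, ← sum_mul_class ro (fun c => ∑ j, base c i j),
    ← sum_mul_class ot (fun c => ∑ j, base c j i), ← Finset.sum_add_distrib, Finset.mul_sum]
  simp only [load]
  rw [Finset.sum_comm]
  refine Finset.sum_le_sum fun t _ => ?_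
  rw [Finset.sum_add_distrib, ← Finset.mul_sum, ← Finset.mul_sum]
  have h1 := mul_le_mul_of_nonneg_left
    (sum_row_le (cls := cls) (good := good) hbase hmass hl1 hl (gp t) i) (hro t)
  have h2 := mul_le_mul_of_nonneg_left
    (sum_col_le (cls := cls) (good := good) hbase hmass hl1 hl (gp t) i) (hot t)
  linarith

/-- Private regions hold root sides only, so their load involves just the root totals of the classes
that occur in `F`. -/
theorem sum_load_some_le (hbase : ∀ c i j, 0 ≤ base c i j) (hmass : ∀ w, 0 < mass w)
    (hl0 : 0 ≤ l) (hl : ∀ w, 1 ≤ l * mass w) (hro : ∀ t, 0 ≤ ro t)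
    (F : Finset H) (D : Finset Bool) (hF : ∀ w ∈ F, cls w ∈ D) (i : Fin M) :
    ∑ w ∈ F, load T ro ot gp (spread cls base good mass) (i, some w) ≤
      l * ∑ c ∈ D, (∑ t ∈ T.filter (fun t => groupClass cls (gp t) = c), ro t) *
        ∑ j, base c i j := by
  have h0 : ∑ c ∈ D, (∑ t ∈ T.filter (fun t => groupClass cls (gp t) = c), ro t) *
        ∑ j, base c i j = ∑ c, (∑ t ∈ T.filter (fun t => groupClass cls (gp t) = c), ro t) *
        (if c ∈ D then ∑ j, base c i j else 0) := by
    simp only [mul_ite, mul_zero]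
    rw [← Finset.sum_filter, Finset.filter_mem_eq_inter, Finset.univ_inter]
  rw [h0, ← sum_mul_class ro (fun c => if c ∈ D then ∑ j, base c i j else 0), Finset.mul_sum]
  simp only [load, col_some, mul_zero, add_zero]
  rw [Finset.sum_comm]
  refine Finset.sum_le_sum fun t _ => ?_
  rw [← Finset.mul_sum]
  have h1 := mul_le_mul_of_nonneg_left
    (sum_row_some_le (cls := cls) (good := good) hbase hmass hl0 hl F D hF (gp t) i) (hro t)
  refine h1.trans (le_of_eq ?_)
  split_ifs <;> ring

theorem load_nonneg (hbase : ∀ c i j, 0 ≤ base c i j) (hmass : ∀ w, 0 < mass w)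
    (hro : ∀ t, 0 ≤ ro t) (hot : ∀ t, 0 ≤ ot t) (p : Fin M × Option H) :
    0 ≤ load T ro ot gp (spread cls base good mass) p :=
  Finset.sum_nonneg fun t _ => add_nonneg
    (mul_nonneg (hro t) (Finset.sum_nonneg fun _ _ => nonneg hbase hmass _ _ _))
    (mul_nonneg (hot t) (Finset.sum_nonneg fun _ _ => nonneg hbase hmass _ _ _))

end Spread
end

/-! ### From a fractional allocation to an embedding. -/

section
open scoped Classical

/-- The seeds `W` cut a tree with two-colouring `cls` into components of size at most `b`; at the
seeds outside `H` hang at most `h` vertices. -/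
structure IsTreeCut (k : ℕ) (par : ℕ → ℕ) (cls : ℕ → Bool) (W H : Finset ℕ) (b h : ℕ) : Prop where
  par_lt : ∀ v, 0 < v → v < k → par v < v
  cls_ne : ∀ v, 0 < v → v < k → cls v ≠ cls (par v)
  W_sub : W ⊆ Finset.range k
  H_sub : H ⊆ W
  zero_mem : 0 ∈ H
  cross : ∀ w ∈ W, 0 < w → par w ∉ W → cls w = cls (par (compTop par W (par w)))
  comp_le : ∀ t, ((Finset.range k).filter (fun v => v ∉ W ∧ compTop par W v = t)).card ≤ b
  light_le : ∀ w ∈ W, w ∉ H →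
    ((Finset.range k).filter (fun v => v ∉ W ∧ par (compTop par W v) = w)).card ≤ h
  par_heavy : ∀ w ∈ H, 0 < w → par w ∈ W

/-- The roots of the components. -/
noncomputable def treeTops (k : ℕ) (par : ℕ → ℕ) (W : Finset ℕ) : Finset ℕ :=
  (Finset.range k).filter (fun v => v ∉ W ∧ compTop par W v = v)

/-- The number of vertices of the component of `t` in the class of `t`. -/
noncomputable def rootCount (k : ℕ) (par : ℕ → ℕ) (cls : ℕ → Bool) (W : Finset ℕ) (t : ℕ) : ℕ :=
  ((Finset.range k).filter (fun v => (v ∉ W ∧ compTop par W v = t) ∧ cls v = cls t)).card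

/-- The number of vertices of the component of `t` outside the class of `t`. -/
noncomputable def otherCount (k : ℕ) (par : ℕ → ℕ) (cls : ℕ → Bool) (W : Finset ℕ) (t : ℕ) : ℕ :=
  ((Finset.range k).filter (fun v => (v ∉ W ∧ compTop par W v = t) ∧ cls v ≠ cls t)).card

/-- The index `c` is the class of the seed above the component, so the vertices counted belong to
the opposite class. -/
noncomputable def rootTotal (k : ℕ) (par : ℕ → ℕ) (cls : ℕ → Bool) (W : Finset ℕ) (c : Bool) : ℝ :=
  ∑ t ∈ (treeTops k par W).filter (fun t => cls (par t) = c), (rootCount k par cls W t : ℝ)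

noncomputable def otherTotal (k : ℕ) (par : ℕ → ℕ) (cls : ℕ → Bool) (W : Finset ℕ) (c : Bool) :
    ℝ :=
  ∑ t ∈ (treeTops k par W).filter (fun t => cls (par t) = c), (otherCount k par cls W t : ℝ)

/-- A tree embeds into a graph whose reduced graph admits a fractional allocation of the
components of the tree. -/
theorem exists_embedding_of_allocation {V : Type*} (G : SimpleGraph V) {k : ℕ} {par : ℕ → ℕ}
    {cls : ℕ → Bool} {W H : Finset ℕ} {b h : ℕ} (hT : IsTreeCut k par cls W H b h)
    {M : ℕ} (C : Fin M → Finset V) (hC : ∀ i j, i ≠ j → Disjoint (C i) (C j)) (c : ℕ)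
    (hCc : ∀ i, c ≤ (C i).card) (w : Fin M → Fin M → ℝ) (hsymm : ∀ i j, w i j = w j i)
    {ε σ d dd : ℝ} (hdense : ∀ i j, 0 < w i j → dd ≤ w i j ∧ MostlyDense G σ (w i j - ε) (C i) (C j))
    (ctr : Bool → Fin M) (hctr : ctr true ≠ ctr false) (hAB : 0 < w (ctr true) (ctr false))
    (base : Bool → Fin M → Fin M → ℝ) (base0 : ∀ x i j, 0 ≤ base x i j)
    (base_pos : ∀ x i j, 0 < base x i j → 0 < w (ctr x) i ∧ 0 < w i j)
    (base1 : ∀ x, ∑ i, ∑ j, base x i j = 1) {a n : ℕ} (hHn : H.card ≤ n)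
    {γ γ₂ γ₃ δ l μ g gR cst s : ℝ}
    (cap : ∀ i, (1 + γ₂) * ∑ x, (rootTotal k par cls W x * ∑ j, base x i j +
      otherTotal k par cls W x * ∑ j, base x j i) ≤ c)
    (cap_false : ∀ i, 0 < ∑ j, base false i j →
      (1 + γ₂) * (rootTotal k par cls W false * ∑ j, base false i j) ≤ c * w (ctr false) i)
    (cap_true : ∀ i, 0 < ∑ j, base true i j →
      (1 + γ₂) * (rootTotal k par cls W true * ∑ j, base true i j +
        rootTotal k par cls W false * ∑ j, base false i j) ≤ c * w (ctr true) i)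
    (mass_le : ∀ x i, ∑ j, base x i j ≤ μ)
    (hσ : 0 < σ) (hd : 0 < d) (hd1 : d ≤ 1) (hε : 0 ≤ ε) (hdd : d + ε ≤ dd) (hdd1 : dd ≤ 1)
    (hγ : 0 ≤ γ) (hγ₃ : 0 ≤ γ₃) (hγ₃' : γ₃ ≤ 1) (hδ : 0 < δ) (hδ1 : δ < 1)
    (hγδ : 1 ≤ (1 + γ) * (1 - δ)) (hl : 1 ≤ l * (1 - δ)) (hl1 : 1 ≤ l)
    (hγl : (1 + γ) * l ≤ (1 - γ₃) * (1 + γ₂)) (hgR : 0 ≤ gR)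
    (hmain : (n + 1) * (cst + g + 1) + gR + ε * c + 2 * a ≤ γ₃ * dd * c)
    (hcst : 2 * (M * (n + 1)) * ((n + 2) * (b + 1) ^ 2) * b ≤ cst)
    (hbad : σ / δ + σ + n ≤ s) (hs : s ≤ d ^ n * a)
    (hstar : W.card + σ + 2 * σ / δ < d * (s - n)) (hσc : σ ≤ c) (hac : a ≤ c)
    (hσg : 2 * σ ≤ g) (hσgR : 4 * σ ≤ d * gR) (hbg : b + 2 * σ ≤ d * g)
    (hex : 4 * h * μ ≤ δ * (d * gR)) :
    ∃ φ : ℕ → V, Set.InjOn φ (Finset.range k) ∧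
      ∀ v, 0 < v → v < k → G.Adj (φ (par v)) (φ v) := by
  have hdense' : ∀ i j, 0 < w i j → MostlyDense G σ d (C i) (C j) := fun i j hij =>
    (hdense i j hij).2.of_le le_rfl (by linarith [(hdense i j hij).1])
  have hwpos : ∀ x i, 0 < ∑ j, base x i j → 0 < w (ctr x) i := by
    intro x i h
    obtain ⟨j, -, hj⟩ := Finset.exists_lt_of_sum_lt (s := Finset.univ) (f := fun _ => (0 : ℝ))
      (g := fun j => base x i j) (by simpa using h)
    exact (base_pos x i j hj).1
  have hrow0 : ∀ x i, 0 ≤ ∑ j, base x i j := fun x i => Finset.sum_nonneg fun j _ => base0 x i j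
  -- the reservoirs in the two central clusters
  have hX : ∀ x, ∃ X ⊆ C (ctr x), X.card = a := fun x =>
    Finset.exists_subset_card_eq ((hac.trans (hCc _)))
  choose X hXC hXa using hX
  have hXd : Disjoint (X true) (X false) := (hC _ _ hctr).mono (hXC _) (hXC _)
  have hXdense : ∀ x, MostlyDense G σ d (X x) (X !x) := by
    rintro (_ | _)
    · exact (hdense' _ _ (by rw [hsymm]; exact hAB)).mono (hXC _) (hXC _)
    · exact (hdense' _ _ hAB).mono (hXC _) (hXC _)
  set p : Bool → Fin M → V → Prop := fun x i v =>
    ((nbrIn G v (C i)).card : ℝ) < (w (ctr x) i - ε) * (C i).card with hp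
  -- Vertices atypical to clusters of mass more than `δ`. A hub outside `bad` can still use mass at
  -- least `1 - δ`.
  set bad : Bool → Finset V := fun x => (X x).filter fun v =>
    δ < ∑ i ∈ Finset.univ.filter (fun i => p x i v), ∑ j, base x i j with hbaddef
  have hbadc : ∀ x, ((bad x).card : ℝ) ≤ σ / δ := by
    intro x
    rw [le_div_iff₀ hδ]
    refine card_filter_mass_le (X x) (p x) (fun i => ∑ j, base x i j) (hrow0 x) (base1 x) ?_
    intro i hi
    refine le_of_lt ?_
    exact ((hdense _ _ (hwpos x i hi)).2.mono (hXC x) subset_rfl) (C i) subset_rfl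
      (hσc.trans (Nat.cast_le.2 (hCc i)))
  obtain ⟨hub, star, hub_inj, hub_mem, star_sub, hub_star, hub_adj, hub_star_adj, star_card⟩ :=
    exists_hubs G hσ hd.le hd1 X bad hXd hXdense H cls n hHn (s := s)
      (fun x => by linarith [hbadc x]) (fun x => by rw [hXa]; exact hs)
  set good : H → Finset (Fin M) := fun v => Finset.univ.filter fun i => ¬ p (cls v) i (hub v)
    with hgood
  set mass : H → ℝ := fun v => ∑ i ∈ good v, ∑ j, base (cls v) i j with hmassdef
  have hmass1 : ∀ v, 1 - δ ≤ mass v := by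
    intro v
    have h1 := Finset.sum_filter_add_sum_filter_not Finset.univ (fun i => p (cls v) i (hub v))
      (fun i => ∑ j, base (cls v) i j)
    rw [base1] at h1
    obtain ⟨h2, h3⟩ := Finset.mem_sdiff.1 (hub_mem v v.2)
    have h4 : ∑ i ∈ Finset.univ.filter (fun i => p (cls v) i (hub v)), ∑ j, base (cls v) i j ≤ δ := by
      by_contra hc
      exact h3 (Finset.mem_filter.2 ⟨h2, not_le.1 hc⟩)
    have h5 : mass v = ∑ i ∈ Finset.univ.filter (fun i => ¬ p (cls v) i (hub v)),
      ∑ j, base (cls v) i j := rfl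
    linarith
  have hmass : ∀ v, 0 < mass v := fun v => lt_of_lt_of_le (by linarith) (hmass1 v)
  have hlm : ∀ v, 1 ≤ l * mass v := fun v =>
    hl.trans (mul_le_mul_of_nonneg_left (hmass1 v) (by linarith))
  set α := spread cls base good mass with hα
  set gp : ℕ → H ⊕ Bool := fun v => if hv : v ∈ H then Sum.inl ⟨v, hv⟩ else Sum.inr (cls v) with hgp
  have hgpH : ∀ (v : ℕ) (hv : v ∈ H), gp v = Sum.inl ⟨v, hv⟩ := fun v hv => dif_pos hv
  have hgpL : ∀ v : ℕ, v ∉ H → gp v = Sum.inr (cls v) := fun v hv => dif_neg hv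
  have hgpc : ∀ v, groupClass cls (gp v) = cls v := by
    intro v
    by_cases hv : v ∈ H
    · rw [hgpH v hv]
      rfl
    · rw [hgpL v hv]
      rfl
  set T := treeTops k par W with hTT
  set ro : ℕ → ℝ := fun t => rootCount k par cls W t with hro
  set ot : ℕ → ℝ := fun t => otherCount k par cls W t with hot
  set Ld : Fin M × Option H → ℝ := Spread.load T ro ot (fun t => gp (par t)) α with hLd
  have hLd0 : ∀ q, 0 ≤ Ld q := Spread.load_nonneg T ro ot (fun t => gp (par t)) base0 hmass
    (fun t => Nat.cast_nonneg _) (fun t => Nat.cast_nonneg _)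
  have hfilt : ∀ x, T.filter (fun t => groupClass cls (gp (par t)) = x) =
      T.filter (fun t => cls (par t) = x) := fun x => by simp only [hgpc]
  have hγ1 : 0 ≤ 1 + γ := by linarith
  have hRS0 : ∀ x, 0 ≤ rootTotal k par cls W x := fun x =>
    Finset.sum_nonneg fun t _ => Nat.cast_nonneg _
  -- The slack `γ₂` of the allocation absorbs the quota factor `1 + γ` and the renormalisation `l`,
  -- and still leaves a `γ₃`-fraction of the space.
  have hscale : ∀ {A B : ℝ}, 0 ≤ A → (1 + γ₂) * A ≤ B → (1 + γ) * (l * A) ≤ B - γ₃ * B := by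
    intro A B hA hAB
    have h1 := mul_le_mul_of_nonneg_right hγl hA
    have h2 := mul_le_mul_of_nonneg_left hAB (by linarith : 0 ≤ 1 - γ₃)
    linarith
  have hsumLd : ∀ i, (1 + γ) * ∑ r, Ld (i, r) ≤ c - γ₃ * c := by
    intro i
    have h1 := Spread.sum_load_le (cls := cls) (good := good) T ro ot (fun t => gp (par t)) base0 hmass hl1 hlm
      (fun t => Nat.cast_nonneg _) (fun t => Nat.cast_nonneg _) i
    simp only [hfilt] at h1
    refine (mul_le_mul_of_nonneg_left h1 hγ1).trans (hscale ?_ (cap i))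
    refine Finset.sum_nonneg fun x _ => add_nonneg (mul_nonneg (hRS0 x) (hrow0 x i)) (mul_nonneg
      (Finset.sum_nonneg fun t _ => Nat.cast_nonneg _) (Finset.sum_nonneg fun j _ => base0 x j i))
  have hsumF : ∀ (F : Finset H) (D : Finset Bool), (∀ v ∈ F, cls v ∈ D) → ∀ i,
      (1 + γ) * ∑ v ∈ F, Ld (i, some v) ≤ (1 + γ) * (l * ∑ x ∈ D, rootTotal k par cls W x *
        ∑ j, base x i j) := by
    intro F D hF i
    have h1 := Spread.sum_load_some_le (cls := cls) (good := good) T ro ot (fun t => gp (par t)) base0 hmass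
      (zero_le_one.trans hl1) hlm (fun t => Nat.cast_nonneg _) F D hF i
    simp only [hfilt] at h1
    exact mul_le_mul_of_nonneg_left h1 hγ1
  -- the regions of the heavy seeds
  set z : Fin M → H → ℕ := fun i v => ⌈(1 + γ) * Ld (i, some v) + cst + g⌉₊ with hz
  have hcst0 : 0 ≤ cst := le_trans (by positivity) hcst
  have hzle : ∀ (F : Finset H) (i), ((∑ v ∈ F, z i v : ℕ) : ℝ) ≤
      (1 + γ) * ∑ v ∈ F, Ld (i, some v) + n * (cst + g + 1) := by
    intro F i
    have h1 : ∀ v ∈ F, (z i v : ℝ) ≤ (1 + γ) * Ld (i, some v) + (cst + g + 1) := by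
      intro v _
      have := Nat.ceil_lt_add_one (a := (1 + γ) * Ld (i, some v) + cst + g)
        (by have := mul_nonneg hγ1 (hLd0 (i, some v)); linarith)
      linarith
    have h2 := Finset.sum_le_sum h1
    rw [Finset.sum_add_distrib, ← Finset.mul_sum, Finset.sum_const, nsmul_eq_mul] at h2
    have h3 : (F.card : ℝ) ≤ n := by
      refine Nat.cast_le.2 (le_trans ?_ hHn)
      exact (Finset.card_le_univ F).trans (by rw [Fintype.card_coe])
    have h4 := mul_le_mul_of_nonneg_right h3 (by linarith : 0 ≤ cst + g + 1)
    push_cast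
    linarith
  set C' : Fin M → Finset V := fun i => C i \ (X true ∪ X false) with hC'
  have hXX : (X true ∪ X false).card ≤ 2 * a := by
    have := Finset.card_union_le (X true) (X false)
    rw [hXa, hXa] at this
    omega
  have hXX' : ((X true ∪ X false).card : ℝ) ≤ 2 * a := by exact_mod_cast hXX
  set F : Fin M → Finset H := fun i => Finset.univ.filter fun v =>
    i ∈ good v ∧ 0 < ∑ j, base (cls v) i j with hF
  have hn0 : (0 : ℝ) ≤ n := Nat.cast_nonneg _
  have hc0 : (0 : ℝ) ≤ c := Nat.cast_nonneg _
  have hgapp : γ₃ * dd * c ≤ γ₃ * c := by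
    rw [mul_assoc]
    exact mul_le_mul_of_nonneg_left (mul_le_of_le_one_left hc0 hdd1) hγ₃
  have hN : ∀ i, ∀ v ∈ F i, ∀ B : ℝ, B ≤ c * w (ctr (cls v)) i - γ₃ * (c * w (ctr (cls v)) i) →
      B + n * (cst + g + 1) ≤ ((nbrIn G (hub v) (C' i)).card : ℝ) := by
    intro i v hv B hB
    obtain ⟨-, h1, h2⟩ := Finset.mem_filter.1 hv
    have h3 := not_lt.1 (Finset.mem_filter.1 h1).2
    have hw := hwpos _ _ h2
    have hwd := (hdense _ _ hw).1
    have h4 : (w (ctr (cls v)) i - ε) * c ≤ (w (ctr (cls v)) i - ε) * (C i).card :=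
      mul_le_mul_of_nonneg_left (Nat.cast_le.2 (hCc i)) (by linarith)
    have h5 : nbrIn G (hub v) (C i) ⊆ nbrIn G (hub v) (C' i) ∪ (X true ∪ X false) := by
      intro y hy
      by_cases hyX : y ∈ X true ∪ X false
      · exact Finset.mem_union_right _ hyX
      · exact Finset.mem_union_left _ (mem_nbrIn.2
          ⟨Finset.mem_sdiff.2 ⟨(mem_nbrIn.1 hy).1, hyX⟩, (mem_nbrIn.1 hy).2⟩)
    have h6 : ((nbrIn G (hub v) (C i)).card : ℝ) ≤
        (nbrIn G (hub v) (C' i)).card + (X true ∪ X false).card := by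
      exact_mod_cast (Finset.card_le_card h5).trans (Finset.card_union_le _ _)
    have h7 : γ₃ * dd * c ≤ γ₃ * (c * w (ctr (cls v)) i) := by
      have := mul_le_mul_of_nonneg_left (mul_le_mul_of_nonneg_left hwd hc0) hγ₃
      linarith
    linarith
  have hZ : ∀ i, ∃ Z : H → Finset V, (∀ v, v ∉ F i → Z v = ∅) ∧
      (∀ v ∈ F i, Z v ⊆ nbrIn G (hub v) (C' i) ∧ (Z v).card = z i v) ∧
      ∀ v v', v ≠ v' → Disjoint (Z v) (Z v') := by
    intro i
    -- Hubs of class `false` sit in the cluster for which `cap_false` counts only their own roots,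
    -- so they choose first; `cap_true` provides for both classes.
    refine exists_disjoint_subsets_two (F i) (fun v => cls v)
      (fun v => nbrIn G (hub v) (C' i)) (z i) ?_ ?_
    · intro v hv hcv
      have h1 := hzle ((F i).filter fun u => cls u = false) i
      have h2 := hsumF ((F i).filter fun u => cls u = false) {false}
        (fun u hu => Finset.mem_singleton.2 (Finset.mem_filter.1 hu).2) i
      rw [Finset.sum_singleton] at h2
      have hrow : 0 < ∑ j, base false i j := by
        have := (Finset.mem_filter.1 hv).2.2
        rwa [hcv] at this
      have h3 := hscale (mul_nonneg (hRS0 false) (hrow0 false i)) (cap_false i hrow)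
      have h4 := hN i v hv ((1 + γ) * ∑ u ∈ (F i).filter (fun u : H => cls u = false), Ld (i, some u)) (by rw [hcv]; exact h2.trans h3)
      exact_mod_cast h1.trans h4
    · intro v hv hcv
      have h1 := hzle (F i) i
      have h2 := hsumF (F i) Finset.univ (fun u _ => Finset.mem_univ _) i
      rw [Fintype.sum_bool] at h2
      have hrow : 0 < ∑ j, base true i j := by
        have := (Finset.mem_filter.1 hv).2.2
        rwa [hcv] at this
      have h3 := hscale (add_nonneg (mul_nonneg (hRS0 true) (hrow0 true i))
        (mul_nonneg (hRS0 false) (hrow0 false i))) (cap_true i hrow)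
      have h4 := hN i v hv ((1 + γ) * ∑ u ∈ F i, Ld (i, some u)) (by rw [hcv]; exact h2.trans h3)
      exact_mod_cast h1.trans h4
  choose Z hZ1 hZ2 hZ3 using hZ
  have hZC' : ∀ i v, Z i v ⊆ C' i := by
    intro i v
    by_cases hv : v ∈ F i
    · exact (hZ2 i v hv).1.trans nbrIn_subset
    · rw [hZ1 i v hv]
      exact Finset.empty_subset _
  -- What remains of the cluster takes all components of light seeds and the other sides of those of
  -- heavy seeds.
  set R : Fin M → Finset V := fun i => C' i \ (F i).biUnion (Z i) with hR
  have hRcard : ∀ i, (1 + γ) * Ld (i, none) + cst + g + gR ≤ (R i).card := by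
    intro i
    have h1 : (C i).card ≤ (R i).card + ∑ v ∈ F i, z i v + (X true ∪ X false).card := by
      have e1 := Finset.le_card_sdiff (X true ∪ X false) (C i)
      have e2 := Finset.le_card_sdiff ((F i).biUnion (Z i)) (C' i)
      have e3 : ((F i).biUnion (Z i)).card ≤ ∑ v ∈ F i, z i v :=
        Finset.card_biUnion_le.trans (Finset.sum_le_sum fun u hu => (hZ2 i u hu).2.le)
      have e4 : (C' i).card = (C i \ (X true ∪ X false)).card := rfl
      have e5 : (R i).card = (C' i \ (F i).biUnion (Z i)).card := rfl
      omega
    have h2 : ((C i).card : ℝ) ≤ (R i).card + (∑ v ∈ F i, z i v : ℕ) +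
        (X true ∪ X false).card := by exact_mod_cast h1
    have h3 := hzle (F i) i
    have h4 := hsumLd i
    rw [Fintype.sum_option] at h4
    have h5 : ∑ v ∈ F i, Ld (i, some v) ≤ ∑ v, Ld (i, some v) :=
      Finset.sum_le_sum_of_subset_of_nonneg (Finset.subset_univ _) fun v _ _ => hLd0 _
    have h6 := mul_le_mul_of_nonneg_left h5 hγ1
    have h7 : (c : ℝ) ≤ (C i).card := Nat.cast_le.2 (hCc i)
    have h8 : 0 ≤ ε * c := mul_nonneg hε hc0
    linarith
  set reg : Fin M × Option H → Finset V := fun q => q.2.elim (R q.1) (Z q.1) with hreg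
  have hregC' : ∀ q, reg q ⊆ C' q.1 := by
    rintro ⟨i, _ | v⟩
    · exact Finset.sdiff_subset
    · exact hZC' i v
  have hregC : ∀ q, reg q ⊆ C q.1 := fun q => (hregC' q).trans Finset.sdiff_subset
  have hregX : ∀ q x, Disjoint (X x) (reg q) := by
    intro q x
    refine Finset.disjoint_left.2 fun y hy hyq => (Finset.mem_sdiff.1 (hregC' q hyq)).2 ?_
    cases x
    · exact Finset.mem_union_right _ hy
    · exact Finset.mem_union_left _ hy
  have hgroup : ∀ v q q', 0 < α (gp v) q q' → 0 < base (cls v) q.1 q'.1 ∧ q'.2 = none ∧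
      ((∃ hv : v ∈ H, q.2 = some ⟨v, hv⟩ ∧ ⟨v, hv⟩ ∈ F q.1) ∨ (v ∉ H ∧ q.2 = none)) := by
    intro v q q' hq
    obtain ⟨h1, h2, h3⟩ := Spread.pos hmass hq
    rw [hgpc] at h1
    refine ⟨h1, h2, ?_⟩
    by_cases hv : v ∈ H
    · left
      rw [hgpH v hv] at h3
      rcases h3 with ⟨u, e1, e2, e3⟩ | ⟨x, e1, -⟩
      · cases e1
        refine ⟨hv, e2, Finset.mem_filter.2 ⟨Finset.mem_univ _, e3, ?_⟩⟩
        exact h1.trans_le (Finset.single_le_sum (f := fun j => base (cls v) q.1 j)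
          (fun j _ => base0 _ _ _) (Finset.mem_univ q'.1))
      · cases e1
    · right
      rw [hgpL v hv] at h3
      rcases h3 with ⟨u, e1, -⟩ | ⟨x, -, e2⟩
      · cases e1
      · exact ⟨hv, e2⟩
  have hιcard : (Fintype.card (Fin M × Option H) : ℝ) = M * (H.card + 1) := by
    rw [Fintype.card_prod, Fintype.card_option, Fintype.card_fin, Fintype.card_coe]
    push_cast
    rfl
  have hClcard : (Fintype.card (H ⊕ Bool) : ℝ) = H.card + 2 := by
    rw [Fintype.card_sum, Fintype.card_bool, Fintype.card_coe]
    push_cast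
    rfl
  have hconst : (2 : ℝ) * Fintype.card (Fin M × Option H) *
      (Fintype.card (H ⊕ Bool) * (b + 1) ^ 2) * b ≤ cst := by
    rw [hιcard, hClcard]
    refine le_trans ?_ hcst
    have : (H.card : ℝ) ≤ n := Nat.cast_le.2 hHn
    gcongr
  have hcapN : ∀ i, (1 + γ) * Ld (i, none) + (2 : ℝ) * Fintype.card (Fin M × Option H) *
      (Fintype.card (H ⊕ Bool) * (b + 1) ^ 2) * b + gR ≤ (reg (i, none)).card := fun i => by
    have : ((reg (i, none)).card : ℝ) = (R i).card := rfl
    linarith [hRcard i]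
  have hcap : ∀ v q q', 0 < α (gp v) q q' ∨ 0 < α (gp v) q' q →
      (1 + γ) * Ld q + (2 : ℝ) * Fintype.card (Fin M × Option H) *
      (Fintype.card (H ⊕ Bool) * (b + 1) ^ 2) * b + g ≤ (reg q).card := by
    rintro v ⟨i, r⟩ q' hq
    have hnone : r = none → (1 + γ) * Ld (i, r) + (2 : ℝ) * Fintype.card (Fin M × Option H) *
        (Fintype.card (H ⊕ Bool) * (b + 1) ^ 2) * b + g ≤ (reg (i, r)).card := by
      rintro rfl
      have : ((reg (i, none)).card : ℝ) = (R i).card := rfl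
      linarith [hRcard i]
    rcases hq with hq | hq
    · obtain ⟨-, -, ⟨hv, h1, h2⟩ | ⟨-, h1⟩⟩ := hgroup v _ _ hq
      · dsimp only at h1 h2
        subst h1
        have h3 : ((reg (i, some ⟨v, hv⟩)).card : ℝ) = z i ⟨v, hv⟩ := by
          exact_mod_cast (hZ2 i ⟨v, hv⟩ h2).2
        have h4 := Nat.le_ceil ((1 + γ) * Ld (i, some ⟨v, hv⟩) + cst + g)
        linarith
      · exact hnone h1
    · exact hnone (hgroup v _ _ hq).2.1
  have hstarX : ∀ x q, Disjoint (star x) (reg q) := fun x q =>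
    (hregX q x).mono_left (star_sub x)
  let S : TreePacking V (Fin M × Option H) (H ⊕ Bool) :=
    { G := G, k := k, par := par, cls := cls, W := W, H := H, hub := hub, star := star, reg := reg
      cl := gp, α := α, σ := σ, d := d, g := g, gR := gR, δ := δ, γ := γ, μ := μ, b := b, h := h
      par_lt := hT.par_lt
      cls_ne := hT.cls_ne
      W_sub := hT.W_sub
      H_sub := hT.H_sub
      zero_mem := hT.zero_mem
      cross := hT.cross
      comp_le := hT.comp_le
      light_le := hT.light_le
      par_heavy := hT.par_heavy
      star_reg := hstarX
      reg_reg := by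
        rintro ⟨i, r⟩ ⟨i', r'⟩ hne
        by_cases hi : i = i'
        · subst hi
          rcases r with _ | v <;> rcases r' with _ | v'
          · exact absurd rfl hne
          · refine Finset.disjoint_left.2 fun y hy hy' => (Finset.mem_sdiff.1 hy).2 ?_
            have hv : v' ∈ F i := by
              by_contra h
              have : y ∈ Z i v' := hy'
              rw [hZ1 i v' h] at this
              exact absurd this (Finset.notMem_empty _)
            exact Finset.mem_biUnion.2 ⟨v', hv, hy'⟩
          · refine Finset.disjoint_left.2 fun y hy' hy => (Finset.mem_sdiff.1 hy).2 ?_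
            have hv : v ∈ F i := by
              by_contra h
              have : y ∈ Z i v := hy'
              rw [hZ1 i v h] at this
              exact absurd this (Finset.notMem_empty _)
            exact Finset.mem_biUnion.2 ⟨v, hv, hy'⟩
          · exact hZ3 i v v' fun h => hne (by rw [h])
        · exact (hC i i' hi).mono (hregC (i, r)) (hregC (i', r'))
      hub_inj := hub_inj
      hub_star := hub_star
      hub_reg := fun v hv q hq => Finset.disjoint_left.1 (hregX q (cls v))
        (Finset.mem_sdiff.1 (hub_mem v hv)).1 hq
      hub_adj := hub_adj
      hub_star_adj := hub_star_adj
      star_dense := fun x => (hXdense x).mono (star_sub _) (star_sub _)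
      α_nonneg := Spread.nonneg base0 hmass
      α_sum := Spread.sum_eq_one hmass (fun _ => rfl) base1
      dense_reg := fun v _ q q' hq => by
        have h1 := (base_pos _ _ _ (hgroup v q q' hq).1).2
        exact ⟨(hdense' _ _ h1).mono (hregC _) (hregC _),
          (hdense' _ _ (by rw [hsymm]; exact h1)).mono (hregC _) (hregC _)⟩
      dense_star := fun v _ q q' hq => by
        have h1 := (base_pos _ _ _ (hgroup v q q' hq).1).1
        exact (hdense' _ _ (by rw [hsymm]; exact h1)).mono (hregC _)
          ((star_sub _).trans (hXC _))
      dense_light := fun v _ _ q q' hq => by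
        have h1 := (base_pos _ _ _ (hgroup v q q' hq).1).1
        exact (hdense' _ _ h1).mono ((star_sub _).trans (hXC _)) (hregC _)
      reg_heavy := fun v hv q q' hq y hy => by
        obtain ⟨-, -, ⟨hv', h1, h2⟩ | ⟨h1, -⟩⟩ := hgroup v q q' hq
        · obtain ⟨i, r⟩ := q
          dsimp only at h1 h2
          subst h1
          exact (mem_nbrIn.1 ((hZ2 i ⟨v, hv⟩ h2).1 hy)).2
        · exact absurd hv h1
      capacity := fun v _ q q' hq => hcap v q q' hq
      capacity_light := fun v _ hvH q q' hq => by
        obtain ⟨-, -, ⟨h1, -⟩ | ⟨-, h1⟩⟩ := hgroup v q q' hq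
        · exact absurd h1 hvH
        · obtain ⟨i, r⟩ := q
          dsimp only at h1
          subst h1
          exact hcapN i
      mass_le := fun v _ hvH q => by
        have h0 : 0 ≤ μ := (hrow0 true (ctr true)).trans (mass_le _ _)
        rw [hgpL v hvH]
        obtain ⟨i, _ | r⟩ := q
        · rw [Spread.row_inr_none]
          exact mass_le _ _
        · rw [Spread.row_inr_some]
          exact h0
      σ_pos := hσ
      d_pos := hd
      d_le := hd1
      σ_g := hσg
      σ_gR := hσgR
      b_g := hbg
      δ_pos := hδ
      γ_nonneg := hγ
      γ_δ := hγδ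
      exhaust := hex
      star_card := fun x => hstar.trans_le (mul_le_mul_of_nonneg_left (star_card x) hd.le) }
  exact S.exists_embedding

end

/-! ### Class sizes and the choice of constants. -/

section
open scoped Classical

/-- Roots below seeds of class `c`, and other sides below seeds of class `!c`, both lie in class
`!c`; the sets counted are disjoint because each determines its component. -/
theorem IsTreeCut.rootTotal_add_otherTotal_le {k : ℕ} {par : ℕ → ℕ} {cls : ℕ → Bool}
    {W H : Finset ℕ} {b h : ℕ} (hT : IsTreeCut k par cls W H b h) (c : Bool) :
    rootTotal k par cls W c + otherTotal k par cls W (!c) ≤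
      (((Finset.range k).filter fun v => cls v = !c).card : ℝ) := by
  have h0 : 0 ∈ W := hT.H_sub hT.zero_mem
  have hcls : ∀ t ∈ treeTops k par W, cls t = !cls (par t) := by
    intro t ht
    obtain ⟨h1, h2, -⟩ := Finset.mem_filter.1 ht
    have := hT.cls_ne t (Nat.pos_of_ne_zero fun h => h2 (h ▸ h0)) (Finset.mem_range.1 h1)
    revert this
    cases cls t <;> cases cls (par t) <;> simp
  set F : Bool → Finset ℕ := fun x => (treeTops k par W).filter fun t => cls (par t) = x with hF
  set P : ℕ → Finset ℕ := fun t =>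
    (Finset.range k).filter (fun v => (v ∉ W ∧ compTop par W v = t) ∧ cls v = cls t) with hP
  set Q : ℕ → Finset ℕ := fun t =>
    (Finset.range k).filter (fun v => (v ∉ W ∧ compTop par W v = t) ∧ cls v ≠ cls t) with hQ
  have e1 : ∑ t ∈ F c, (P t).card = ((F c).biUnion P).card := by
    refine (Finset.card_biUnion fun t _ t' _ hne => Finset.disjoint_left.2 fun v hv hv' => hne ?_).symm
    rw [← (Finset.mem_filter.1 hv).2.1.2, (Finset.mem_filter.1 hv').2.1.2]
  have e2 : ∑ t ∈ F (!c), (Q t).card = ((F (!c)).biUnion Q).card := by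
    refine (Finset.card_biUnion fun t _ t' _ hne => Finset.disjoint_left.2 fun v hv hv' => hne ?_).symm
    rw [← (Finset.mem_filter.1 hv).2.1.2, (Finset.mem_filter.1 hv').2.1.2]
  have e3 : Disjoint ((F c).biUnion P) ((F (!c)).biUnion Q) := by
    refine Finset.disjoint_left.2 fun v hv hv' => ?_
    obtain ⟨t, ht, hvt⟩ := Finset.mem_biUnion.1 hv
    obtain ⟨t', ht', hvt'⟩ := Finset.mem_biUnion.1 hv'
    have h1 : t = t' := by
      rw [← (Finset.mem_filter.1 hvt).2.1.2, (Finset.mem_filter.1 hvt').2.1.2]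
    have h2 := (Finset.mem_filter.1 ht).2
    have h3 := (Finset.mem_filter.1 ht').2
    rw [← h1, h2] at h3
    cases c <;> simp at h3
  have e4 : (F c).biUnion P ∪ (F (!c)).biUnion Q ⊆
      (Finset.range k).filter fun v => cls v = !c := by
    refine Finset.union_subset ?_ ?_
    · intro v hv
      obtain ⟨t, ht, hvt⟩ := Finset.mem_biUnion.1 hv
      obtain ⟨h1, h2, h3⟩ := Finset.mem_filter.1 hvt
      obtain ⟨h4, h5⟩ := Finset.mem_filter.1 ht
      exact Finset.mem_filter.2 ⟨h1, by rw [h3, hcls t h4, h5]⟩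
    · intro v hv
      obtain ⟨t, ht, hvt⟩ := Finset.mem_biUnion.1 hv
      obtain ⟨h1, h2, h3⟩ := Finset.mem_filter.1 hvt
      obtain ⟨h4, h5⟩ := Finset.mem_filter.1 ht
      refine Finset.mem_filter.2 ⟨h1, ?_⟩
      have h6 := hcls t h4
      rw [h5, Bool.not_not] at h6
      rw [h6] at h3
      revert h3
      cases cls v <;> cases c <;> simp
  have e5 := Finset.card_le_card e4
  rw [Finset.card_union_of_disjoint e3, ← e1, ← e2] at e5
  have e6 : rootTotal k par cls W c = ((∑ t ∈ F c, (P t).card : ℕ) : ℝ) := by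
    push_cast
    rfl
  have e7 : otherTotal k par cls W (!c) = ((∑ t ∈ F (!c), (Q t).card : ℕ) : ℝ) := by
    push_cast
    rfl
  rw [e6, e7]
  exact_mod_cast e5

-- Fixes the hierarchy of constants: the regularity parameter before the bound `M₀` on the number of
-- clusters, the component size `b` after it. The cut is produced before the allocation because the
-- latter depends on the totals of the cut.
set_option maxHeartbeats 2000000 in
theorem exists_embedding_of_reduced (γ₂ ρ dd : ℝ) (hγ₂ : 0 < γ₂) (hγ₂1 : γ₂ ≤ 1) (hρ : 0 < ρ)
    (hdd : 0 < dd) (hdd1 : dd ≤ 1) :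
    ∃ ε : ℝ, 0 < ε ∧ ∀ M₀ : ℕ, ∃ N₀ : ℕ, ∀ (V : Type) [Fintype V] (G : SimpleGraph V) (M c : ℕ)
      (C : Fin M → Finset V) (w : Fin M → Fin M → ℝ), N₀ ≤ Fintype.card V → M ≤ M₀ →
      Fintype.card V ≤ M * (c + 1) → (∀ i j, i ≠ j → Disjoint (C i) (C j)) →
      (∀ i, c ≤ (C i).card) → (∀ i, w i i = 0) → (∀ i j, w i j = w j i) →
      (∀ i j, 0 < w i j → dd ≤ w i j ∧
        MostlyDense G (ε * (c + 1)) (w i j - ε) (C i) (C j)) →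
      0 < c ∧ ∀ (k : ℕ) (par : ℕ → ℕ) (cls : ℕ → Bool), 0 < k → k ≤ Fintype.card V →
        (∀ v, 0 < v → v < k → par v < v) → (∀ v, 0 < v → v < k → cls v ≠ cls (par v)) →
        ∃ (W H : Finset ℕ) (b h : ℕ), IsTreeCut k par cls W H b h ∧
          ∀ (ctr : Bool → Fin M) (base : Bool → Fin M → Fin M → ℝ),
            0 < w (ctr true) (ctr false) → (∀ x i j, 0 ≤ base x i j) →
            (∀ x i j, 0 < base x i j → 0 < w (ctr x) i ∧ 0 < w i j) →
            (∀ x, ∑ i, ∑ j, base x i j = 1) →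
            (∀ i, (1 + γ₂) * ∑ x, (rootTotal k par cls W x * ∑ j, base x i j +
              otherTotal k par cls W x * ∑ j, base x j i) ≤ c) →
            (∀ i, (1 + γ₂) * (rootTotal k par cls W false * ∑ j, base false i j) ≤
              c * w (ctr false) i) →
            (∀ i, 0 < ∑ j, base true i j →
              (1 + γ₂) * (rootTotal k par cls W true * ∑ j, base true i j +
                rootTotal k par cls W false * ∑ j, base false i j) ≤ c * w (ctr true) i) →
            (∀ x i, ρ * Fintype.card V * ∑ j, base x i j ≤ c) →
            ∃ φ : ℕ → V, Set.InjOn φ (Finset.range k) ∧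
              ∀ v, 0 < v → v < k → G.Adj (φ (par v)) (φ v) := by
  obtain ⟨d, hd⟩ : ∃ d, d = dd / 2 := ⟨_, rfl⟩
  have hd0 : 0 < d := by rw [hd]; positivity
  have hd1 : d ≤ 1 := by rw [hd]; linarith
  obtain ⟨δ, hδ⟩ : ∃ δ, δ = γ₂ / 8 := ⟨_, rfl⟩
  have hδ0 : 0 < δ := by rw [hδ]; positivity
  have hδ1 : δ ≤ 1 / 8 := by rw [hδ]; linarith
  obtain ⟨K, hK⟩ : ∃ K, K = γ₂ / 4 * dd := ⟨_, rfl⟩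
  have hK0 : 0 < K := by rw [hK]; positivity
  have hK1 : K ≤ 1 := by rw [hK]; nlinarith
  -- With `h` at most `ε' * N`, this value makes the exhaustion condition hold with equality for the
  -- largest `h`, with mass bound `c / (ρ * N)` and reserve `K * c / 8`.
  obtain ⟨ε', hε'⟩ : ∃ ε', ε' = ρ * δ * d * K / 32 := ⟨_, rfl⟩
  have hε'0 : 0 < ε' := by rw [hε']; positivity
  -- A bound for the number of heavy seeds: `(h + 1) * H.card ≤ k + (h + 1)` and `h + 1 > ε' * N ≥
  -- ε' * k`.
  obtain ⟨n, hn⟩ : ∃ n : ℕ, n = ⌈1 / ε'⌉₊ + 1 := ⟨_, rfl⟩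
  obtain ⟨q, hq⟩ : ∃ q, q = d ^ n := ⟨_, rfl⟩
  have hq0 : 0 < q := by rw [hq]; positivity
  have hq1 : q ≤ 1 := by rw [hq]; exact pow_le_one₀ hd0.le hd1
  have hn1 : (2 : ℝ) ≤ n + 1 := by
    have : (1 : ℝ) ≤ n := by rw [hn]; push_cast; linarith [Nat.cast_nonneg (α := ℝ) ⌈1 / ε'⌉₊]
    linarith
  have hn0 : (0 : ℝ) < n + 1 := by linarith
  have hdq : 0 < d * q := mul_pos hd0 hq0
  have hdq1 : d * q ≤ 1 := mul_le_one₀ hd1 hq0.le hq1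
  have hdqδ : d * q * δ ≤ 1 := mul_le_one₀ hdq1 hδ0.le (by linarith)
  obtain ⟨ε, hε⟩ : ∃ ε, ε = d * q * δ * K / (512 * (n + 1)) := ⟨_, rfl⟩
  have hε0 : 0 < ε := by rw [hε]; positivity
  have hεn : ε * (512 * (n + 1)) = d * q * δ * K := by
    rw [hε]
    exact div_mul_cancel₀ _ (by positivity)
  have hε512 : ε * 1024 ≤ d * q * δ * K := by
    rw [← hεn]
    exact mul_le_mul_of_nonneg_left (by linarith) hε0.le
  have hεd : ε * 1024 ≤ d := by
    refine hε512.trans ?_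
    calc d * q * δ * K = d * (q * δ * K) := by ring
      _ ≤ d * 1 := mul_le_mul_of_nonneg_left
        (mul_le_one₀ (mul_le_one₀ hq1 hδ0.le (by linarith)) hK0.le hK1) hd0.le
      _ = d := mul_one d
  have hεK : ε * 1024 ≤ K := hε512.trans (mul_le_of_le_one_left hK0.le hdqδ)
  refine ⟨ε, hε0, fun M₀ => ?_⟩
  -- Components this large keep the number of seeds, roughly `4 * k / b`, negligible against a
  -- common neighbourhood of `n` hubs.
  obtain ⟨b, hb⟩ : ∃ b : ℕ, b = ⌈4096 * M₀ / (d * q * K)⌉₊ := ⟨_, rfl⟩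
  have hbM : 4096 * (M₀ : ℝ) ≤ b * (d * q * K) := by
    rw [← div_le_iff₀ (by positivity), hb]
    exact Nat.le_ceil _
  obtain ⟨cst, hcst⟩ : ∃ cst : ℝ, cst = 2 * (M₀ * (n + 1)) * ((n + 2) * (b + 1) ^ 2) * b := ⟨_, rfl⟩
  have hcst0 : 0 ≤ cst := by rw [hcst]; positivity
  obtain ⟨c₀, hc₀⟩ : ∃ c₀ : ℕ, ∀ c : ℕ, c₀ ≤ c → (1 : ℝ) ≤ c ∧ 32 ≤ K * c ∧
      b * (16 * (n + 1)) ≤ d * (K * c) ∧ n * 512 ≤ q * (K * c) ∧ 2048 ≤ d * q * (K * c) ∧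
      (n + 1) * (cst + 1) * 8 ≤ K * c := by
    have key : ∀ A B : ℝ, 0 < B → ∀ᶠ c : ℕ in Filter.atTop, A ≤ B * c := fun A B hB =>
      (tendsto_natCast_atTop_atTop.const_mul_atTop hB).eventually_ge_atTop A
    have := (key 1 1 one_pos).and ((key 32 K hK0).and ((key (b * (16 * (n + 1))) (d * K)
      (by positivity)).and ((key (n * 512) (q * K) (by positivity)).and
      ((key 2048 (d * q * K) (by positivity)).and (key ((n + 1) * (cst + 1) * 8) K hK0)))))
    obtain ⟨c₀, h⟩ := Filter.eventually_atTop.1 this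
    refine ⟨c₀, fun c hc => ?_⟩
    obtain ⟨h1, h2, h3, h4, h5, h6⟩ := h c hc
    refine ⟨by linarith, h2, by linarith, by linarith, by linarith, h6⟩
  refine ⟨max (M₀ * (c₀ + 1)) ⌈(b + 1) / ε'⌉₊ + 1, fun V _ G M c C w hN hM hMc hC hCc hw0 hsymm
    hdense => ?_⟩
  set N := Fintype.card V with hNdef
  have hcc : c₀ ≤ c := by
    by_contra h
    have h1 : M * (c + 1) ≤ M₀ * (c₀ + 1) := Nat.mul_le_mul hM (by omega)
    have h2 := le_max_left (M₀ * (c₀ + 1)) ⌈(b + 1) / ε'⌉₊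
    omega
  obtain ⟨hc1, hT1, hT2, hT3, hT4, hT5⟩ := hc₀ c hcc
  have hcpos : 0 < c := by exact_mod_cast (zero_lt_one.trans_le hc1)
  refine ⟨hcpos, fun k par cls hk hkN hpar hcls => ?_⟩
  obtain ⟨h, hh⟩ : ∃ h : ℕ, h = ⌊ε' * N⌋₊ := ⟨_, rfl⟩
  have hN0 : (0 : ℝ) < N := Nat.cast_pos.2 (hk.trans_le hkN)
  have hhle : (h : ℝ) ≤ ε' * N := by
    rw [hh]
    exact Nat.floor_le (by positivity)
  have hhlt : ε' * N < h + 1 := by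
    rw [hh]
    exact Nat.lt_floor_add_one _
  have hbh : b ≤ h := by
    have h1 : ((b : ℝ) + 1) / ε' ≤ N := by
      refine (Nat.le_ceil _).trans (Nat.cast_le.2 ?_)
      exact (le_max_right _ _).trans ((Nat.le_succ _).trans hN)
    rw [div_le_iff₀ hε'0] at h1
    have : (b : ℝ) + 1 < h + 1 := by linarith
    exact_mod_cast (by linarith : (b : ℝ) ≤ h)
  obtain ⟨W, H, hW1, hW2, hW3, hW4, hW5, hW6, hW7, hW8, hW9⟩ :=
    exists_tree_cut k hk par cls hpar hcls b h hbh
  have hcut : IsTreeCut k par cls W H b h := ⟨hpar, hcls, hW1, hW2, hW3, hW6, hW7, hW8, hW9⟩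
  refine ⟨W, H, b, h, hcut, fun ctr base hAB base0 base_pos base1 cap cap_false cap_true hmass => ?_⟩
  have hkN' : (k : ℝ) ≤ N := Nat.cast_le.2 hkN
  have hHn : H.card ≤ n := by
    have h1 : ((h : ℝ) + 1) * H.card ≤ k + (h + 1) := by exact_mod_cast hW5
    have h2 : (H.card : ℝ) ≤ 1 / ε' + 1 := by
      by_contra hcon
      rw [not_le] at hcon
      have h3 : ((h : ℝ) + 1) * (1 / ε' + 1) < ((h : ℝ) + 1) * H.card :=
        mul_lt_mul_of_pos_left hcon (by positivity)
      have h4 : ε' * N * (1 / ε') ≤ ((h : ℝ) + 1) * (1 / ε') :=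
        mul_le_mul_of_nonneg_right hhlt.le (by positivity)
      have h5 : ε' * N * (1 / ε') = N := by field_simp
      linarith
    have h3 : (H.card : ℝ) ≤ n := by
      rw [hn]
      push_cast
      linarith [Nat.le_ceil (1 / ε')]
    exact_mod_cast h3
  -- `Y` is the slack `γ₃ * dd * c`. The reserves `gR`, `(n + 1) * g`, the two reservoirs, and the
  -- rounding terms each take at most an eighth of it.
  set Y : ℝ := K * c with hY
  have hY0 : 0 < Y := by rw [hY]; positivity
  set σ : ℝ := ε * (c + 1) with hσ
  have hσ0 : 0 < σ := by rw [hσ]; positivity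
  have hσ2 : σ ≤ 2 * (ε * c) := by
    rw [hσ]
    nlinarith
  have hσn : σ * (256 * (n + 1)) ≤ d * q * δ * Y := by
    calc σ * (256 * (n + 1)) ≤ 2 * (ε * c) * (256 * (n + 1)) :=
          mul_le_mul_of_nonneg_right hσ2 (by positivity)
      _ = ε * (512 * (n + 1)) * c := by ring
      _ = d * q * δ * Y := by rw [hεn, hY]; ring
  have hσ512 : σ * 512 ≤ d * q * δ * Y := by
    refine le_trans ?_ hσn
    exact mul_le_mul_of_nonneg_left (by linarith) hσ0.le
  have hle1 : d * q * δ * Y ≤ d * Y := by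
    have : d * q * δ ≤ d := by
      rw [mul_assoc]
      exact mul_le_of_le_one_right hd0.le (mul_le_one₀ hq1 hδ0.le (by linarith))
    exact mul_le_mul_of_nonneg_right this hY0.le
  have hle2 : d * Y ≤ Y := mul_le_of_le_one_left hY0.le hd1
  have hσδ : σ / δ * 512 ≤ d * q * Y := by
    rw [div_mul_eq_mul_div, div_le_iff₀ hδ0]
    linarith
  have hσδ' : σ ≤ σ / δ := by
    rw [le_div_iff₀ hδ0]
    exact mul_le_of_le_one_right hσ0.le (by linarith)
  obtain ⟨a, ha⟩ : ∃ a : ℕ, a = ⌊Y / 16⌋₊ := ⟨_, rfl⟩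
  have ha1 : (a : ℝ) ≤ Y / 16 := by
    rw [ha]
    exact Nat.floor_le (by positivity)
  have ha2 : Y / 32 ≤ a := by
    have := Nat.lt_floor_add_one (Y / 16)
    rw [← ha] at this
    linarith
  have hYc : Y ≤ c := mul_le_of_le_one_left (Nat.cast_nonneg _) hK1
  have hqa : q * Y / 32 ≤ q * a := by
    have := mul_le_mul_of_nonneg_left ha2 hq0.le
    linarith
  have hqY : d * q * Y ≤ q * Y := by
    rw [mul_assoc]
    exact mul_le_of_le_one_left (by positivity) hd1
  have hWc : (W.card : ℝ) * 512 ≤ d * q * Y + 2048 := by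
    have h1 : ((b : ℝ) + 1) * W.card ≤ 4 * k + 4 * (b + 1) := by exact_mod_cast hW4
    have h2 : (N : ℝ) ≤ M₀ * (2 * c) := by
      have e1 : (N : ℝ) ≤ M * (c + 1) := by exact_mod_cast hMc
      have e2 : (M : ℝ) * (c + 1) ≤ M₀ * (2 * c) := by
        have : (M : ℝ) ≤ M₀ := Nat.cast_le.2 hM
        exact mul_le_mul this (by linarith) (by positivity) (by positivity)
      linarith
    have h3 : 4096 * (M₀ : ℝ) * c ≤ b * (d * q * Y) := by
      have := mul_le_mul_of_nonneg_right hbM (Nat.cast_nonneg (α := ℝ) c)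
      calc 4096 * (M₀ : ℝ) * c ≤ b * (d * q * K) * c := this
        _ = b * (d * q * Y) := by rw [hY]; ring
    have h4 : 0 ≤ d * q * Y := by positivity
    have h5 : ((b : ℝ) + 1) * (W.card * 512) ≤ (b + 1) * (d * q * Y + 2048) := by linarith
    exact le_of_mul_le_mul_left h5 (by positivity)
  have hne : ctr true ≠ ctr false := by
    intro h
    rw [h, hw0] at hAB
    exact lt_irrefl _ hAB
  have h1δ : 0 < 1 - δ := by linarith
  have hg : (n + 1) * (Y / (8 * (n + 1))) = Y / 8 := by field_simp
  have hNμ : ∀ x i, ∑ j, base x i j ≤ c / (ρ * N) := fun x i => by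
    rw [le_div_iff₀ (by positivity), mul_comm]
    exact hmass x i
  refine exists_embedding_of_allocation G hcut C hC c hCc w hsymm (ε := ε) (σ := σ) (d := d)
    (dd := dd) hdense ctr hne hAB base base0 base_pos base1 (a := a) hHn (γ := 1 / (1 - δ) - 1)
    (γ₂ := γ₂) (γ₃ := γ₂ / 4) (δ := δ) (l := 1 / (1 - δ)) (μ := c / (ρ * N))
    (g := Y / (8 * (n + 1))) (gR := Y / 8) (cst := cst) (s := q * a) cap (fun i _ => cap_false i)
    cap_true hNμ hσ0 hd0 hd1 hε0.le ?_ hdd1 ?_ (by positivity) (by linarith) hδ0 (by linarith)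
    ?_ ?_ ?_ ?_ (by positivity) ?_ ?_ ?_ ?_ ?_ ?_ ?_ ?_ ?_ ?_ ?_
  · have : d + d = dd := by rw [hd]; ring
    linarith
  · rw [sub_nonneg, le_div_iff₀ h1δ]
    linarith
  · rw [add_sub_cancel, div_mul_cancel₀ _ h1δ.ne']
  · rw [div_mul_cancel₀ _ h1δ.ne']
  · rw [le_div_iff₀ h1δ]
    linarith
  · rw [add_sub_cancel, div_mul_div_comm, one_mul, div_le_iff₀ (by positivity)]
    have e1 : 1 - γ₂ / 4 ≤ (1 - δ) * (1 - δ) := by rw [hδ]; nlinarith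
    have e2 : 1 + γ₂ / 2 ≤ (1 - γ₂ / 4) * (1 + γ₂) := by nlinarith
    have e3 : 1 ≤ (1 + γ₂ / 2) * (1 - γ₂ / 4) := by nlinarith
    refine e3.trans (mul_le_mul e2 e1 (by linarith) (by nlinarith))
  · have e1 : ε * c * 1024 ≤ Y := by
      have := mul_le_mul_of_nonneg_right hεK (Nat.cast_nonneg (α := ℝ) c)
      linarith
    have e2 : γ₂ / 4 * dd * c = Y := by rw [hY, hK]
    have e3 : ((n : ℝ) + 1) * (cst + Y / (8 * (n + 1)) + 1) =
        (n + 1) * (cst + 1) + (n + 1) * (Y / (8 * (n + 1))) := by ring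
    rw [e2, e3, hg]
    linarith
  · rw [hcst]
    have : (M : ℝ) ≤ M₀ := Nat.cast_le.2 hM
    gcongr
  · linarith
  · rw [hq]
  · have e1 : d * (q * Y / 32) ≤ d * (q * a) := mul_le_mul_of_nonneg_left hqa hd0.le
    have e2 : d * (n * 512) ≤ d * (q * Y) := mul_le_mul_of_nonneg_left hT3 hd0.le
    have e3 : 2 * σ / δ = 2 * (σ / δ) := by ring
    have e4 : 0 < d * q * Y := by positivity
    rw [e3]
    linarith
  · linarith
  · exact_mod_cast (by linarith : (a : ℝ) ≤ c)
  · rw [le_div_iff₀ (by positivity)]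
    linarith
  · linarith
  · have e1 : (b : ℝ) ≤ d * (Y / (8 * (n + 1))) / 2 := by
      rw [mul_div_assoc', div_div, le_div_iff₀ (by positivity)]
      linarith
    have e2 : 2 * σ ≤ d * (Y / (8 * (n + 1))) / 2 := by
      rw [mul_div_assoc', div_div, le_div_iff₀ (by positivity)]
      linarith
    linarith
  · have e1 : 4 * (h : ℝ) * (c / (ρ * N)) ≤ 4 * (ε' * N) * (c / (ρ * N)) :=
      mul_le_mul_of_nonneg_right (by linarith) (by positivity)
    refine e1.trans (le_of_eq ?_)
    rw [hε', hY]
    field_simp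
    ring

end

/-! ### The asymptotic skew Loebl-Komlós-Sós theorem. -/

section
open scoped Classical

/-- An asymptotic version of the skew Loebl-Komlós-Sós conjecture: if a positive proportion `1 / m`
of the vertices have degree a little above the order of a tree one of whose classes contains at
most a proportion `1 / m` of its vertices, then the graph contains the tree. -/
theorem exists_tree_embedding (m : ℕ) (hm : 2 ≤ m) (η : ℝ) (hη : 0 < η) (hη1 : η ≤ 1) :
    ∃ N₀ : ℕ, ∀ (V : Type) [Fintype V] (G : SimpleGraph V), N₀ ≤ Fintype.card V →
      ∀ (k : ℕ) (par : ℕ → ℕ) (cls : ℕ → Bool), 0 < k →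
        (∀ v, 0 < v → v < k → par v < v) → (∀ v, 0 < v → v < k → cls v ≠ cls (par v)) →
        m * ((Finset.range k).filter fun v => cls v = true).card ≤ k →
        Fintype.card V ≤ m * (Finset.univ.filter fun v =>
          (k : ℝ) + η * Fintype.card V ≤ G.degree v).card →
        ∃ φ : ℕ → V, Set.InjOn φ (Finset.range k) ∧
          ∀ v, 0 < v → v < k → G.Adj (φ (par v)) (φ v) := by
  have hm0 : (0 : ℝ) < m := by exact_mod_cast (by omega : 0 < m)
  have hm2 : (2 : ℝ) ≤ m := by exact_mod_cast hm
  obtain ⟨γ₂, hγ₂⟩ : ∃ γ₂, γ₂ = η / 8 := ⟨_, rfl⟩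
  obtain ⟨ρ, hρ⟩ : ∃ ρ, ρ = η / (32 * m) := ⟨_, rfl⟩
  have hγ₂0 : 0 < γ₂ := by rw [hγ₂]; positivity
  have hγ₂1 : γ₂ ≤ 1 := by rw [hγ₂]; linarith
  have hρ0 : 0 < ρ := by rw [hρ]; positivity
  have hρm : 4 * m * ρ = η / 8 := by rw [hρ]; field_simp; norm_num
  have hρ8 : 8 * ρ ≤ 4 * m * ρ := mul_le_mul_of_nonneg_right (by linarith) hρ0.le
  have hρ1 : ρ ≤ 1 := by linarith
  obtain ⟨ε, hε, hA⟩ := exists_embedding_of_reduced γ₂ ρ (ρ / 4) hγ₂0 hγ₂1 hρ0 (by positivity)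
    (by linarith)
  obtain ⟨M₀, hM₀⟩ := exists_reduced_graph ρ ε hρ0 hρ1 hε
  obtain ⟨N₀, hN₀⟩ := hA M₀
  refine ⟨max M₀ N₀ + 1, fun V _ G hN k par cls hk hpar hcls hx hdeg => ?_⟩
  obtain ⟨M, c, C, w, hM, hMM, hMc, hNc, hC, hCc, hw0, hsymm, wnn, wle, hdense, hL⟩ :=
    hM₀ V G (by have := le_max_left M₀ N₀; omega)
  obtain ⟨hc, hemb⟩ := hN₀ V G M c C w (by have := le_max_right M₀ N₀; omega) hMM hNc hC
    (fun i => (hCc i).1) hw0 hsymm hdense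
  obtain ⟨N, hNdef⟩ : ∃ N, N = Fintype.card V := ⟨_, rfl⟩
  rw [← hNdef] at hN hMc hNc hL hemb hdeg
  have hN0 : (0 : ℝ) < N := Nat.cast_pos.2 (by omega)
  have hc0 : (0 : ℝ) < c := Nat.cast_pos.2 hc
  set Λ := Finset.univ.filter fun v => (k : ℝ) + η * N ≤ G.degree v with hΛ
  have hΛN : (N : ℝ) / m ≤ Λ.card := by
    rw [div_le_iff₀ hm0, mul_comm]
    exact_mod_cast hdeg
  have hkN : (k : ℝ) + η * N ≤ N := by
    have h1 : (0 : ℝ) < Λ.card := lt_of_lt_of_le (by positivity) hΛN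
    obtain ⟨v, hv⟩ := Finset.card_pos.1 (by exact_mod_cast h1)
    refine (Finset.mem_filter.1 hv).2.trans ?_
    rw [hNdef]
    exact Nat.cast_le.2 (G.degree_lt_card_verts v).le
  have hkN' : (k : ℝ) ≤ N := by
    have := mul_pos hη hN0
    linarith
  obtain ⟨W, H, b, h, hcut, hmain⟩ := hemb k par cls hk (by exact_mod_cast hkN') hpar hcls
  have hk0 : (0 : ℝ) < k := Nat.cast_pos.2 hk
  obtain ⟨x, hxdef⟩ : ∃ x : ℕ, x = ((Finset.range k).filter fun v => cls v = true).card := ⟨_, rfl⟩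
  obtain ⟨y, hydef⟩ : ∃ y : ℕ, y = ((Finset.range k).filter fun v => cls v = false).card := ⟨_, rfl⟩
  have hxy : (x : ℝ) + y = k := by
    have h1 := Finset.card_filter_add_card_filter_not (s := Finset.range k) (fun v => cls v = true)
    simp only [Bool.not_eq_true, Finset.card_range] at h1
    rw [← hxdef, ← hydef] at h1
    exact_mod_cast h1
  have hmx : (m : ℝ) * x ≤ k := by
    rw [← hxdef] at hx
    exact_mod_cast hx
  have hX := hcut.rootTotal_add_otherTotal_le false
  have hY := hcut.rootTotal_add_otherTotal_le true
  simp only [Bool.not_false, Bool.not_true] at hX hY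
  rw [← hxdef] at hX
  rw [← hydef] at hY
  have hR0 : ∀ z, 0 ≤ rootTotal k par cls W z := fun z =>
    Finset.sum_nonneg fun t _ => Nat.cast_nonneg _
  have hO0 : ∀ z, 0 ≤ otherTotal k par cls W z := fun z =>
    Finset.sum_nonneg fun t _ => Nat.cast_nonneg _
  obtain ⟨R, hR⟩ : ∃ R, R = rootTotal k par cls W := ⟨_, rfl⟩
  obtain ⟨O, hO⟩ : ∃ O, O = otherTotal k par cls W := ⟨_, rfl⟩
  rw [← hR, ← hO] at hX hY hmain
  rw [← hR] at hR0
  rw [← hO] at hO0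
  have hρN : 0 < ρ * N := mul_pos hρ0 hN0
  -- Enlarging `k` by `e` keeps `r` below `1 / m - ρ`, although the smaller class is padded by `2 *
  -- ρ * N`: the gain is `e / m = 4 * ρ * N`, and the loss `ρ * (k + e)` is at most `2 * ρ * N`. The
  -- missing `ρ` pays for the loss of large-degree clusters.
  obtain ⟨e, he⟩ : ∃ e, e = 4 * m * ρ * N := ⟨_, rfl⟩
  have he8 : 8 * (ρ * N) ≤ e := by
    rw [he, ← mul_assoc]
    exact mul_le_mul_of_nonneg_right hρ8 hN0.le
  have heη : e = η * N / 8 := by rw [he, hρm]; ring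
  have hke : 0 < k + e := by linarith
  obtain ⟨κ, hκ⟩ : ∃ κ, κ = (1 + γ₂) * (k + e) / c := ⟨_, rfl⟩
  obtain ⟨r, hr⟩ : ∃ r, r = (x + 2 * (ρ * N)) / (k + e) := ⟨_, rfl⟩
  have h1γ : 0 < 1 + γ₂ := by linarith
  have hκ0 : 0 < κ := by rw [hκ]; positivity
  have hr0 : 0 < r := by
    rw [hr]
    have : (0 : ℝ) ≤ x := Nat.cast_nonneg _
    positivity
  have hr2 : r ≤ 1 / 2 := by
    rw [hr, div_le_iff₀ hke]
    have : 2 * (x : ℝ) ≤ m * x := mul_le_mul_of_nonneg_right hm2 (Nat.cast_nonneg _)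
    linarith
  have hrm : r * N ≤ N / m - ρ * N := by
    have h1 : r ≤ 1 / m - ρ := by
      rw [hr, div_le_iff₀ hke]
      have e1 : (x : ℝ) ≤ k / m := by rw [le_div_iff₀ hm0]; linarith
      have e2 : (1 / m - ρ) * (k + e) = k / m + 4 * (ρ * N) - ρ * k - ρ * e := by
        rw [he]
        field_simp
        ring
      have e3 : ρ * k ≤ ρ * N := mul_le_mul_of_nonneg_left hkN' hρ0.le
      have e4 : ρ * e ≤ ρ * N := mul_le_mul_of_nonneg_left (by rw [heη]; nlinarith) hρ0.le
      rw [e2]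
      linarith
    have := mul_le_mul_of_nonneg_right h1 hN0.le
    calc r * N ≤ (1 / m - ρ) * N := this
      _ = N / m - ρ * N := by ring
  have hrκ : r * κ * c = (1 + γ₂) * (x + 2 * (ρ * N)) := by
    rw [hr, hκ]
    field_simp
  have hκc : κ * c = (1 + γ₂) * (k + e) := by
    rw [hκ]
    field_simp
  have hκlt : (1 + γ₂) * (k + e) < k + η * N - ρ * N := by
    have e1 : γ₂ * k ≤ γ₂ * N := mul_le_mul_of_nonneg_left hkN' hγ₂0.le
    have e2 : γ₂ * e ≤ e := mul_le_of_le_one_left (by linarith) hγ₂1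
    have e3 : γ₂ * N = η * N / 8 := by rw [hγ₂]; ring
    have e4 : 0 < η * N := mul_pos hη hN0
    have e5 : (1 + γ₂) * (k + e) = k + e + γ₂ * k + γ₂ * e := by ring
    rw [e5]
    linarith
  set L := Finset.univ.filter fun i => κ < ∑ j, w i j with hLdef
  have hLc : (N : ℝ) / m - ρ * N ≤ c * L.card := by
    have h1 := hL (k + η * N)
    rw [← hΛ] at h1
    have h2 : (Finset.univ.filter fun i => (k : ℝ) + η * N - ρ * N ≤ c * ∑ j, w i j) ⊆ L := by
      intro i hi
      refine Finset.mem_filter.2 ⟨Finset.mem_univ _, ?_⟩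
      have h3 := hκlt.trans_le (Finset.mem_filter.1 hi).2
      rw [← hκc, mul_comm] at h3
      exact lt_of_mul_lt_mul_left h3 hc0.le
    have h3 := mul_le_mul_of_nonneg_left (Nat.cast_le (α := ℝ).2 (Finset.card_le_card h2)) hc0.le
    linarith
  have hcard : r * Fintype.card (Fin M) ≤ L.card := by
    rw [Fintype.card_fin]
    have h1 : (M : ℝ) * c ≤ N := by exact_mod_cast hMc
    have h2 := mul_le_mul_of_nonneg_left h1 hr0.le
    have h3 : c * (r * M) ≤ c * L.card := by linarith
    exact le_of_mul_le_mul_left h3 hc0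
  have hne : L.Nonempty := by
    rw [← Finset.card_pos]
    have h1 : (0 : ℝ) < r * Fintype.card (Fin M) := by
      rw [Fintype.card_fin]
      exact mul_pos hr0 (Nat.cast_pos.2 hM)
    exact_mod_cast h1.trans_le hcard
  -- The factor `s` converts vertices to cluster units and includes the slack `γ₂`. Adding `ρ * N`
  -- to each total makes the demands positive and bounds the root mass in a cluster by `c / (ρ *
  -- N)`.
  obtain ⟨s, hs⟩ : ∃ s, s = (1 + γ₂) / c := ⟨_, rfl⟩
  have hs0 : 0 < s := by rw [hs]; positivity
  have hsc : s * c = 1 + γ₂ := by rw [hs]; field_simp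
  have hpos : ∀ z : ℝ, 0 ≤ z → 0 < s * (z + ρ * N) := fun z hz => mul_pos hs0 (by linarith)
  -- Class `true` is the small one. Its seeds go to `A`, so `a₂ + b₁` measures the small class and
  -- `a₁ + b₂` the large one.
  obtain ⟨A, B, α, β, hAB, α0, β0, αpos, βpos, α1, β1, hload, hβB, hαA⟩ :=
    exists_allocation w hsymm wnn wle κ r hκ0 hr0 hr2 L (fun v hv => (Finset.mem_filter.1 hv).2)
      hcard hne (s * (R true + ρ * N)) (s * (O true + ρ * N)) (s * (R false + ρ * N))
      (s * (O false + ρ * N)) (hpos _ (hR0 _)) (hpos _ (hO0 _)) (hpos _ (hR0 _)) (hpos _ (hO0 _))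
      (by
        refine le_of_mul_le_mul_right (a := (c : ℝ)) ?_ hc0
        rw [hrκ]
        calc (s * (O true + ρ * N) + s * (R false + ρ * N)) * c =
            s * c * (R false + O true + 2 * (ρ * N)) := by ring
          _ ≤ _ := by
            rw [hsc]
            exact mul_le_mul_of_nonneg_left (by linarith) h1γ.le)
      (by
        refine le_of_mul_le_mul_right (a := (c : ℝ)) ?_ hc0
        have e1 : (1 - r) * κ * c = (1 + γ₂) * (k + e - (x + 2 * (ρ * N))) := by
          have : (1 - r) * κ * c = κ * c - r * κ * c := by ring
          rw [this, hκc, hrκ]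
          ring
        rw [e1]
        calc (s * (R true + ρ * N) + s * (O false + ρ * N)) * c =
            s * c * (R true + O false + 2 * (ρ * N)) := by ring
          _ ≤ _ := by
            rw [hsc]
            exact mul_le_mul_of_nonneg_left (by linarith) h1γ.le)
  have hαr : ∀ i, 0 ≤ ∑ j, α i j := fun i => Finset.sum_nonneg fun j _ => α0 i j
  have hαc : ∀ i, 0 ≤ ∑ j, α j i := fun i => Finset.sum_nonneg fun j _ => α0 j i
  have hβr : ∀ i, 0 ≤ ∑ j, β i j := fun i => Finset.sum_nonneg fun j _ => β0 i j
  have hβc : ∀ i, 0 ≤ ∑ j, β j i := fun i => Finset.sum_nonneg fun j _ => β0 j i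
  have hscale : ∀ z u : ℝ, 0 ≤ u → (1 + γ₂) * (z * u) ≤ c * (s * (z + ρ * N) * u) := by
    intro z u hu
    have e1 : c * (s * (z + ρ * N) * u) = s * c * ((z + ρ * N) * u) := by ring
    rw [e1, hsc]
    refine mul_le_mul_of_nonneg_left (mul_le_mul_of_nonneg_right ?_ hu) h1γ.le
    linarith
  have hrow : ∀ z u : ℝ, 0 ≤ z → 0 ≤ u → s * (z + ρ * N) * u ≤ 1 → ρ * N * u ≤ c := by
    intro z u hz hu h
    have e1 := mul_le_mul_of_nonneg_left h hc0.le
    have e2 : c * (s * (z + ρ * N) * u) = s * c * ((z + ρ * N) * u) := by ring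
    rw [e2, hsc, mul_one] at e1
    have e3 : 0 ≤ z * u := mul_nonneg hz hu
    have e4 : 0 ≤ ρ * N * u := mul_nonneg hρN.le hu
    have e5 : 0 ≤ γ₂ * ((z + ρ * N) * u) := mul_nonneg hγ₂0.le (by linarith)
    linarith
  refine hmain (fun z => if z then A else B) (fun z => if z then α else β) hAB ?_ ?_ ?_ ?_ ?_ ?_ ?_
  · rintro (_ | _)
    · exact β0
    · exact α0
  · rintro (_ | _)
    · exact βpos
    · exact αpos
  · rintro (_ | _)
    · exact β1
    · exact α1
  · intro i
    rw [Fintype.sum_bool]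
    simp only [if_true, Bool.false_eq_true, if_false]
    have h1 := mul_le_mul_of_nonneg_left (hload i) hc0.le
    have e1 := hscale (R true) _ (hαr i)
    have e2 := hscale (O true) _ (hαc i)
    have e3 := hscale (R false) _ (hβr i)
    have e4 := hscale (O false) _ (hβc i)
    linarith
  · intro i
    exact (hscale (R false) _ (hβr i)).trans (mul_le_mul_of_nonneg_left (hβB i) hc0.le)
  · intro i hi
    simp only [if_true, Bool.false_eq_true, if_false] at hi ⊢
    obtain ⟨j, -, hj⟩ := Finset.exists_lt_of_sum_lt (s := Finset.univ) (f := fun _ => (0 : ℝ))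
      (g := fun j => α i j) (by simpa using hi)
    have h1 := mul_le_mul_of_nonneg_left (hαA i ⟨j, hj⟩) hc0.le
    have e1 := hscale (R true) _ (hαr i)
    have e3 := hscale (R false) _ (hβr i)
    linarith
  · have hterm : ∀ z u : ℝ, 0 ≤ z → 0 ≤ u → 0 ≤ s * (z + ρ * N) * u := fun z u hz hu =>
      mul_nonneg (hpos z hz).le hu
    rintro (_ | _) i
    · change ρ * N * ∑ j, β i j ≤ c
      refine hrow (R false) _ (hR0 _) (hβr i) ?_
      have e1 := hterm (R true) _ (hR0 _) (hαr i)
      have e2 := hterm (O true) _ (hO0 _) (hαc i)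
      have e4 := hterm (O false) _ (hO0 _) (hβc i)
      linarith [hload i]
    · change ρ * N * ∑ j, α i j ≤ c
      refine hrow (R true) _ (hR0 _) (hαr i) ?_
      have e2 := hterm (O true) _ (hO0 _) (hαc i)
      have e3 := hterm (R false) _ (hR0 _) (hβr i)
      have e4 := hterm (O false) _ (hO0 _) (hβc i)
      linarith [hload i]

end

/-! ### Numbering trees, pigeonhole over colours and the error function. -/

section
open scoped Classical

/-- Geodesics to `v` and to `v'`, each extended by one edge, are paths to `u`. They coincide in a
tree, hence so do their penultimate vertices. -/
theorem SimpleGraph.IsTree.eq_of_adj_of_dist {V : Type*} {T : SimpleGraph V} (hT : T.IsTree)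
    {r u v v' : V} (h : T.Adj v u) (h' : T.Adj v' u) (hd : T.dist r u = T.dist r v + 1)
    (hd' : T.dist r u = T.dist r v' + 1) : v = v' := by
  obtain ⟨p, hp⟩ := hT.connected.exists_walk_length_eq_dist r v
  obtain ⟨p', hp'⟩ := hT.connected.exists_walk_length_eq_dist r v'
  have h1 : (p.concat h).IsPath := SimpleGraph.Walk.isPath_of_length_eq_dist _ (by
    rw [SimpleGraph.Walk.length_concat, hp, hd])
  have h2 : (p'.concat h').IsPath := SimpleGraph.Walk.isPath_of_length_eq_dist _ (by
    rw [SimpleGraph.Walk.length_concat, hp', hd'])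
  have h3 := (hT.existsUnique_path r u).unique h1 h2
  have h4 := congrArg SimpleGraph.Walk.penultimate h3
  simpa using h4

theorem SimpleGraph.IsTree.exists_adj_dist {V : Type*} {T : SimpleGraph V} (hT : T.IsTree)
    {r v : V} (h : v ≠ r) : ∃ u, T.Adj u v ∧ T.dist r v = T.dist r u + 1 := by
  obtain ⟨p, hp⟩ := hT.connected.exists_walk_length_eq_dist v r
  cases p with
  | nil => exact absurd rfl h
  | @cons _ u _ hvu q =>
    refine ⟨u, hvu.symm, ?_⟩
    rw [SimpleGraph.Walk.length_cons, SimpleGraph.dist_comm] at hp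
    have h1 := SimpleGraph.dist_le q
    rw [SimpleGraph.dist_comm] at h1
    rcases hT.dist_eq_dist_add_one_of_adj r hvu with h2 | h2 <;> omega

/-- The vertices of a tree can be numbered so that each but the first has one smaller neighbour. -/
theorem SimpleGraph.IsTree.exists_numbering {V : Type*} [Fintype V] {T : SimpleGraph V}
    (hT : T.IsTree) :
    ∃ (f : ℕ → V) (idx : V → ℕ) (par : ℕ → ℕ), (∀ v, idx v < Fintype.card V ∧ f (idx v) = v) ∧
      (∀ i < Fintype.card V, idx (f i) = i) ∧
      (∀ i, 0 < i → i < Fintype.card V → par i < i ∧ T.Adj (f (par i)) (f i)) ∧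
      ∀ u v, T.Adj u v → (0 < idx v ∧ idx u = par (idx v)) ∨ (0 < idx u ∧ idx v = par (idx u)) := by
  obtain ⟨r⟩ := hT.connected.nonempty
  set e₀ := (Fintype.equivFin V).symm with he₀
  -- Sorting by distance from `r` puts the neighbour one step closer before the vertex; ties are
  -- irrelevant, since adjacent vertices differ in distance by one.
  set e : Fin (Fintype.card V) ≃ V :=
    (Tuple.sort fun i => T.dist r (e₀ i)).trans e₀ with he
  have hmono : Monotone fun i => T.dist r (e i) := Tuple.monotone_sort fun i => T.dist r (e₀ i)
  set idx : V → ℕ := fun v => (e.symm v : ℕ) with hidx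
  set f : ℕ → V := fun i => if h : i < Fintype.card V then e ⟨i, h⟩ else r with hf
  have h1 : ∀ v, idx v < Fintype.card V ∧ f (idx v) = v := by
    intro v
    refine ⟨(e.symm v).2, ?_⟩
    simp only [hf, hidx]
    rw [dif_pos (e.symm v).2]
    exact e.apply_symm_apply v
  have h2 : ∀ i < Fintype.card V, idx (f i) = i := by
    intro i hi
    simp only [hf, hidx]
    rw [dif_pos hi, e.symm_apply_apply]
  have hlt : ∀ u v, T.dist r u < T.dist r v → idx u < idx v := by
    intro u v huv
    by_contra h
    have h3 : e.symm v ≤ e.symm u := Fin.le_def.2 (not_lt.1 h)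
    have h4 := hmono h3
    simp only [Equiv.apply_symm_apply] at h4
    omega
  have hr : ∀ v, v ≠ r → 0 < idx v := by
    intro v hv
    refine lt_of_le_of_lt (Nat.zero_le (idx r)) (hlt r v ?_)
    rw [SimpleGraph.dist_self]
    exact hT.connected.pos_dist_of_ne hv.symm
  have hr0 : ∀ i, 0 < i → i < Fintype.card V → f i ≠ r := by
    intro i hi hik h
    have h3 : f 0 ≠ r := by
      intro h0
      have e1 := h2 i hik
      have e2 := h2 0 (hi.trans hik)
      rw [h] at e1
      rw [h0] at e2
      omega
    have h4 : idx r < idx (f 0) := hlt r (f 0) (by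
      rw [SimpleGraph.dist_self]
      exact hT.connected.pos_dist_of_ne h3.symm)
    rw [h2 0 (hi.trans hik)] at h4
    exact absurd h4 (Nat.not_lt_zero _)
  have hpar : ∀ v, ∃ u, v ≠ r → T.Adj u v ∧ T.dist r v = T.dist r u + 1 := by
    intro v
    by_cases hv : v = r
    · exact ⟨r, fun h => absurd hv h⟩
    · obtain ⟨u, hu⟩ := hT.exists_adj_dist hv
      exact ⟨u, fun _ => hu⟩
  choose p hp using hpar
  refine ⟨f, idx, fun i => idx (p (f i)), h1, h2, ?_, ?_⟩
  · intro i hi hik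
    obtain ⟨g1, g2⟩ := hp (f i) (hr0 i hi hik)
    refine ⟨?_, ?_⟩
    · have := hlt (p (f i)) (f i) (by omega)
      rwa [h2 i hik] at this
    · rw [(h1 (p (f i))).2]
      exact g1
  · have key : ∀ u v, T.Adj u v → T.dist r v = T.dist r u + 1 →
        0 < idx v ∧ idx u = idx (p (f (idx v))) := by
      intro u v huv hd
      have hv : v ≠ r := by
        rintro rfl
        rw [SimpleGraph.dist_self] at hd
        omega
      obtain ⟨g1, g2⟩ := hp v hv
      refine ⟨hr v hv, ?_⟩
      rw [(h1 v).2, hT.eq_of_adj_of_dist huv g1 hd g2]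
    intro u v huv
    rcases hT.dist_eq_dist_add_one_of_adj r huv with h | h
    · exact Or.inr (key v u huv.symm h)
    · exact Or.inl (key u v huv h)

theorem isContained_of_degrees (m : ℕ) (hm : 2 ≤ m) (η : ℝ) (hη : 0 < η) (hη1 : η ≤ 1) :
    ∃ N₀ : ℕ, ∀ (V : Type) [Fintype V] (G : SimpleGraph V), N₀ ≤ Fintype.card V →
      ∀ {U : Type*} [Fintype U] (T : SimpleGraph U), T.IsTree → ∀ C : T.Coloring (Fin 2),
        m * (C.colorClass 0).ncard ≤ Fintype.card U →
        Fintype.card V ≤ m * (Finset.univ.filter fun v =>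
          (Fintype.card U : ℝ) + η * Fintype.card V ≤ G.degree v).card →
        T.IsContained G := by
  obtain ⟨N₀, h⟩ := exists_tree_embedding m hm η hη hη1
  refine ⟨N₀, fun V _ G hN U _ T hT C hC hdeg => ?_⟩
  obtain ⟨f, idx, par, h1, h2, h3, h4⟩ := hT.exists_numbering
  have hfin : ∀ a b : Fin 2, a ≠ b → decide (a = 0) ≠ decide (b = 0) := by decide
  have hU : 0 < Fintype.card U := by
    obtain ⟨r⟩ := hT.connected.nonempty
    exact Fintype.card_pos_iff.2 ⟨r⟩
  have hcount : ((Finset.range (Fintype.card U)).filter fun v => decide (C (f v) = 0) = true).card ≤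
      (C.colorClass 0).ncard := by
    rw [Set.ncard_eq_toFinset_card']
    refine Finset.card_le_card_of_injOn f ?_ ?_
    · intro v hv
      rw [Finset.mem_coe, Set.mem_toFinset]
      exact of_decide_eq_true (Finset.mem_filter.1 hv).2
    · intro u hu v hv huv
      have e1 := h2 u (Finset.mem_range.1 (Finset.mem_filter.1 hu).1)
      have e2 := h2 v (Finset.mem_range.1 (Finset.mem_filter.1 hv).1)
      rw [← e1, ← e2, huv]
  obtain ⟨φ, g1, g2⟩ := h V G hN (Fintype.card U) par (fun v => decide (C (f v) = 0)) hU
    (fun v h0 hv => (h3 v h0 hv).1)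
    (fun v h0 hv => hfin _ _ (C.valid (h3 v h0 hv).2).symm)
    ((Nat.mul_le_mul_left m hcount).trans hC) hdeg
  refine ⟨⟨⟨fun v => φ (idx v), ?_⟩, ?_⟩⟩
  · intro u v huv
    rcases h4 u v huv with ⟨e1, e2⟩ | ⟨e1, e2⟩
    · simp only [e2]
      exact g2 _ e1 (h1 v).1
    · simp only [e2]
      exact (g2 _ e1 (h1 u).1).symm
  · intro u v huv
    have e1 : idx u = idx v := g1 (Finset.mem_coe.2 (Finset.mem_range.2 (h1 u).1))
      (Finset.mem_coe.2 (Finset.mem_range.2 (h1 v).1)) huv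
    rw [← (h1 u).2, ← (h1 v).2, e1]

/-- In an edge-coloured complete graph, some colour has many vertices of large degree. -/
theorem exists_label_card_le {m N : ℕ} (hm : 0 < m) (hN0 : 0 < N)
    (c : SimpleGraph.TopEdgeLabeling (Fin N) (Fin m)) (k : Fin m → ℝ) (hk : ∑ i, k i ≤ N - 1) :
    ∃ i, N ≤ m * (Finset.univ.filter fun v => k i ≤ (c.labelGraph i).degree v).card := by
  -- The colour neighbourhoods of `v` cover the other `N - 1` vertices, so the degrees cannot all
  -- lie below thresholds with sum at most `N - 1`.
  have hvert : ∀ v : Fin N, ∃ i, k i ≤ (c.labelGraph i).degree v := by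
    intro v
    by_contra hcon
    push Not at hcon
    have h1 : (Finset.univ.erase v).card ≤ ∑ i, (c.labelGraph i).degree v := by
      refine le_trans (Finset.card_le_card (t := Finset.univ.biUnion fun i =>
        (c.labelGraph i).neighborFinset v) ?_) Finset.card_biUnion_le
      intro u hu
      have hvu : v ≠ u := (Finset.ne_of_mem_erase hu).symm
      refine Finset.mem_biUnion.2 ⟨c.get v u hvu, Finset.mem_univ _, ?_⟩
      rw [SimpleGraph.mem_neighborFinset, SimpleGraph.TopEdgeLabeling.labelGraph_adj]
      exact ⟨hvu, rfl⟩
    rw [Finset.card_erase_of_mem (Finset.mem_univ v), Finset.card_univ, Fintype.card_fin] at h1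
    have h2 : ((N - 1 : ℕ) : ℝ) ≤ ∑ i, ((c.labelGraph i).degree v : ℝ) := by exact_mod_cast h1
    rw [Nat.cast_sub hN0, Nat.cast_one] at h2
    have hne : Nonempty (Fin m) := ⟨⟨0, hm⟩⟩
    have h3 : ∑ i, ((c.labelGraph i).degree v : ℝ) < ∑ i, k i :=
      Finset.sum_lt_sum_of_nonempty (Finset.univ_nonempty) fun i _ => hcon i
    linarith
  by_contra hcon
  push Not at hcon
  choose g hg using hvert
  have h1 : (Finset.univ : Finset (Fin N)).card =
      ∑ i, (Finset.univ.filter fun v => g v = i).card :=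
    Finset.card_eq_sum_card_fiberwise fun v _ => Finset.mem_coe.2 (Finset.mem_univ _)
  rw [Finset.card_univ, Fintype.card_fin] at h1
  have h2 : ∀ i, m * (Finset.univ.filter fun v => g v = i).card < N := by
    intro i
    refine lt_of_le_of_lt (Nat.mul_le_mul_left m (Finset.card_le_card fun v hv => ?_)) (hcon i)
    have := (Finset.mem_filter.1 hv).2
    exact Finset.mem_filter.2 ⟨Finset.mem_univ _, this ▸ hg v⟩
  have hm0 : 0 < m := (g ⟨0, hN0⟩).pos
  have h3 : ∑ i : Fin m, m * (Finset.univ.filter fun v => g v = i).card < ∑ _i : Fin m, N :=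
    Finset.sum_lt_sum_of_nonempty ⟨⟨0, hm0⟩, Finset.mem_univ _⟩ fun i _ => h2 i
  rw [← Finset.mul_sum, ← h1, Finset.sum_const, Finset.card_univ, Fintype.card_fin,
    smul_eq_mul] at h3
  exact lt_irrefl _ h3

/-- `N` vertices suffice for all families of skewed trees with `s` vertices in total. -/
def ArrowsSkewedTrees.{u} (m s N : ℕ) : Prop :=
  ∀ (V : Fin m → Type u) [∀ i, Fintype (V i)] (T : ∀ i, SimpleGraph (V i)),
    (∀ i, (T i).IsTree) →
    (∀ i, ∃ C : (T i).Coloring (Fin 2),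
      ((C.colorClass 0).ncard : ℝ) ≤ (Fintype.card (V i) : ℝ) / m) →
    ∑ i, Fintype.card (V i) = s → RamseyArrows N T

/-- One colour is treated apart, since the embedding theorem assumes `2 ≤ m` in order to have `r ≤ 1
/ 2`. -/
theorem arrowsSkewedTrees_one (s : ℕ) : ArrowsSkewedTrees 1 s s := by
  intro V _ T _ _ hs c
  refine ⟨0, ?_⟩
  rw [Fin.sum_univ_one] at hs
  have e := Fintype.equivFinOfCardEq hs
  refine ⟨⟨⟨e, ?_⟩, e.injective⟩⟩
  intro u v huv
  rw [SimpleGraph.TopEdgeLabeling.labelGraph_adj]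
  exact ⟨fun h => huv.ne (e.injective h), Subsingleton.elim _ _⟩

/-- The error `η * N` is shared equally by the colours, and the extra `1` accounts for a vertex
having only `N - 1` neighbours. -/
theorem arrowsSkewedTrees_of_le (m : ℕ) (hm : 2 ≤ m) (η : ℝ) (hη : 0 < η) (hη1 : η ≤ 1) :
    ∃ N₀ : ℕ, ∀ s N : ℕ, N₀ ≤ N → (s : ℝ) + η * N + 1 ≤ N → ArrowsSkewedTrees m s N := by
  have hm0 : (0 : ℝ) < m := by exact_mod_cast (by omega : 0 < m)
  have hm1 : (1 : ℝ) ≤ m := by exact_mod_cast (by omega : 1 ≤ m)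
  obtain ⟨N₀, h⟩ := isContained_of_degrees m hm (η / m) (by positivity)
    ((div_le_one hm0).2 (hη1.trans hm1))
  refine ⟨N₀, fun s N hN hsN V _ T hT hC hs c => ?_⟩
  have hN0 : 0 < N := by
    rcases Nat.eq_zero_or_pos N with h0 | h0
    · rw [h0, Nat.cast_zero, mul_zero] at hsN
      linarith [Nat.cast_nonneg (α := ℝ) s]
    · exact h0
  obtain ⟨i, hi⟩ := exists_label_card_le (by omega) hN0 c
    (fun i => (Fintype.card (V i) : ℝ) + η / m * N) (by
      rw [Finset.sum_add_distrib, Finset.sum_const, Finset.card_univ, Fintype.card_fin,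
        nsmul_eq_mul, ← Nat.cast_sum, hs]
      have : (m : ℝ) * (η / m * N) = η * N := by field_simp
      rw [this]
      linarith)
  obtain ⟨C, hCi⟩ := hC i
  refine ⟨i, h (Fin N) (c.labelGraph i) (by rwa [Fintype.card_fin]) (T i) (hT i) C ?_ ?_⟩
  · rw [le_div_iff₀ hm0, mul_comm] at hCi
    exact_mod_cast hCi
  · rw [Fintype.card_fin]
    convert hi

theorem exists_arrowsSkewedTrees (m s : ℕ) (hm : 1 ≤ m) : ∃ N, ArrowsSkewedTrees m s N := by
  rcases hm.eq_or_lt with rfl | hm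
  · exact ⟨s, arrowsSkewedTrees_one s⟩
  · obtain ⟨N₀, h⟩ := arrowsSkewedTrees_of_le m hm (1 / 2) (by norm_num) (by norm_num)
    -- For `η = 1 / 2` the inequality `s + N / 2 + 1 ≤ N` means `N ≥ 2 * s + 2`.
    refine ⟨N₀ + 2 * s + 2, h s _ (by omega) ?_⟩
    push_cast
    linarith [Nat.cast_nonneg (α := ℝ) N₀]

theorem exists_arrowsSkewedTrees_le (m : ℕ) (hm : 1 ≤ m) (η : ℝ) (hη : 0 < η) (hη1 : η ≤ 1) :
    ∀ᶠ s : ℕ in Filter.atTop, ∃ N : ℕ, (N : ℝ) ≤ s + η * s ∧ ArrowsSkewedTrees m s N := by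
  rcases hm.eq_or_lt with rfl | hm
  · refine Filter.Eventually.of_forall fun s => ⟨s, ?_, arrowsSkewedTrees_one s⟩
    linarith [mul_nonneg hη.le (Nat.cast_nonneg (α := ℝ) s)]
  · obtain ⟨N₀, h⟩ := arrowsSkewedTrees_of_le m hm (η / 4) (by positivity) (by linarith)
    have h1 : ∀ᶠ s : ℕ in Filter.atTop, (4 : ℝ) ≤ η * s :=
      (tendsto_natCast_atTop_atTop.const_mul_atTop hη).eventually_ge_atTop 4
    filter_upwards [h1, Filter.eventually_ge_atTop N₀] with s hs hsN
    have hs0 : (0 : ℝ) ≤ s := Nat.cast_nonneg s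
    have h2 : (⌊(s : ℝ) + η * s⌋₊ : ℝ) ≤ s + η * s := Nat.floor_le (by positivity)
    have h3 := Nat.lt_floor_add_one ((s : ℝ) + η * s)
    refine ⟨⌊(s : ℝ) + η * s⌋₊, h2, h s _ ?_ ?_⟩
    · refine hsN.trans (Nat.le_floor ?_)
      linarith
    · have h4 : η * s ≤ s := mul_le_of_le_one_left hs0 hη1
      have h5 : η / 4 * (⌊(s : ℝ) + η * s⌋₊ : ℝ) ≤ η / 4 * (2 * s) :=
        mul_le_mul_of_nonneg_left (by linarith) (by positivity)
      linarith

end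

/-- For each number of colours `m ≥ 1` there is an error function `f` with `f s = o(s)` that serves
all families of `m` skewed trees. The Ramsey number is also claimed to be well defined. -/
theorem corollary7p1 (m : ℕ) (hm : 1 ≤ m) :
    ∃ f : ℕ → ℝ, f =o[Filter.atTop] (fun s : ℕ => (s : ℝ)) ∧
      ∀ (V : Fin m → Type*) [∀ i, Fintype (V i)] (T : ∀ i, SimpleGraph (V i)),
        (∀ i, (T i).IsTree) →
        (∀ i, ∃ C : (T i).Coloring (Fin 2),
          ((C.colorClass 0).ncard : ℝ) ≤ (Fintype.card (V i) : ℝ) / m) →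
        RamseyArrows (ramseyNumber T) T ∧
          (ramseyNumber T : ℝ) ≤
            ((∑ i, Fintype.card (V i) : ℕ) : ℝ) + f (∑ i, Fintype.card (V i)) := by
  have hmem : ∀ s, ArrowsSkewedTrees m s (sInf {N | ArrowsSkewedTrees m s N}) := fun s =>
    Nat.sInf_mem (exists_arrowsSkewedTrees m s hm)
  -- The set of numbers that work is nonempty for every `s`, so its infimum belongs to it and is not
  -- a default value. The maximum with `0` makes the norm in the little-o estimate trivial.
  refine ⟨fun s => max ((sInf {N | ArrowsSkewedTrees m s N} : ℕ) - (s : ℝ)) 0, ?_, ?_⟩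
  · rw [Asymptotics.isLittleO_iff]
    intro ε hε
    filter_upwards [exists_arrowsSkewedTrees_le m hm (min ε 1) (lt_min hε one_pos)
      (min_le_right _ _)] with s ⟨N, hN, hNs⟩
    have h1 : ((sInf {N | ArrowsSkewedTrees m s N} : ℕ) : ℝ) ≤ N := by
      exact_mod_cast Nat.sInf_le hNs
    have h2 : min ε 1 * (s : ℝ) ≤ ε * s :=
      mul_le_mul_of_nonneg_right (min_le_left _ _) (Nat.cast_nonneg s)
    rw [Real.norm_of_nonneg (le_max_right _ _), Real.norm_of_nonneg (Nat.cast_nonneg s)]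
    exact max_le (by linarith) (by positivity)
  · intro V _ T hT hC
    have h1 := hmem _ V T hT hC rfl
    refine ⟨Nat.sInf_mem (s := {N | RamseyArrows N T}) ⟨_, h1⟩, ?_⟩
    have h2 : (ramseyNumber T : ℝ) ≤
        (sInf {N | ArrowsSkewedTrees m (∑ i, Fintype.card (V i)) N} : ℕ) := by
      exact_mod_cast Nat.sInf_le (s := {N | RamseyArrows N T}) h1
    have h3 := le_max_left
      (((sInf {N | ArrowsSkewedTrees m (∑ i, Fintype.card (V i)) N} : ℕ) : ℝ) -
        ((∑ i, Fintype.card (V i) : ℕ) : ℝ)) 0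
    linarith
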